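/- Let $a\in\mathbb{C}$ with $-\frac12<\mathrm{Re}(a)<\frac12$ and let $f:\mathbb{R}\to\mathbb{C}$ be a Schwartz function. Let $F$ be the Mellin transform of $f$, that is, the analytic continuation of $s\mapsto\int_0^\infty f(x)x^{s-1}\,dx$ ($\mathrm{Re}(s)>0$) to $\mathbb{C}\setminus\{0,-1,-2,\dots\}$, and suppose that $F$ decays faster than any polynomial in every bounded vertical strip, i.e. for all real $\sigma_1,\sigma_2$ and all $N\in\mathbb{N}$ the function $|F(s)|\,|\mathrm{Im}(s)|^N$ is bounded on $\{s:\sigma_1\le\mathrm{Re}(s)\le\sigma_2,\ |\mathrm{Im}(s)|\ge1\}$. Put $\sigma_a(n)=\sum_{d\mid n}d^a$, let $\zeta$ be the Riemann zeta function, and let $$J_\nu(z)=\sum_{m=0}^\infty\frac{(-1)^m(z/2)^{2m+\nu}}{m!\,\Gamma(m+1+\nu)},\qquad I_\nu(z)=\sum_{m=0}^\infty\frac{(z/2)^{2m+\nu}}{m!\,\Gamma(m+1+\nu)},$$ $$Y_\nu(z)=\frac{J_\nu(z)\cos(\pi\nu)-J_{-\nu}(z)}{\sin(\pi\nu)},\qquad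 K_\nu(z)=\frac{\pi}{2}\,\frac{I_{-\nu}(z)-I_\nu(z)}{\sin(\pi\nu)}$$ be the Bessel functions, where $Y_\nu$ and $K_\nu$ at integers $\nu$ are defined as limits in $\nu$. Then \begin{align*} \sum_{n=1}^\infty\sigma_a(n)f(n)={}&\int_0^\infty\bigl(\zeta(1-a)+t^a\zeta(1+a)\bigr)f(t)\,dt-\frac12\zeta(-a)f(0^+)\\ &+2\pi\sum_{n=1}^\infty\sigma_a(n)n^{-a/2}\int_0^\infty y^{a/2}f(y)\Bigl\{\Bigl(\frac2\pi K_a(4\pi\sqrt{ny})-Y_a(4\pi\sqrt{ny})\Bigr)\cos\Bigl(\frac{\pi a}2\Bigr)-J_a(4\pi\sqrt{ny})\sin\Bigl(\frac{\pi a}2\Bigr)\Bigr\}\,dy, \end{align*} where for $a=0$ the factor $\zeta(1-a)+t^a\zeta(1+a)$ denotes its limit $2\gamma+\log t$ as $a\to0$ ($\gamma$ being Euler's constant). Both series converge absolutely, and so do all the integrals. -/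

import Mathlib

open scoped SchwartzMap Topology

noncomputable section

namespace Voronoi

/-- The divisor function `σ_a(n) = ∑_{d ∣ n} d^a` for a complex exponent `a`. -/
def sigma (a : ℂ) (n : ℕ) : ℂ := ∑ d ∈ n.divisors, (d : ℂ) ^ a

/-- The Bessel function of the first kind,
`J_ν(z) = ∑_{m ≥ 0} (-1)^m (z/2)^{2m+ν} / (m! Γ(m+1+ν))`, with the principal power.
Mathlib's `Gamma` is `0` at its poles, so that `1 / Γ` is `0` there, as it should be. -/
def besselJ (ν z : ℂ) : ℂ :=
  ∑' m : ℕ, (-1) ^ m * (z / 2) ^ (2 * (m : ℂ) + ν) /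
    ((m.factorial : ℂ) * Complex.Gamma ((m : ℂ) + 1 + ν))

/-- The modified Bessel function of the first kind,
`I_ν(z) = ∑_{m ≥ 0} (z/2)^{2m+ν} / (m! Γ(m+1+ν))`, with the principal power. -/
def besselI (ν z : ℂ) : ℂ :=
  ∑' m : ℕ, (z / 2) ^ (2 * (m : ℂ) + ν) /
    ((m.factorial : ℂ) * Complex.Gamma ((m : ℂ) + 1 + ν))

open Classical in
/-- The Bessel function of the second kind: `(J_ν(z) cos πν - J_{-ν}(z)) / sin πν` for
`ν` not an integer, and the limit of this expression in the order at integers. -/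
def besselY (ν z : ℂ) : ℂ :=
  if ∃ k : ℤ, ν = k then
    Filter.limUnder (𝓝[≠] ν) fun μ : ℂ =>
      (besselJ μ z * Complex.cos (Real.pi * μ) - besselJ (-μ) z) / Complex.sin (Real.pi * μ)
  else
    (besselJ ν z * Complex.cos (Real.pi * ν) - besselJ (-ν) z) / Complex.sin (Real.pi * ν)

open Classical in
/-- The modified Bessel function of the second kind: `(π/2) (I_{-ν}(z) - I_ν(z)) / sin πν` for
`ν` not an integer, and the limit of this expression in the order at integers. -/
def besselK (ν z : ℂ) : ℂ :=
  if ∃ k : ℤ, ν = k then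
    Filter.limUnder (𝓝[≠] ν) fun μ : ℂ =>
      Real.pi / 2 * ((besselI (-μ) z - besselI μ z) / Complex.sin (Real.pi * μ))
  else
    Real.pi / 2 * ((besselI (-ν) z - besselI ν z) / Complex.sin (Real.pi * ν))

/-- The first Koshliakov kernel of order `a`, as a function of the Bessel argument `x`:
`((2/π) K_a(x) - Y_a(x)) cos(πa/2) - J_a(x) sin(πa/2)`. -/
def koshliakovKernel (a : ℂ) (x : ℝ) : ℂ :=
  (2 / Real.pi * besselK a x - besselY a x) * Complex.cos (Real.pi * a / 2) -
    besselJ a x * Complex.sin (Real.pi * a / 2)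

/-- The density `ζ(1-a) + t^a ζ(1+a)` of the main term. At `a = 0`, where the poles of the two
zeta values cancel, it stands for its limit `2γ + log t`. -/
def mainDensity (a : ℂ) (t : ℝ) : ℂ :=
  if a = 0 then 2 * Real.eulerMascheroniConstant + Real.log t
  else riemannZeta (1 - a) + (t : ℂ) ^ a * riemannZeta (1 + a)

/-- The value of `mainDensity` at `a = 0` is the limit of its values at `a ≠ 0`. -/
theorem tendsto_mainDensity {t : ℝ} (ht : 0 < t) :
    Filter.Tendsto (fun a : ℂ => riemannZeta (1 - a) + (t : ℂ) ^ a * riemannZeta (1 + a))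
      (𝓝[≠] 0) (𝓝 (mainDensity 0 t)) := by
  have ht0 : (t : ℂ) ≠ 0 := by exact_mod_cast ht.ne'
  have h1 : Filter.Tendsto (fun a : ℂ => 1 + a) (𝓝[≠] 0) (𝓝[≠] 1) := by
    refine tendsto_nhdsWithin_iff.2 ⟨?_, ?_⟩
    · have : Filter.Tendsto (fun a : ℂ => 1 + a) (𝓝 0) (𝓝 (1 + 0)) := by
        exact (continuous_const.add continuous_id).tendsto 0
      simpa using this.mono_left nhdsWithin_le_nhds
    · filter_upwards [self_mem_nhdsWithin] with a ha
      simpa using ha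
  have h2 : Filter.Tendsto (fun a : ℂ => 1 - a) (𝓝[≠] 0) (𝓝[≠] 1) := by
    refine tendsto_nhdsWithin_iff.2 ⟨?_, ?_⟩
    · have : Filter.Tendsto (fun a : ℂ => 1 - a) (𝓝 0) (𝓝 (1 - 0)) := by
        exact (continuous_const.sub continuous_id).tendsto 0
      simpa using this.mono_left nhdsWithin_le_nhds
    · filter_upwards [self_mem_nhdsWithin] with a ha
      simpa using ha
  have h3 := tendsto_riemannZeta_sub_one_div.comp h1
  have h4 := tendsto_riemannZeta_sub_one_div.comp h2
  have hd : HasDerivAt (fun a : ℂ => (t : ℂ) ^ a) ((t : ℂ) ^ (0 : ℂ) * Complex.log t) 0 := by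
    simpa using (hasDerivAt_id (0 : ℂ)).const_cpow (c := (t : ℂ)) (Or.inl ht0)
  have h5 : Filter.Tendsto (fun a : ℂ => (t : ℂ) ^ a) (𝓝[≠] 0) (𝓝 ((t : ℂ) ^ (0 : ℂ))) :=
    hd.continuousAt.tendsto.mono_left nhdsWithin_le_nhds
  have h6 := hasDerivAt_iff_tendsto_slope_zero.1 hd
  have h7 := ((h5.mul h3).add h6).add h4
  have hv : mainDensity 0 t = (t : ℂ) ^ (0 : ℂ) * (Real.eulerMascheroniConstant : ℂ) +
      (t : ℂ) ^ (0 : ℂ) * Complex.log t + Real.eulerMascheroniConstant := by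
    simp [mainDensity, Complex.ofReal_log ht.le]
    ring
  rw [hv]
  refine h7.congr' ?_
  filter_upwards [self_mem_nhdsWithin] with a ha
  have ha : a ≠ 0 := ha
  simp only [Function.comp, smul_eq_mul, zero_add, Complex.cpow_zero]
  have e1 : (1 : ℂ) + a - 1 = a := by ring
  have e2 : (1 : ℂ) - a - 1 = -a := by ring
  rw [e1, e2]
  field_simp
  ring

/-- `F` is the analytic continuation of the Mellin transform `∫_0^∞ f(x) x^{s-1} dx`, `Re s > 0`,
of a Schwartz function to the complex plane without the non-positive integers. -/
def IsMellinContinuation (f : ℝ → ℂ) (F : ℂ → ℂ) : Prop :=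
  DifferentiableOn ℂ F {s : ℂ | ∀ n : ℕ, s ≠ -(n : ℂ)} ∧
    ∀ s : ℂ, 0 < s.re → F s = mellin f s

/-- `F` decays faster than any polynomial in every bounded vertical strip, as `|Im s| → ∞`. -/
def RapidlyDecaysInStrips (F : ℂ → ℂ) : Prop :=
  ∀ (σ₁ σ₂ : ℝ) (N : ℕ), ∃ C : ℝ, ∀ s : ℂ, σ₁ ≤ s.re → s.re ≤ σ₂ → 1 ≤ |s.im| →
    ‖F s‖ * |s.im| ^ N ≤ C

end Voronoi

end

noncomputable section

namespace Voronoi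

open Complex MeasureTheory Filter Set
open scoped Interval

/-! By Mellin inversion and the Dirichlet series of `sigma a`, the left side is `1/(2π)` times the
integral of `ζ(s) ζ(s-a) F(s)` over `re s = 3/2`. Moving the line to `re s = -1/2` crosses the poles
at `1` and `1 + a`, which give the integral of `mainDensity` (`integral_mainDensity_mul`), and the
pole of `F` at `0` with residue `f 0`, which gives `-ζ(-a) f(0) / 2`.

On the new line put `s = 1 - w` and apply `ζ(1-w) = χ(w) ζ(w)` to both zeta factors. Expanding `ζ(w)
ζ(w+a)` leaves `∑ σ_{-a}(n)` times the integrals of `χ(w) χ(w+a) n^{-w} F(1-w)` over `re w = 3/2`,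
and it remains to identify each of these with `∫ f(y) V(ny) dy`, where `V` is `voronoiKernel`
(`integral_mul_voronoiKernel`).

For this, `V(y)` is written as the residue of `χ(w) χ(w+a) y^{-w}` at `0` and `-a` plus `1/(2π)`
times its integral over `re w = -3/2` (`voronoiKernel_eq`). Pushing that line to `-∞` sums the
residues at `-2j` and `-2j-a`, and these are the even terms of the power series of `I` and `J` at
orders `-a` and `a`. On `re w = -3/2` the product of the two `χ` decays quadratically and `F(1-w)`
is a convergent Mellin integral, so Fubini applies. The same residues at `0` and `-a` appear when
the line `3/2` is moved to `-3/2`.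

Two poles which merge at `a = 0` are treated together: their residues add up to a divided difference
`dslope h p q`, which becomes `h'(p)` when `q = p`. Only the formula for the kernel itself is
obtained at `a = 0` as a limit. -/

/-! ### Moving vertical lines of integration -/

/-- The integral of `g` along the vertical line `re w = σ`, with respect to `im w`. -/
def verticalIntegral (g : ℂ → ℂ) (σ : ℝ) : ℂ := ∫ t : ℝ, g (σ + t * I)

/-- The closed vertical strip `σ₁ ≤ re w ≤ σ₂`. -/
def strip (σ₁ σ₂ : ℝ) : Set ℂ := {w : ℂ | w.re ∈ Icc σ₁ σ₂}

/-- Quadratic decay of `g` as `|im w| → ∞` in a vertical strip. -/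
def QuadraticDecay (g : ℂ → ℂ) (σ₁ σ₂ : ℝ) : Prop :=
  ∃ C T : ℝ, 0 < T ∧ ∀ w ∈ strip σ₁ σ₂, T ≤ |w.im| → ‖g w‖ ≤ C / w.im ^ 2

theorem strip_mem_nhds {σ₁ σ₂ : ℝ} {p : ℂ} (h₁ : σ₁ < p.re) (h₂ : p.re < σ₂) :
    strip σ₁ σ₂ ∈ 𝓝 p :=
  continuous_re.continuousAt.preimage_mem_nhds (Icc_mem_nhds h₁ h₂)

theorem add_mul_I_mem_strip {σ σ₁ σ₂ : ℝ} (h : σ ∈ Icc σ₁ σ₂) (t : ℝ) :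
    (σ + t * I : ℂ) ∈ strip σ₁ σ₂ := by
  simpa [strip] using h

theorem integrable_of_continuous_of_norm_le_div_sq {u : ℝ → ℂ} (hu : Continuous u) {C T : ℝ}
    (h : ∀ t : ℝ, T ≤ |t| → ‖u t‖ ≤ C / t ^ 2) : Integrable u := by
  refine hu.locallyIntegrable.integrable_of_isBigO_cocompact (g := fun t : ℝ => (1 + t ^ 2)⁻¹) ?_
    (integrable_inv_one_add_sq.integrableAtFilter _)
  refine Asymptotics.IsBigO.of_bound (2 * |C|) ?_
  have : ∀ᶠ t : ℝ in cocompact ℝ, max T 1 ≤ ‖t‖ := tendsto_norm_cocompact_atTop.eventually_ge_atTop _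
  filter_upwards [this] with t ht
  have h1 : 1 ≤ |t| := (le_max_right _ _).trans ht
  have h2 : 1 ≤ t ^ 2 := by rw [← sq_abs]; nlinarith
  refine (h t ((le_max_left _ _).trans ht)).trans ?_
  rw [Real.norm_of_nonneg (by positivity), ← div_eq_mul_inv, div_le_div_iff₀ (by positivity)
    (by positivity)]
  nlinarith [le_abs_self C, abs_nonneg C]

theorem continuous_vertical {g : ℂ → ℂ} {σ σ₁ σ₂ : ℝ} (hσ : σ ∈ Icc σ₁ σ₂)
    (hg : ContinuousOn g (strip σ₁ σ₂)) : Continuous fun t : ℝ => g (σ + t * I) :=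
  hg.comp_continuous (by fun_prop) (add_mul_I_mem_strip hσ)

theorem integrable_vertical {g : ℂ → ℂ} {σ σ₁ σ₂ : ℝ} (hσ : σ ∈ Icc σ₁ σ₂)
    (hc : Continuous fun t : ℝ => g (σ + t * I)) (hd : QuadraticDecay g σ₁ σ₂) :
    Integrable fun t : ℝ => g (σ + t * I) := by
  obtain ⟨C, T, -, h⟩ := hd
  refine integrable_of_continuous_of_norm_le_div_sq hc (C := C) (T := T) fun t ht => ?_
  simpa using h _ (add_mul_I_mem_strip hσ t) (by simpa using ht)

/-- Cauchy's theorem for an infinite vertical strip. -/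
theorem integral_strip_boundary_eq_zero {h : ℂ → ℂ} {σ₁ σ₂ C T : ℝ} (hσ : σ₁ ≤ σ₂)
    (hd : DifferentiableOn ℂ h (strip σ₁ σ₂))
    (hb : ∀ w ∈ strip σ₁ σ₂, T ≤ |w.im| → ‖h w‖ ≤ C / |w.im|)
    (hi : Integrable fun t : ℝ => h (σ₂ + t * I) - h (σ₁ + t * I)) :
    ∫ t : ℝ, (h (σ₂ + t * I) - h (σ₁ + t * I)) = 0 := by
  -- Only the difference of the two sides is assumed integrable: a function of size `1 / |im w|`
  -- need not be integrable on either line. The horizontal sides still tend to zero.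
  have h1 := intervalIntegral_tendsto_integral hi tendsto_neg_atTop_atBot tendsto_id
  refine tendsto_nhds_unique h1 ?_
  have hlim : Tendsto (fun R : ℝ => 2 * (|C| * (σ₂ - σ₁)) / R) atTop (𝓝 0) :=
    tendsto_const_nhds.div_atTop tendsto_id
  refine squeeze_zero_norm' ?_ hlim
  filter_upwards [eventually_ge_atTop T, eventually_gt_atTop 0] with R hR hR0
  have hsub : ([[(σ₁ + (-R : ℝ) * I : ℂ).re, (σ₂ + R * I : ℂ).re]] ×ℂ
      [[(σ₁ + (-R : ℝ) * I : ℂ).im, (σ₂ + R * I : ℂ).im]]) ⊆ strip σ₁ σ₂ := by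
    intro w hw
    have := hw.1
    simpa [strip, uIcc_of_le hσ] using this
  have h2 := integral_boundary_rect_eq_zero_of_differentiableOn h _ _ (hd.mono hsub)
  have hbound : ∀ y : ℝ, |y| = R → ‖∫ x : ℝ in σ₁..σ₂, h (x + y * I)‖ ≤ |C| / R * |σ₂ - σ₁| := by
    intro y hy
    refine intervalIntegral.norm_integral_le_of_norm_le_const fun x hx => ?_
    rw [uIoc_of_le hσ] at hx
    refine (hb _ (add_mul_I_mem_strip ⟨hx.1.le, hx.2⟩ y) (by simpa [hy] using hR)).trans ?_
    simp only [add_im, ofReal_im, mul_im, ofReal_re, I_im, I_re, mul_one, mul_zero, add_zero,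
      zero_add, hy]
    gcongr
    exact le_abs_self C
  have hcont : ∀ σ ∈ Icc σ₁ σ₂, IntervalIntegrable (fun t : ℝ => h (σ + t * I)) volume (-R) R :=
    fun σ hσ' => (continuous_vertical hσ' hd.continuousOn).intervalIntegrable _ _
  simp only [add_re, ofReal_re, mul_re, I_re, mul_zero, ofReal_im, I_im, mul_one, sub_self,
    add_zero, add_im, mul_im, zero_add, smul_eq_mul] at h2
  simp only [id]
  rw [intervalIntegral.integral_sub (hcont σ₂ ⟨hσ, le_rfl⟩) (hcont σ₁ ⟨le_rfl, hσ⟩)]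
  have h3 : I * ((∫ t : ℝ in -R..R, h (σ₂ + t * I)) - ∫ t : ℝ in -R..R, h (σ₁ + t * I)) =
      (∫ x : ℝ in σ₁..σ₂, h (x + R * I)) - ∫ x : ℝ in σ₁..σ₂, h (x + (-R : ℝ) * I) := by
    linear_combination h2
  have h4 := congrArg norm h3
  rw [norm_mul, norm_I, one_mul] at h4
  rw [h4]
  refine (norm_sub_le _ _).trans ((add_le_add (hbound R (abs_of_pos hR0))
    (hbound (-R) (by rw [abs_neg, abs_of_pos hR0]))).trans (le_of_eq ?_))
  rw [abs_of_nonneg (sub_nonneg.2 hσ)]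
  ring

theorem integral_div_sq_add_sq {c : ℝ} (hc : 0 < c) :
    Integrable (fun t : ℝ => c / (c ^ 2 + t ^ 2)) ∧ ∫ t : ℝ, c / (c ^ 2 + t ^ 2) = Real.pi := by
  have h : (fun t : ℝ => c / (c ^ 2 + t ^ 2)) = fun t : ℝ => c⁻¹ * (1 + (t / c) ^ 2)⁻¹ := by
    ext t
    have : c ^ 2 + t ^ 2 ≠ 0 := by positivity
    have : 1 + (t / c) ^ 2 ≠ 0 := by positivity
    field_simp
  rw [h]
  refine ⟨(integrable_inv_one_add_sq.comp_div hc.ne').const_mul _, ?_⟩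
  rw [integral_const_mul, Measure.integral_comp_div (fun t : ℝ => (1 + t ^ 2)⁻¹) c,
    integral_univ_inv_one_add_sq, abs_of_pos hc, smul_eq_mul]
  field_simp

theorem ofReal_add_mul_I_ne_zero {c : ℝ} (hc : c ≠ 0) (t : ℝ) : (c + t * I : ℂ) ≠ 0 := by
  intro h
  apply hc
  simpa using congrArg re h

theorem abs_le_norm_add_mul_I (c t : ℝ) : |t| ≤ ‖(c + t * I : ℂ)‖ := by
  simpa using abs_im_le_norm (c + t * I : ℂ)

/-- The residue of a simple pole, by direct computation. Each fraction alone is not integrable, but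
the difference is `O(t⁻²)`; averaging over `t` and `-t` turns `1 / (c + it)` into `c / (c² + t²)`,
of integral `±π` according to the sign of `c`. -/
theorem integral_inv_sub_inv {c₁ c₂ : ℝ} (h₁ : c₁ < 0) (h₂ : 0 < c₂) :
    Integrable (fun t : ℝ => 1 / (c₂ + t * I : ℂ) - 1 / (c₁ + t * I : ℂ)) ∧
    ∫ t : ℝ, (1 / (c₂ + t * I : ℂ) - 1 / (c₁ + t * I : ℂ)) = 2 * Real.pi := by
  have hn₁ := ofReal_add_mul_I_ne_zero h₁.ne
  have hn₂ := ofReal_add_mul_I_ne_zero h₂.ne'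
  have hint : Integrable (fun t : ℝ => 1 / (c₂ + t * I : ℂ) - 1 / (c₁ + t * I : ℂ)) := by
    refine integrable_of_continuous_of_norm_le_div_sq (C := ‖(c₁ - c₂ : ℂ)‖) (T := 1) ?_ ?_
    · fun_prop (disch := first | exact hn₁ _ | exact hn₂ _)
    · intro t ht
      have : 1 / (c₂ + t * I : ℂ) - 1 / (c₁ + t * I : ℂ) =
          (c₁ - c₂) / ((c₂ + t * I) * (c₁ + t * I)) := by
        field_simp [hn₁ t, hn₂ t]
        ring
      rw [this, norm_div, norm_mul, ← sq_abs, sq]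
      have h0 : 0 < |t| := by linarith
      gcongr <;> exact abs_le_norm_add_mul_I _ _
  refine ⟨hint, ?_⟩
  obtain ⟨i₁, v₁⟩ := integral_div_sq_add_sq (neg_pos.2 h₁)
  obtain ⟨i₂, v₂⟩ := integral_div_sq_add_sq h₂
  have hsym := integral_neg_eq_self
    (fun t : ℝ => 1 / (c₂ + t * I : ℂ) - 1 / (c₁ + t * I : ℂ)) volume
  have hneg : Integrable (fun t : ℝ => 1 / (c₂ + (-t : ℝ) * I : ℂ) - 1 / (c₁ + (-t : ℝ) * I : ℂ)) :=
    hint.comp_neg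
  have key : ∀ t : ℝ, (1 / (c₂ + t * I : ℂ) - 1 / (c₁ + t * I : ℂ)) +
      (1 / (c₂ + (-t : ℝ) * I : ℂ) - 1 / (c₁ + (-t : ℝ) * I : ℂ)) =
      ((2 * (c₂ / (c₂ ^ 2 + t ^ 2)) + 2 * (-c₁ / ((-c₁) ^ 2 + t ^ 2)) : ℝ) : ℂ) := by
    intro t
    have e : ∀ c : ℝ, c ≠ 0 → 1 / (c + t * I : ℂ) + 1 / (c + (-t : ℝ) * I : ℂ) =
        ((2 * (c / (c ^ 2 + t ^ 2)) : ℝ) : ℂ) := by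
      intro c hc
      have a1 := ofReal_add_mul_I_ne_zero hc t
      have a2 := ofReal_add_mul_I_ne_zero hc (-t)
      have a3 : ((c : ℂ) ^ 2 + (t : ℂ) ^ 2) = (c + t * I) * (c + (-t : ℝ) * I) := by
        push_cast
        ring_nf
        simp
      push_cast at a2 a3 ⊢
      rw [a3, div_add_div _ _ a1 a2, mul_div_assoc']
      congr 1
      ring
    have e1 := e c₁ h₁.ne
    have e2 := e c₂ h₂.ne'
    have e3 : ((2 * (-c₁ / ((-c₁) ^ 2 + t ^ 2)) : ℝ) : ℂ) = -((2 * (c₁ / (c₁ ^ 2 + t ^ 2)) : ℝ) : ℂ) := by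
      push_cast; ring
    rw [ofReal_add, e3]
    linear_combination e2 - e1
  have hsum := integral_add hint hneg
  rw [hsym] at hsum
  simp only [key] at hsum
  rw [integral_complex_ofReal, integral_add (i₂.const_mul 2) (i₁.const_mul 2), integral_const_mul,
    integral_const_mul, v₁, v₂] at hsum
  push_cast at hsum
  linear_combination -hsum / 2

/-- The antiderivative `I / (c + tI)` vanishes at both ends, so the double part of a pole
contributes nothing. -/
theorem integral_inv_sq {c : ℝ} (hc : c ≠ 0) :
    Integrable (fun t : ℝ => 1 / (c + t * I : ℂ) ^ 2) ∧ ∫ t : ℝ, 1 / (c + t * I : ℂ) ^ 2 = 0 := by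
  have hn := ofReal_add_mul_I_ne_zero hc
  have hint : Integrable (fun t : ℝ => 1 / (c + t * I : ℂ) ^ 2) := by
    refine integrable_of_continuous_of_norm_le_div_sq (C := 1) (T := 1) ?_ ?_
    · exact continuous_const.div (by fun_prop) fun t => pow_ne_zero 2 (hn t)
    · intro t ht
      have h0 : 0 < |t| := by linarith
      rw [norm_div, norm_one, norm_pow, ← sq_abs t]
      gcongr
      exact abs_le_norm_add_mul_I _ _
  refine ⟨hint, ?_⟩
  have hder : ∀ t : ℝ, HasDerivAt (fun t : ℝ => I / (c + t * I : ℂ)) (1 / (c + t * I : ℂ) ^ 2) t := by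
    intro t
    have h1 : HasDerivAt (fun t : ℝ => (c + t * I : ℂ)) (1 * I) t :=
      ((hasDerivAt_id t).ofReal_comp.mul_const I).const_add _
    convert (hasDerivAt_const t I).fun_div h1 (hn t) using 1
    congr 1
    ring_nf
    simp
  have hlim : ∀ l : Filter ℝ, Tendsto (fun t : ℝ => |t|) l atTop →
      Tendsto (fun t : ℝ => I / (c + t * I : ℂ)) l (𝓝 0) := by
    intro l hl
    have h2 : Tendsto (fun t : ℝ => 1 / |t|) l (𝓝 0) := tendsto_const_nhds.div_atTop hl
    refine squeeze_zero_norm' ?_ h2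
    filter_upwards [hl.eventually_ge_atTop 1] with t ht
    rw [norm_div, norm_I]
    gcongr
    exact abs_le_norm_add_mul_I _ _
  rw [integral_of_hasDerivAt_of_tendsto hder hint (hlim _ tendsto_abs_atBot_atTop)
    (hlim _ tendsto_abs_atTop_atTop), sub_zero]

theorem half_abs_im_le_norm_sub {w p : ℂ} (h : 2 * |p.im| ≤ |w.im|) : |w.im| / 2 ≤ ‖w - p‖ := by
  have h1 := abs_im_le_norm (w - p)
  rw [sub_im] at h1
  have h2 := abs_sub_abs_le_abs_sub w.im p.im
  linarith

/-- Moving the line of integration across finitely many poles of order at most two. -/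
theorem verticalIntegral_sub_of_principalPart {g h : ℂ → ℂ} {σ₁ σ₂ : ℝ} {p q A B D : ℂ}
    (hp₁ : σ₁ < p.re) (hp₂ : p.re < σ₂) (hq₁ : σ₁ < q.re) (hq₂ : q.re < σ₂)
    (hh : DifferentiableOn ℂ h (strip σ₁ σ₂)) (hg : QuadraticDecay g σ₁ σ₂)
    (hgh : ∀ w ∈ strip σ₁ σ₂, w ≠ p → w ≠ q →
      g w = h w + A / (w - p) + B / (w - q) + D / (w - p) ^ 2) :
    verticalIntegral g σ₂ - verticalIntegral g σ₁ = 2 * Real.pi * (A + B) := by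
  have hσ : σ₁ ≤ σ₂ := (hp₁.trans hp₂).le
  have mem₁ : σ₁ ∈ Icc σ₁ σ₂ := ⟨le_rfl, hσ⟩
  have mem₂ : σ₂ ∈ Icc σ₁ σ₂ := ⟨hσ, le_rfl⟩
  have line : ∀ σ ∈ Icc σ₁ σ₂, σ ≠ p.re → σ ≠ q.re → ∀ t : ℝ, g (σ + t * I) = h (σ + t * I) +
      A / (σ + t * I - p) + B / (σ + t * I - q) + D / (σ + t * I - p) ^ 2 := by
    intro σ hσ' hσp hσq t
    refine hgh _ (add_mul_I_mem_strip hσ' t) ?_ ?_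
    · rintro rfl; simp at hσp
    · rintro rfl; simp at hσq
  have shift : ∀ (σ : ℝ) (r : ℂ) (t : ℝ),
      (σ + t * I - r : ℂ) = ((σ - r.re : ℝ) : ℂ) + ((t - r.im : ℝ) : ℂ) * I := by
    intro σ r t
    apply Complex.ext <;> simp
  have gint : ∀ σ ∈ Icc σ₁ σ₂, σ ≠ p.re → σ ≠ q.re → Integrable fun t : ℝ => g (σ + t * I) := by
    intro σ hσ' hσp hσq
    refine integrable_vertical hσ' ?_ hg
    simp_rw [line σ hσ' hσp hσq]
    have := continuous_vertical hσ' hh.continuousOn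
    have np : ∀ t : ℝ, (σ + t * I - p : ℂ) ≠ 0 := fun t => by
      rw [shift]; exact ofReal_add_mul_I_ne_zero (sub_ne_zero.2 hσp) _
    have nq : ∀ t : ℝ, (σ + t * I - q : ℂ) ≠ 0 := fun t => by
      rw [shift]; exact ofReal_add_mul_I_ne_zero (sub_ne_zero.2 hσq) _
    have np2 : ∀ t : ℝ, (σ + t * I - p : ℂ) ^ 2 ≠ 0 := fun t => pow_ne_zero _ (np t)
    exact ((this.add (continuous_const.div (by fun_prop) np)).add
      (continuous_const.div (by fun_prop) nq)).add (continuous_const.div (by fun_prop) np2)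
  have g₁ := gint σ₁ mem₁ hp₁.ne hq₁.ne
  have g₂ := gint σ₂ mem₂ hp₂.ne' hq₂.ne'
  have simple : ∀ r : ℂ, σ₁ < r.re → r.re < σ₂ →
      Integrable (fun t : ℝ => 1 / (σ₂ + t * I - r) - 1 / (σ₁ + t * I - r)) ∧
      ∫ t : ℝ, (1 / (σ₂ + t * I - r) - 1 / (σ₁ + t * I - r)) = 2 * Real.pi := by
    intro r hr₁ hr₂
    obtain ⟨i, v⟩ := integral_inv_sub_inv (sub_neg.2 hr₁) (sub_pos.2 hr₂)
    simp_rw [shift]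
    exact ⟨i.comp_sub_right r.im, (integral_sub_right_eq_self
      (fun t : ℝ => 1 / (((σ₂ - r.re : ℝ) : ℂ) + t * I) - 1 / (((σ₁ - r.re : ℝ) : ℂ) + t * I))
      r.im).trans v⟩
  have double : ∀ σ : ℝ, σ ≠ p.re → Integrable (fun t : ℝ => 1 / (σ + t * I - p) ^ 2) ∧
      ∫ t : ℝ, 1 / (σ + t * I - p) ^ 2 = 0 := by
    intro σ hσp
    obtain ⟨i, v⟩ := integral_inv_sq (sub_ne_zero.2 hσp)
    simp_rw [shift]
    exact ⟨i.comp_sub_right p.im, (integral_sub_right_eq_self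
      (fun t : ℝ => 1 / (((σ - p.re : ℝ) : ℂ) + t * I) ^ 2) p.im).trans v⟩
  obtain ⟨ip, vp⟩ := simple p hp₁ hp₂
  obtain ⟨iq, vq⟩ := simple q hq₁ hq₂
  obtain ⟨d₁, w₁⟩ := double σ₁ hp₁.ne
  obtain ⟨d₂, w₂⟩ := double σ₂ hp₂.ne'
  have hdiff : ∀ t : ℝ, h (σ₂ + t * I) - h (σ₁ + t * I) = (g (σ₂ + t * I) - g (σ₁ + t * I)) -
      (A * (1 / (σ₂ + t * I - p) - 1 / (σ₁ + t * I - p)) +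
        B * (1 / (σ₂ + t * I - q) - 1 / (σ₁ + t * I - q)) +
        D * (1 / (σ₂ + t * I - p) ^ 2 - 1 / (σ₁ + t * I - p) ^ 2)) := by
    intro t
    rw [line σ₁ mem₁ hp₁.ne hq₁.ne, line σ₂ mem₂ hp₂.ne' hq₂.ne']
    ring
  -- With the principal parts removed the remainder `h` is holomorphic, so Cauchy's theorem applies
  -- to it, and the explicit fractions supply the residues.
  have iAll := ((ip.const_mul A).add (iq.const_mul B)).add ((d₂.sub d₁).const_mul D)
  have hint : Integrable fun t : ℝ => h (σ₂ + t * I) - h (σ₁ + t * I) := by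
    simp_rw [hdiff]
    exact (g₂.sub g₁).sub iAll
  have hzero : ∫ t : ℝ, (h (σ₂ + t * I) - h (σ₁ + t * I)) = 0 := by
    obtain ⟨C, T, hT, hC⟩ := hg
    -- High in the strip `‖w - p‖ ≥ |im w| / 2`, whence the factors `2`, and `4` for the squared
    -- denominator.
    refine integral_strip_boundary_eq_zero (C := |C| + 2 * ‖A‖ + 2 * ‖B‖ + 4 * ‖D‖)
      (T := max (max T 1) (max (2 * |p.im| + 1) (2 * |q.im| + 1))) hσ hh ?_ hint
    intro w hw hwT
    have t1 : T ≤ |w.im| := by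
      exact (le_max_left _ _).trans ((le_max_left _ _).trans hwT)
    have t2 : 1 ≤ |w.im| := (le_max_right _ _).trans ((le_max_left _ _).trans hwT)
    have t3 : 2 * |p.im| + 1 ≤ |w.im| := (le_max_left _ _).trans ((le_max_right _ _).trans hwT)
    have t4 : 2 * |q.im| + 1 ≤ |w.im| := (le_max_right _ _).trans ((le_max_right _ _).trans hwT)
    have np := half_abs_im_le_norm_sub (w := w) (p := p) (by linarith)
    have nq := half_abs_im_le_norm_sub (w := w) (p := q) (by linarith)
    have np0 : w ≠ p := by rintro rfl; simp at np; linarith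
    have nq0 : w ≠ q := by rintro rfl; simp at nq; linarith
    have e : h w = g w - A / (w - p) - B / (w - q) - D / (w - p) ^ 2 := by
      rw [hgh w hw np0 nq0]; ring
    have b0 : ‖g w‖ ≤ |C| / |w.im| := by
      refine (hC w hw t1).trans ?_
      rw [← sq_abs]
      gcongr
      · exact le_abs_self C
      · nlinarith
    have b1 : ‖A / (w - p)‖ ≤ 2 * ‖A‖ / |w.im| := by
      rw [norm_div, div_le_div_iff₀ (by linarith) (by linarith)]
      nlinarith [norm_nonneg A]
    have b2 : ‖B / (w - q)‖ ≤ 2 * ‖B‖ / |w.im| := by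
      rw [norm_div, div_le_div_iff₀ (by linarith) (by linarith)]
      nlinarith [norm_nonneg B]
    have b3 : ‖D / (w - p) ^ 2‖ ≤ 4 * ‖D‖ / |w.im| := by
      rw [norm_div, norm_pow, div_le_div_iff₀ (by nlinarith) (by linarith)]
      have : |w.im| / 4 ≤ ‖w - p‖ ^ 2 := by nlinarith
      nlinarith [norm_nonneg D]
    rw [e]
    calc _ ≤ ‖g w‖ + ‖A / (w - p)‖ + ‖B / (w - q)‖ + ‖D / (w - p) ^ 2‖ :=
          (norm_sub_le _ _).trans (add_le_add_left ((norm_sub_le _ _).trans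
            (add_le_add_left (norm_sub_le _ _) _)) _)
      _ ≤ |C| / |w.im| + 2 * ‖A‖ / |w.im| + 2 * ‖B‖ / |w.im| + 4 * ‖D‖ / |w.im| := by gcongr
      _ = _ := by ring
  simp_rw [hdiff] at hzero
  have i₁ := integral_sub (g₂.sub g₁) iAll
  have i₂ := integral_sub g₂ g₁
  have i₃ := integral_add ((ip.const_mul A).add (iq.const_mul B)) ((d₂.sub d₁).const_mul D)
  have i₄ := integral_add (ip.const_mul A) (iq.const_mul B)
  have i₅ := integral_sub d₂ d₁
  simp only [Pi.add_apply, Pi.sub_apply, integral_const_mul] at i₁ i₂ i₃ i₄ i₅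
  rw [i₁, i₂, i₃, i₄, i₅, vp, vq, w₁, w₂] at hzero
  simp only [verticalIntegral]
  linear_combination hzero

/-- Moving the line of integration across a simple pole. -/
theorem verticalIntegral_sub_of_simplePole {g h : ℂ → ℂ} {σ₁ σ₂ : ℝ} {p : ℂ}
    (hp₁ : σ₁ < p.re) (hp₂ : p.re < σ₂) (hh : DifferentiableOn ℂ h (strip σ₁ σ₂))
    (hg : QuadraticDecay g σ₁ σ₂) (hgh : ∀ w ∈ strip σ₁ σ₂, w ≠ p → g w = h w / (w - p)) :
    verticalIntegral g σ₂ - verticalIntegral g σ₁ = 2 * Real.pi * h p := by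
  have := verticalIntegral_sub_of_principalPart (h := dslope h p) (A := h p) (B := 0) (D := 0)
    hp₁ hp₂ hp₁ hp₂ ((differentiableOn_dslope (strip_mem_nhds hp₁ hp₂)).2 hh) hg ?_
  · simpa using this
  · intro w hw hwp _
    have h1 : w - p ≠ 0 := sub_ne_zero.2 hwp
    rw [hgh w hw hwp, dslope_of_ne _ hwp, slope_def_field]
    field_simp
    ring

/-- Moving the line of integration across two simple poles or a double pole. -/
theorem verticalIntegral_sub_of_twoPoles {g h : ℂ → ℂ} {σ₁ σ₂ : ℝ} {p q : ℂ}
    (hp₁ : σ₁ < p.re) (hp₂ : p.re < σ₂) (hq₁ : σ₁ < q.re) (hq₂ : q.re < σ₂)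
    (hh : DifferentiableOn ℂ h (strip σ₁ σ₂)) (hg : QuadraticDecay g σ₁ σ₂)
    (hgh : ∀ w ∈ strip σ₁ σ₂, w ≠ p → w ≠ q → g w = h w / ((w - p) * (w - q))) :
    verticalIntegral g σ₂ - verticalIntegral g σ₁ = 2 * Real.pi * dslope h p q := by
  have dp := (differentiableOn_dslope (strip_mem_nhds hp₁ hp₂)).2 hh
  have dq := (differentiableOn_dslope (strip_mem_nhds hq₁ hq₂)).2 hh
  -- For `p = q` the residue is `h'(p)`; for `p ≠ q` partial fractions give `(h p - h q) / (p - q)`.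
  -- Both are `dslope h p q`.
  rcases eq_or_ne p q with rfl | hpq
  · have ddp := (differentiableOn_dslope (strip_mem_nhds hp₁ hp₂)).2 dp
    have := verticalIntegral_sub_of_principalPart (h := dslope (dslope h p) p)
      (A := dslope h p p) (B := 0) (D := h p) hp₁ hp₂ hp₁ hp₂ ddp hg ?_
    · simpa using this
    · intro w hw hwp _
      have h1 : w - p ≠ 0 := sub_ne_zero.2 hwp
      rw [hgh w hw hwp hwp, dslope_of_ne _ hwp, slope_def_field, dslope_of_ne h hwp,
        slope_def_field]
      field_simp
      ring
  · have hpq' : p - q ≠ 0 := sub_ne_zero.2 hpq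
    have := verticalIntegral_sub_of_principalPart
      (h := fun w => (dslope h p w - dslope h q w) / (p - q))
      (A := h p / (p - q)) (B := -h q / (p - q)) (D := 0) hp₁ hp₂ hq₁ hq₂
      ((dp.sub dq).div_const _) hg ?_
    · rw [this, dslope_of_ne _ hpq.symm, slope_def_field]
      have : q - p ≠ 0 := sub_ne_zero.2 hpq.symm
      field_simp
      ring
    · intro w hw hwp hwq
      have h1 : w - p ≠ 0 := sub_ne_zero.2 hwp
      have h1' : w - q ≠ 0 := sub_ne_zero.2 hwq
      rw [hgh w hw hwp hwq, dslope_of_ne _ hwp, slope_def_field, dslope_of_ne _ hwq,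
        slope_def_field]
      field_simp
      ring

/-! ### Growth of the Gamma function in vertical strips -/

theorem integrableOn_rpow_mul_exp_neg_mul {p b : ℝ} (hp : -1 < p) (hb : 0 < b) :
    IntegrableOn (fun t : ℝ => t ^ p * Real.exp (-(b * t))) (Ioi 0) := by
  simpa using integrableOn_rpow_mul_exp_neg_mul_rpow hp zero_lt_one hb

theorem continuousOn_cpow_mul_exp (s r : ℂ) :
    ContinuousOn (fun t : ℝ => (t : ℂ) ^ s * cexp (-(r * t))) (Ioi 0) := by
  refine ContinuousOn.mul ?_ (by fun_prop)
  exact fun t ht => (continuousAt_ofReal_cpow_const t s (Or.inr (ne_of_gt ht))).continuousWithinAt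

theorem norm_cpow_mul_exp (s r : ℂ) {t : ℝ} (ht : 0 < t) :
    ‖(t : ℂ) ^ s * cexp (-(r * t))‖ = t ^ s.re * Real.exp (-(r.re * t)) := by
  rw [norm_mul, norm_cpow_eq_rpow_re_of_pos ht, norm_exp]
  simp

theorem integrableOn_cpow_mul_exp {s r : ℂ} (hs : -1 < s.re) (hr : 0 < r.re) :
    IntegrableOn (fun t : ℝ => (t : ℂ) ^ s * cexp (-(r * t))) (Ioi 0) := by
  refine (integrableOn_rpow_mul_exp_neg_mul hs hr).mono'
    ((continuousOn_cpow_mul_exp s r).aestronglyMeasurable measurableSet_Ioi) ?_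
  filter_upwards [ae_restrict_mem measurableSet_Ioi] with t ht
  rw [norm_cpow_mul_exp s r ht]

theorem differentiableAt_integral_cpow_mul_exp {s r : ℂ} (hs : 0 < s.re) (hr : 0 < r.re) :
    DifferentiableAt ℂ (fun r : ℂ => ∫ t in Ioi (0 : ℝ), (t : ℂ) ^ (s - 1) * cexp (-(r * t))) r := by
  have hs' : -1 < (s - 1).re := by simpa using hs
  have hnhds : {z : ℂ | r.re / 2 < z.re} ∈ 𝓝 r :=
    (isOpen_lt continuous_const continuous_re).mem_nhds (by simpa using half_lt_self hr)
  have hpos : ∀ z ∈ {z : ℂ | r.re / 2 < z.re}, 0 < z.re := fun z hz => (half_pos hr).trans hz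
  refine (hasDerivAt_integral_of_dominated_loc_of_deriv_le (μ := volume.restrict (Ioi 0)) hnhds
    (F := fun z t => (t : ℂ) ^ (s - 1) * cexp (-(z * t)))
    (F' := fun z t => -((t : ℂ) ^ s * cexp (-(z * t))))
    (bound := fun t => t ^ s.re * Real.exp (-(r.re / 2 * t))) ?_
    (integrableOn_cpow_mul_exp hs' hr) ?_ ?_
    (integrableOn_rpow_mul_exp_neg_mul (by linarith) (half_pos hr)) ?_).2.differentiableAt
  · filter_upwards with z
    exact (continuousOn_cpow_mul_exp _ _).aestronglyMeasurable measurableSet_Ioi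
  · exact (continuousOn_cpow_mul_exp _ _).neg.aestronglyMeasurable measurableSet_Ioi
  · filter_upwards [ae_restrict_mem measurableSet_Ioi] with t ht z hz
    have ht' : 0 < t := ht
    rw [norm_neg, norm_cpow_mul_exp s z ht]
    have : r.re / 2 < z.re := hz
    gcongr
  · filter_upwards [ae_restrict_mem measurableSet_Ioi] with t ht z _
    have ht0 : (t : ℂ) ≠ 0 := by exact_mod_cast (ne_of_gt ht)
    have h1 : HasDerivAt (fun z : ℂ => cexp (-(z * t))) (cexp (-(z * t)) * -(1 * t)) z :=
      ((hasDerivAt_id z).mul_const (t : ℂ)).neg.cexp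
    refine (h1.const_mul ((t : ℂ) ^ (s - 1))).congr_deriv ?_
    rw [cpow_sub _ _ ht0, cpow_one]
    field_simp

/-- Euler's integral for `Γ(s)` along a ray. -/
theorem integral_cpow_mul_exp_of_re_pos {s r : ℂ} (hs : 0 < s.re) (hr : 0 < r.re) :
    ∫ t in Ioi (0 : ℝ), (t : ℂ) ^ (s - 1) * cexp (-(r * t)) = r ^ (-s) * Gamma s := by
  have hU : IsOpen {z : ℂ | 0 < z.re} := isOpen_lt continuous_const continuous_re
  have h1 : AnalyticOnNhd ℂ
      (fun r : ℂ => ∫ t in Ioi (0 : ℝ), (t : ℂ) ^ (s - 1) * cexp (-(r * t))) {z : ℂ | 0 < z.re} :=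
    DifferentiableOn.analyticOnNhd (fun z hz =>
      (differentiableAt_integral_cpow_mul_exp hs hz).differentiableWithinAt) hU
  have h2 : AnalyticOnNhd ℂ (fun r : ℂ => r ^ (-s) * Gamma s) {z : ℂ | 0 < z.re} := by
    refine DifferentiableOn.analyticOnNhd (fun z hz => ?_) hU
    exact ((differentiableAt_id.cpow_const (Or.inl hz)).mul_const _).differentiableWithinAt
  -- Both sides are analytic in `r` on the right half-plane and agree at the real `r > 1`, which
  -- accumulate at `1`.
  refine h1.eqOn_of_preconnected_of_frequently_eq h2
    (convex_halfSpace_re_gt 0).isPreconnected (z₀ := 1) (by simp) ?_ hr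
  have h3 : ∃ᶠ x : ℝ in 𝓝[>] 1, True := by
    simp [frequently_true_iff_neBot]
    infer_instance
  have h4 : Tendsto (fun x : ℝ => (x : ℂ)) (𝓝[>] 1) (𝓝[≠] 1) := by
    refine tendsto_nhdsWithin_iff.2 ⟨?_, ?_⟩
    · simpa using (continuous_ofReal.tendsto 1).mono_left nhdsWithin_le_nhds
    · filter_upwards [self_mem_nhdsWithin] with x hx
      simpa using ne_of_gt hx
  refine h4.frequently (h3.mp ?_)
  filter_upwards [self_mem_nhdsWithin] with x hx _
  have hx0 : 0 < x := zero_lt_one.trans hx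
  rw [integral_cpow_mul_exp_neg_mul_Ioi hs hx0, one_div, inv_cpow _ _ ?_, cpow_neg]
  rw [arg_ofReal_of_nonneg hx0.le]
  exact Real.pi_pos.ne

/-- Euler's integral along the ray `r = e^{iθ}`: the factor `r^{-s}` has modulus `e^{θ im s}`, and
the absolute integral is a real Gamma integral with rate `cos θ`. -/
theorem norm_Gamma_le {s : ℂ} (hs : 0 < s.re) {θ : ℝ} (h₁ : -(Real.pi / 2) < θ)
    (h₂ : θ < Real.pi / 2) :
    ‖Gamma s‖ ≤ Real.exp (-(θ * s.im)) * (1 / Real.cos θ) ^ s.re * Real.Gamma s.re := by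
  have hcos : 0 < Real.cos θ := Real.cos_pos_of_mem_Ioo ⟨h₁, h₂⟩
  have hr : (cexp (θ * I)).re = Real.cos θ := exp_ofReal_mul_I_re θ
  have h := integral_cpow_mul_exp_of_re_pos hs (r := cexp (θ * I)) (by rwa [hr])
  have hlog : Complex.log (cexp (θ * I)) = θ * I :=
    log_exp (by simp; linarith [Real.pi_pos]) (by simp; linarith [Real.pi_pos])
  have hpow : ‖cexp (θ * I) ^ (-s)‖ = Real.exp (θ * s.im) := by
    rw [cpow_def_of_ne_zero (exp_ne_zero _), hlog, norm_exp]
    simp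
  have hle : ‖∫ t in Ioi (0 : ℝ), (t : ℂ) ^ (s - 1) * cexp (-(cexp (θ * I) * t))‖ ≤
      (1 / Real.cos θ) ^ s.re * Real.Gamma s.re := by
    rw [← Real.integral_rpow_mul_exp_neg_mul_Ioi hs hcos]
    refine (norm_integral_le_integral_norm _).trans (le_of_eq ?_)
    refine setIntegral_congr_fun measurableSet_Ioi fun t ht => ?_
    rw [norm_cpow_mul_exp _ _ ht, hr, sub_re, one_re]
  rw [h, norm_mul, hpow] at hle
  rw [Real.exp_neg, mul_assoc]
  rwa [le_inv_mul_iff₀ (Real.exp_pos _)]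

/-- Take `θ = π/2 - 1/t` in `norm_Gamma_le`, with `t = im s`: the exponential loses only the factor
`e`, and `1 / cos θ = 1 / sin(1/t)` is at most `πt/2`. This is weaker than Stirling by a factor
`|t|^{1/2}`, which does no harm below. Negative `t` follows by conjugation. -/
theorem exists_norm_Gamma_le_of_pos {α β : ℝ} (hα : 0 < α) :
    ∃ C : ℝ, 0 ≤ C ∧ ∀ s ∈ strip α β, 1 ≤ |s.im| →
      ‖Gamma s‖ * Real.exp (Real.pi / 2 * |s.im|) ≤ C * |s.im| ^ s.re := by
  have hcont : ContinuousOn (fun σ : ℝ => Real.exp 1 * (Real.pi / 2) ^ σ * Real.Gamma σ)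
      (Icc α β) := by
    refine ContinuousOn.mul (Continuous.continuousOn ?_) fun σ hσ =>
      (Real.differentiableAt_Gamma fun m => (by
        have := hα.trans_le hσ.1; have : (0 : ℝ) ≤ m := m.cast_nonneg; linarith)).continuousAt.continuousWithinAt
    exact continuous_const.mul (Real.continuous_const_rpow (by positivity))
  obtain ⟨C, hC⟩ := isCompact_Icc.exists_bound_of_continuousOn hcont
  have main : ∀ s ∈ strip α β, 1 ≤ s.im →
      ‖Gamma s‖ * Real.exp (Real.pi / 2 * s.im) ≤ |C| * s.im ^ s.re := by
    intro s hs ht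
    have hs0 : 0 < s.re := hα.trans_le hs.1
    have ht0 : 0 < s.im := by linarith
    have hinv : 1 / s.im ≤ 1 := by rw [div_le_one ht0]; exact ht
    have hinv0 : 0 < 1 / s.im := by positivity
    have hpi : 1 < Real.pi / 2 := by linarith [Real.pi_gt_three]
    have h := norm_Gamma_le hs0 (θ := Real.pi / 2 - 1 / s.im) (by linarith) (by linarith)
    rw [Real.cos_pi_div_two_sub] at h
    have hsin : 2 / Real.pi * (1 / s.im) ≤ Real.sin (1 / s.im) :=
      Real.mul_le_sin hinv0.le (by linarith)
    have hsin' : 1 / Real.sin (1 / s.im) ≤ Real.pi / 2 * s.im := by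
      rw [div_le_iff₀ (lt_of_lt_of_le (by positivity) hsin)]
      calc (1 : ℝ) = Real.pi / 2 * s.im * (2 / Real.pi * (1 / s.im)) := by field_simp
        _ ≤ _ := by gcongr
    have hexp : Real.exp (-((Real.pi / 2 - 1 / s.im) * s.im)) * Real.exp (Real.pi / 2 * s.im) =
        Real.exp 1 := by
      rw [← Real.exp_add]
      congr 1
      field_simp
      ring
    have hsin0 : 0 ≤ 1 / Real.sin (1 / s.im) := by
      refine one_div_nonneg.2 (le_trans (by positivity) hsin)
    have hG : 0 < Real.Gamma s.re := Real.Gamma_pos_of_pos hs0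
    have hC' := (le_abs_self _).trans ((hC s.re hs).trans (le_abs_self C))
    calc ‖Gamma s‖ * Real.exp (Real.pi / 2 * s.im)
        ≤ Real.exp (-((Real.pi / 2 - 1 / s.im) * s.im)) * (1 / Real.sin (1 / s.im)) ^ s.re *
          Real.Gamma s.re * Real.exp (Real.pi / 2 * s.im) := by gcongr
      _ = Real.exp 1 * (1 / Real.sin (1 / s.im)) ^ s.re * Real.Gamma s.re := by
          rw [← hexp]; ring
      _ ≤ Real.exp 1 * (Real.pi / 2 * s.im) ^ s.re * Real.Gamma s.re := by gcongr
      _ = (Real.exp 1 * (Real.pi / 2) ^ s.re * Real.Gamma s.re) * s.im ^ s.re := by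
          rw [Real.mul_rpow (by positivity) ht0.le]; ring
      _ ≤ |C| * s.im ^ s.re := by gcongr
  refine ⟨|C|, abs_nonneg C, fun s hs ht => ?_⟩
  rcases le_abs.1 ht with h | h
  · rw [abs_of_pos (by linarith)]
    exact main s hs h
  · have := main (starRingEnd ℂ s) (by simpa [strip] using hs) (by simpa using h)
    rw [Gamma_conj, norm_conj] at this
    rw [abs_of_neg (by linarith)]
    simpa using this

/-- Growth of `Γ` in vertical strips. -/
theorem exists_norm_Gamma_le (α β : ℝ) :
    ∃ C : ℝ, 0 ≤ C ∧ ∀ s ∈ strip α β, 1 ≤ |s.im| →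
      ‖Gamma s‖ * Real.exp (Real.pi / 2 * |s.im|) ≤ C * |s.im| ^ s.re := by
  obtain ⟨n, hn⟩ := exists_nat_gt (-α)
  induction n generalizing α β with
  | zero => exact exists_norm_Gamma_le_of_pos (by simpa using hn)
  | succ n ih =>
    obtain ⟨C, hC0, hC⟩ := ih (α + 1) (β + 1) (by push_cast at hn; linarith)
    refine ⟨C, hC0, fun s hs ht => ?_⟩
    have ht0 : 0 < |s.im| := by linarith
    have hs0 : s ≠ 0 := by rintro rfl; simp at ht0
    have h := hC (s + 1) ⟨by simpa using hs.1, by simpa using hs.2⟩ (by simpa using ht)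
    rw [Gamma_add_one s hs0, norm_mul, add_im, one_im, add_zero, add_re, one_re,
      Real.rpow_add_one ht0.ne'] at h
    have h1 : |s.im| * (‖Gamma s‖ * Real.exp (Real.pi / 2 * |s.im|)) ≤
        |s.im| * (C * |s.im| ^ s.re) := by
      calc _ ≤ ‖s‖ * (‖Gamma s‖ * Real.exp (Real.pi / 2 * |s.im|)) := by
            gcongr; exact abs_im_le_norm s
        _ ≤ _ := by linarith
    exact le_of_mul_le_mul_left h1 ht0

theorem norm_cos_le_exp (z : ℂ) : ‖Complex.cos z‖ ≤ Real.exp |z.im| := by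
  rw [Complex.cos, norm_div]
  have h1 : ‖cexp (z * I)‖ ≤ Real.exp |z.im| := by
    rw [norm_exp]
    simpa using neg_le_abs z.im
  have h2 : ‖cexp (-z * I)‖ ≤ Real.exp |z.im| := by
    rw [norm_exp]
    simpa using le_abs_self z.im
  have := norm_add_le (cexp (z * I)) (cexp (-z * I))
  simp only [norm_ofNat]
  linarith

/-! ### The factor `χ` of the functional equation -/

/-- The factor in the functional equation `ζ(1 - w) = χ(w) ζ(w)`, in the form
`π (2π)^{-w} / (sin(πw/2) Γ(1 - w))` to which `2 (2π)^{-w} Γ(w) cos(πw/2)` continues. -/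
def chi (w : ℂ) : ℂ :=
  Real.pi * (2 * Real.pi) ^ (-w) * (Complex.sin (Real.pi * w / 2))⁻¹ * (Gamma (1 - w))⁻¹

theorem two_pi_ne_zero' : (2 * Real.pi : ℂ) ≠ 0 := by
  simp [Real.pi_ne_zero]

/-- The reflection formula and `sin πw = 2 sin(πw/2) cos(πw/2)`. Integers are excluded since default
values may occur there. -/
theorem chi_eq {w : ℂ} (hw : ∀ n : ℤ, w ≠ n) :
    chi w = 2 * (2 * Real.pi) ^ (-w) * Gamma w * Complex.cos (Real.pi * w / 2) := by
  have hs : Complex.sin (Real.pi * w) ≠ 0 := by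
    intro h
    obtain ⟨k, hk⟩ := Complex.sin_eq_zero_iff.1 h
    apply hw k
    have : (Real.pi : ℂ) ≠ 0 := by exact_mod_cast Real.pi_ne_zero
    refine mul_left_cancel₀ this ?_
    rw [hk, mul_comm]
  have hG : Gamma (1 - w) ≠ 0 := by
    refine Gamma_ne_zero fun m hm => hw (m + 1) ?_
    push_cast
    linear_combination -hm
  have h2 : Complex.sin (Real.pi * w) =
      2 * Complex.sin (Real.pi * w / 2) * Complex.cos (Real.pi * w / 2) := by
    rw [← Complex.sin_two_mul]
    ring_nf
  have hs2 : Complex.sin (Real.pi * w / 2) ≠ 0 := by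
    intro h; rw [h2, h] at hs; simp at hs
  have hc2 : Complex.cos (Real.pi * w / 2) ≠ 0 := by
    intro h; rw [h2, h] at hs; simp at hs
  have h := Gamma_mul_Gamma_one_sub w
  rw [eq_div_iff hs, h2] at h
  rw [chi]
  field_simp
  linear_combination -h

theorem riemannZeta_one_sub_eq_chi_mul {w : ℂ} (hw : ∀ n : ℤ, w ≠ n) :
    riemannZeta (1 - w) = chi w * riemannZeta w := by
  rw [chi_eq hw, riemannZeta_one_sub (fun n => by simpa using hw (-n)) (by simpa using hw 1)]

/-- The default `Gamma 0 = 0` gives `1/Γ` its true value at the pole. This zero will cancel the pole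
of `F(1 - w)` at `w = 1`. -/
theorem chi_one : chi 1 = 0 := by simp [chi, Gamma_zero]

theorem ne_intCast_of_im_ne_zero {w : ℂ} (hw : w.im ≠ 0) (n : ℤ) : w ≠ n := by
  rintro rfl
  simp at hw

/-- The growth `e^{π|t|/2}` of the cosine is compensated by the decay of `Γ`; only a power of `|t|`
remains. -/
theorem exists_norm_chi_le (α β : ℝ) :
    ∃ C : ℝ, 0 ≤ C ∧ ∀ w ∈ strip α β, 1 ≤ |w.im| → ‖chi w‖ ≤ C * |w.im| ^ w.re := by
  obtain ⟨C, hC0, hC⟩ := exists_norm_Gamma_le α β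
  have hcont : ContinuousOn (fun σ : ℝ => (2 * Real.pi) ^ (-σ)) (Icc α β) :=
    ((Real.continuous_const_rpow (by positivity)).comp continuous_neg).continuousOn
  obtain ⟨B, hB⟩ := isCompact_Icc.exists_bound_of_continuousOn hcont
  refine ⟨2 * |B| * C, by positivity, fun w hw ht => ?_⟩
  have ht0 : w.im ≠ 0 := by
    intro h; rw [h] at ht; norm_num at ht
  have hpow : ‖(2 * Real.pi : ℂ) ^ (-w)‖ = (2 * Real.pi) ^ (-w.re) := by
    have := norm_cpow_eq_rpow_re_of_pos (show 0 < 2 * Real.pi by positivity) (-w)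
    simpa using this
  have hB' := (le_abs_self _).trans ((hB w.re hw).trans (le_abs_self B))
  have hcos : ‖Complex.cos (Real.pi * w / 2)‖ ≤ Real.exp (Real.pi / 2 * |w.im|) := by
    refine (norm_cos_le_exp _).trans (le_of_eq ?_)
    have : (Real.pi * w / 2 : ℂ) = ((Real.pi / 2 : ℝ) : ℂ) * w := by push_cast; ring
    rw [this, im_ofReal_mul, abs_mul, abs_of_pos (by positivity)]
  rw [chi_eq (ne_intCast_of_im_ne_zero ht0), norm_mul, norm_mul, norm_mul, hpow, norm_ofNat]
  calc _ ≤ 2 * |B| * ‖Gamma w‖ * Real.exp (Real.pi / 2 * |w.im|) := by gcongr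
    _ = 2 * |B| * (‖Gamma w‖ * Real.exp (Real.pi / 2 * |w.im|)) := by ring
    _ ≤ 2 * |B| * (C * |w.im| ^ w.re) := by
        exact mul_le_mul_of_nonneg_left (hC w hw ht) (by positivity)
    _ = _ := by ring

/-- Shifting the line by the period of the poles gains a factor of size `|w|⁻²`. Iterated, it
produces the factorial decay that lets the line go to `-∞`. -/
theorem chi_sub_two {w : ℂ} (h₁ : w ≠ 1) (h₂ : w ≠ 2) :
    chi (w - 2) = -(2 * Real.pi) ^ 2 / ((w - 1) * (w - 2)) * chi w := by
  have e1 : (2 * Real.pi : ℂ) ^ (-(w - 2)) = (2 * Real.pi) ^ (-w) * (2 * Real.pi) ^ 2 := by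
    rw [show -(w - 2) = -w + (2 : ℕ) by push_cast; ring, cpow_add _ _ two_pi_ne_zero', cpow_natCast]
  have e2 : Complex.sin (Real.pi * (w - 2) / 2) = -Complex.sin (Real.pi * w / 2) := by
    rw [show (Real.pi * (w - 2) / 2 : ℂ) = Real.pi * w / 2 - Real.pi by ring, Complex.sin_sub_pi]
  have n1 : (1 : ℂ) - w ≠ 0 := sub_ne_zero.2 h₁.symm
  have n2 : (2 : ℂ) - w ≠ 0 := sub_ne_zero.2 h₂.symm
  have n3 : w - 1 ≠ 0 := sub_ne_zero.2 h₁
  have n4 : w - 2 ≠ 0 := sub_ne_zero.2 h₂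
  have e3 : Gamma (1 - (w - 2)) = (2 - w) * ((1 - w) * Gamma (1 - w)) := by
    rw [← Gamma_add_one _ n1, show (1 : ℂ) - w + 1 = 2 - w by ring, ← Gamma_add_one _ n2]
    ring_nf
  rw [chi, chi, e1, e2, e3, mul_inv, mul_inv, inv_neg]
  field_simp
  ring

theorem sin_ne_zero_of_re {u : ℂ} (hu : u ≠ 0) (h : |u.re| < 2) :
    Complex.sin (Real.pi * u / 2) ≠ 0 := by
  intro h0
  obtain ⟨k, hk⟩ := Complex.sin_eq_zero_iff.1 h0
  have hpi : (Real.pi : ℂ) ≠ 0 := by exact_mod_cast Real.pi_ne_zero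
  have hu' : u = 2 * k := by
    refine mul_left_cancel₀ hpi ?_
    linear_combination 2 * hk
  have hk0 : k ≠ 0 := by rintro rfl; simp at hu'; exact hu hu'
  have hre : u.re = 2 * k := by rw [hu']; simp
  rw [hre, abs_mul, abs_two] at h
  have : (1 : ℝ) ≤ |(k : ℝ)| := by exact_mod_cast Int.one_le_abs hk0
  linarith

theorem differentiableAt_chi {w : ℂ} (h : Complex.sin (Real.pi * w / 2) ≠ 0) :
    DifferentiableAt ℂ chi w := by
  have h1 : DifferentiableAt ℂ (fun w : ℂ => (2 * Real.pi : ℂ) ^ (-w)) w :=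
    differentiableAt_id.neg.const_cpow (Or.inl two_pi_ne_zero')
  have h2 : DifferentiableAt ℂ (fun w : ℂ => (Gamma (1 - w))⁻¹) w :=
    (differentiable_one_div_Gamma.comp (differentiable_const 1 |>.sub differentiable_id)) w
  have h3 : DifferentiableAt ℂ (fun w : ℂ => Complex.sin (Real.pi * w / 2)) w := by fun_prop
  exact ((h1.const_mul _).mul (h3.inv h)).mul h2

/-- The function `u / sin(πu/2)`, continued to `u = 0`. -/
def divSin (u : ℂ) : ℂ := (dslope (fun u : ℂ => Complex.sin (Real.pi * u / 2)) 0 u)⁻¹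

theorem divSin_of_ne {u : ℂ} (hu : u ≠ 0) : divSin u = u / Complex.sin (Real.pi * u / 2) := by
  rw [divSin, dslope_of_ne _ hu, slope_def_field]
  simp

theorem hasDerivAt_sin_pi_mul_div_two (u : ℂ) :
    HasDerivAt (fun u : ℂ => Complex.sin (Real.pi * u / 2))
      (Real.pi / 2 * Complex.cos (Real.pi * u / 2)) u := by
  have h : HasDerivAt (fun u : ℂ => (Real.pi * u / 2 : ℂ)) (Real.pi / 2) u := by
    simpa using ((hasDerivAt_id u).const_mul (Real.pi : ℂ)).div_const 2
  refine h.csin.congr_deriv (by ring)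

theorem divSin_zero : divSin 0 = 2 / Real.pi := by
  rw [divSin, dslope_same, (hasDerivAt_sin_pi_mul_div_two 0).deriv]
  simp

theorem differentiableAt_divSin {u : ℂ} (h : |u.re| < 2) : DifferentiableAt ℂ divSin u := by
  have hd : DifferentiableOn ℂ (fun u : ℂ => Complex.sin (Real.pi * u / 2)) univ := by fun_prop
  have hds := ((differentiableOn_dslope (c := 0) univ_mem).2 hd).differentiableAt
    (x := u) univ_mem
  refine hds.inv ?_
  rcases eq_or_ne u 0 with rfl | hu
  · rw [dslope_same, (hasDerivAt_sin_pi_mul_div_two 0).deriv]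
    simp [Real.pi_ne_zero]
  · rw [dslope_of_ne _ hu, slope_def_field]
    simpa using ⟨sin_ne_zero_of_re hu h, hu⟩

/-- The function `(w + 2j) χ(w)`, continued to the pole `w = -2j` of `χ`. -/
def chiReg (j : ℕ) (w : ℂ) : ℂ :=
  (-1) ^ j * Real.pi * (2 * Real.pi) ^ (-w) * divSin (w + 2 * j) * (Gamma (1 - w))⁻¹

theorem chi_eq_chiReg_div {j : ℕ} {w : ℂ} (hw : w + 2 * j ≠ 0) :
    chi w = chiReg j w / (w + 2 * j) := by
  have h : Complex.sin (Real.pi * (w + 2 * j) / 2) = (-1) ^ j * Complex.sin (Real.pi * w / 2) := by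
    rw [show (Real.pi * (w + 2 * j) / 2 : ℂ) = Real.pi * w / 2 + j * Real.pi by ring,
      Complex.sin_antiperiodic.add_nat_mul_eq]
  rw [chi, chiReg, divSin_of_ne hw, h, div_eq_mul_inv _ ((-1) ^ j * _), mul_inv]
  have : ((-1 : ℂ) ^ j)⁻¹ = (-1) ^ j := by
    rw [← inv_pow]; norm_num
  rw [this]
  have h2 : ((-1 : ℂ) ^ j) * (-1) ^ j = 1 := by rw [← mul_pow]; simp
  rw [eq_div_iff hw]
  linear_combination (-(Real.pi * (2 * Real.pi) ^ (-w) * (w + 2 * j) *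
    (Complex.sin (Real.pi * w / 2))⁻¹ * (Gamma (1 - w))⁻¹)) * h2

theorem chiReg_neg_two_mul (j : ℕ) :
    chiReg j (-(2 * j)) = (-1) ^ j * 2 * (2 * Real.pi) ^ (2 * j) / (2 * j).factorial := by
  have hpi : (Real.pi : ℂ) ≠ 0 := by exact_mod_cast Real.pi_ne_zero
  have h1 : (1 : ℂ) - -(2 * j) = ((2 * j : ℕ) : ℂ) + 1 := by push_cast; ring
  have h2 : (2 * Real.pi : ℂ) ^ (-(-(2 * j : ℂ))) = (2 * Real.pi) ^ (2 * j) := by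
    rw [neg_neg, ← cpow_natCast]
    push_cast
    rfl
  rw [chiReg, h1, Gamma_nat_eq_factorial, h2, neg_add_cancel, divSin_zero]
  field_simp

theorem differentiableAt_chiReg {j : ℕ} {w : ℂ} (h : |w.re + 2 * j| < 2) :
    DifferentiableAt ℂ (chiReg j) w := by
  have h1 : DifferentiableAt ℂ (fun w : ℂ => (2 * Real.pi : ℂ) ^ (-w)) w :=
    differentiableAt_id.neg.const_cpow (Or.inl two_pi_ne_zero')
  have h2 : DifferentiableAt ℂ (fun w : ℂ => (Gamma (1 - w))⁻¹) w :=
    (differentiable_one_div_Gamma.comp (differentiable_const 1 |>.sub differentiable_id)) w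
  have h3 : DifferentiableAt ℂ (fun w : ℂ => divSin (w + 2 * j)) w :=
    (differentiableAt_divSin (by simpa using h)).comp w (by fun_prop)
  exact ((h1.const_mul _).mul h3).mul h2

/-! ### Bessel series and the Koshliakov kernel -/

/-- The `m`-th term of the power series of `I_ν`. -/
def besselTerm (m : ℕ) (ν z : ℂ) : ℂ :=
  (z / 2) ^ (2 * (m : ℂ) + ν) / ((m.factorial : ℂ) * Gamma ((m : ℂ) + 1 + ν))

/-- Each step of `Γ(z+1) = z Γ(z)` divides by `m + 1 + ν`, of norm at least `(m+1)/2` because `re ν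
> -1/2`. -/
theorem norm_inv_Gamma_add_le {ν : ℂ} (hν : -(1 / 2) < ν.re) (m : ℕ) :
    ‖(Gamma (m + 1 + ν))⁻¹‖ ≤ ‖(Gamma (1 + ν))⁻¹‖ * (2 ^ m / m.factorial) := by
  induction m with
  | zero => simp
  | succ m ih =>
    have hre : ((m : ℝ) + 1) / 2 ≤ ‖(m + 1 + ν : ℂ)‖ := by
      refine le_trans ?_ (re_le_norm _)
      have : (0 : ℝ) ≤ m := m.cast_nonneg
      simp
      linarith
    have hpos : 0 < ((m : ℝ) + 1) / 2 := by positivity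
    have hne : (m + 1 + ν : ℂ) ≠ 0 := norm_pos_iff.1 (hpos.trans_le hre)
    have e : Gamma ((m + 1 : ℕ) + 1 + ν) = (m + 1 + ν) * Gamma (m + 1 + ν) := by
      rw [← Gamma_add_one _ hne]
      push_cast
      ring_nf
    rw [e, mul_inv, norm_mul, norm_inv (m + 1 + ν : ℂ), Nat.factorial_succ]
    calc ‖(m + 1 + ν : ℂ)‖⁻¹ * ‖(Gamma (m + 1 + ν))⁻¹‖
        ≤ (((m : ℝ) + 1) / 2)⁻¹ * (‖(Gamma (1 + ν))⁻¹‖ * (2 ^ m / m.factorial)) := by gcongr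
      _ = _ := by
        push_cast
        field_simp
        ring_nf

/-- Uniformity in the order is the point: it makes the series differentiable in `ν`, as is needed
for the limits defining `Y_0` and `K_0`. The constant bounds `(x/2)^ν / Γ(1+ν)` on `K`. -/
theorem exists_norm_besselTerm_le {K : Set ℂ} (hK : IsCompact K) (hre : ∀ ν ∈ K, -(1 / 2) < ν.re)
    {x : ℝ} (hx : 0 < x) : ∃ C : ℝ, ∀ ν ∈ K, ∀ m : ℕ,
      ‖besselTerm m ν x‖ ≤ C * ((x ^ 2 / 2) ^ m / m.factorial) := by
  have hx2 : 0 < x / 2 := by positivity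
  have hc : Continuous fun ν : ℂ => ((x / 2 : ℝ) : ℂ) ^ ν * (Gamma (1 + ν))⁻¹ := by
    refine Continuous.mul ?_ ?_
    · exact continuous_id.const_cpow (Or.inl (by exact_mod_cast hx2.ne'))
    · exact differentiable_one_div_Gamma.continuous.comp (by fun_prop)
  obtain ⟨C, hC⟩ := hK.exists_bound_of_continuousOn hc.continuousOn
  refine ⟨C, fun ν hν m => ?_⟩
  have hC0 : 0 ≤ C := (norm_nonneg _).trans (hC ν hν)
  have hb := hC ν hν
  rw [norm_mul, norm_cpow_eq_rpow_re_of_pos hx2] at hb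
  have e1 : ‖((x : ℂ) / 2) ^ (2 * (m : ℂ) + ν)‖ = (x / 2) ^ (2 * m) * (x / 2) ^ ν.re := by
    rw [show ((x : ℂ) / 2) = ((x / 2 : ℝ) : ℂ) by push_cast; rfl, norm_cpow_eq_rpow_re_of_pos hx2,
      ← Real.rpow_natCast, ← Real.rpow_add hx2]
    simp
  have hG := norm_inv_Gamma_add_le (hre ν hν) m
  have hf : (1 : ℝ) ≤ m.factorial := by exact_mod_cast m.factorial_pos
  rw [besselTerm, div_eq_mul_inv, mul_inv, norm_mul, norm_mul, e1, norm_inv, Complex.norm_natCast]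
  calc _ ≤ (x / 2) ^ (2 * m) * (x / 2) ^ ν.re *
          ((m.factorial : ℝ)⁻¹ * (‖(Gamma (1 + ν))⁻¹‖ * (2 ^ m / m.factorial))) := by gcongr
    _ = ((x / 2) ^ ν.re * ‖(Gamma (1 + ν))⁻¹‖) *
          ((x ^ 2 / 2) ^ m / m.factorial * (m.factorial : ℝ)⁻¹) := by
        rw [pow_mul, show x ^ 2 / 2 = (x / 2) ^ 2 * 2 by ring, mul_pow]
        ring
    _ ≤ C * ((x ^ 2 / 2) ^ m / m.factorial * 1) := by
        gcongr
        exact inv_le_one_of_one_le₀ hf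
    _ = _ := by ring

theorem summable_besselTerm {ν : ℂ} (hν : -(1 / 2) < ν.re) {x : ℝ} (hx : 0 < x) :
    Summable fun m => besselTerm m ν x := by
  obtain ⟨C, hC⟩ := exists_norm_besselTerm_le isCompact_singleton (K := {ν})
    (by simpa using hν) hx
  exact Summable.of_norm_bounded ((Real.summable_pow_div_factorial _).mul_left C)
    fun m => hC ν rfl m

theorem besselI_eq_tsum (ν z : ℂ) : besselI ν z = ∑' m, besselTerm m ν z := rfl

theorem besselJ_eq_tsum (ν z : ℂ) : besselJ ν z = ∑' m, (-1) ^ m * besselTerm m ν z := by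
  simp only [besselJ, besselTerm, mul_div_assoc]

theorem hasSum_two_mul_of_summable {b : ℕ → ℂ} (hb : Summable b) :
    HasSum (fun j => b (2 * j)) ((∑' m, b m + ∑' m, (-1) ^ m * b m) / 2) := by
  have h3 : Summable fun j : ℕ => b (2 * j) :=
    hb.comp_injective (mul_right_injective₀ two_ne_zero)
  have h4 : Summable fun j : ℕ => b (2 * j + 1) :=
    hb.comp_injective (i := fun j : ℕ => 2 * j + 1) (fun m n h => by simpa using h)
  have p1 : ∀ j : ℕ, (-1 : ℂ) ^ (2 * j) * b (2 * j) = b (2 * j) := fun j => by simp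
  have p2 : ∀ j : ℕ, (-1 : ℂ) ^ (2 * j + 1) * b (2 * j + 1) = -b (2 * j + 1) := fun j => by
    simp [pow_succ]
  have e1 := tsum_even_add_odd h3 h4
  have e2 := tsum_even_add_odd (f := fun m => (-1) ^ m * b m) (by simpa only [p1] using h3)
    (by simpa only [p2] using h4.neg)
  simp only [p1, p2, tsum_neg] at e2
  rw [← e1, ← e2]
  convert h3.hasSum using 1
  ring

/-- The two series differ by the signs `(-1)^m`, so half their sum keeps the even terms. The even
indices `2j` will match the poles of `χ` at `-2j`. -/
theorem hasSum_besselTerm_two_mul {ν : ℂ} (hν : -(1 / 2) < ν.re) {x : ℝ} (hx : 0 < x) :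
    HasSum (fun j : ℕ => besselTerm (2 * j) ν x) ((besselI ν x + besselJ ν x) / 2) := by
  rw [besselI_eq_tsum, besselJ_eq_tsum]
  exact hasSum_two_mul_of_summable (summable_besselTerm hν hx)

theorem differentiableAt_bessel {x : ℝ} (hx : 0 < x) :
    DifferentiableAt ℂ (fun ν => besselI ν x) 0 ∧ DifferentiableAt ℂ (fun ν => besselJ ν x) 0 := by
  have hmem : Metric.ball (0 : ℂ) (1 / 4) ∈ 𝓝 (0 : ℂ) := Metric.ball_mem_nhds _ (by norm_num)
  have hre : ∀ ν ∈ Metric.closedBall (0 : ℂ) (1 / 4), -(1 / 2) < ν.re := by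
    intro ν hν
    have h1 := (abs_le.1 (abs_re_le_norm ν)).1
    have h2 : ‖ν‖ ≤ 1 / 4 := by simpa using hν
    linarith
  obtain ⟨C, hC⟩ := exists_norm_besselTerm_le (isCompact_closedBall (0 : ℂ) (1 / 4)) hre hx
  · have hu := (Real.summable_pow_div_factorial (x ^ 2 / 2)).mul_left C
    have hd : ∀ m : ℕ, DifferentiableOn ℂ (fun ν => besselTerm m ν x) (Metric.ball (0 : ℂ) (1 / 4)) := by
      intro m
      refine Differentiable.differentiableOn fun ν => ?_
      have hx0 : (x / 2 : ℂ) ≠ 0 := by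
        have : (x : ℂ) ≠ 0 := by exact_mod_cast hx.ne'
        simpa using this
      have h1 : DifferentiableAt ℂ (fun ν : ℂ => (x / 2 : ℂ) ^ (2 * (m : ℂ) + ν)) ν :=
        DifferentiableAt.const_cpow (by fun_prop) (Or.inl hx0)
      have h2 : DifferentiableAt ℂ (fun ν : ℂ => (Gamma ((m : ℂ) + 1 + ν))⁻¹) ν :=
        (differentiable_one_div_Gamma.comp (differentiable_id.const_add _)) ν
      have e : (fun ν : ℂ => besselTerm m ν x) = fun ν => (x / 2 : ℂ) ^ (2 * (m : ℂ) + ν) *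
          ((m.factorial : ℂ)⁻¹ * (Gamma ((m : ℂ) + 1 + ν))⁻¹) := by
        ext ν
        rw [besselTerm, div_eq_mul_inv, mul_inv]
      rw [e]
      exact h1.mul (h2.const_mul _)
    have hle : ∀ (m : ℕ) (ν : ℂ), ν ∈ Metric.ball (0 : ℂ) (1 / 4) → ‖besselTerm m ν x‖ ≤ _ :=
      fun m ν hν => hC ν (Metric.ball_subset_closedBall hν) m
    constructor
    · exact (differentiableOn_tsum_of_summable_norm hu hd Metric.isOpen_ball hle).differentiableAt
        hmem
    · simp_rw [besselJ_eq_tsum]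
      exact (differentiableOn_tsum_of_summable_norm hu (fun m => (hd m).const_mul ((-1) ^ m))
        Metric.isOpen_ball (fun m ν hν => by simpa using hle m ν hν)).differentiableAt hmem

theorem tendsto_div_sin_pi_mul {N : ℂ → ℂ} (hN : DifferentiableAt ℂ N 0) (h0 : N 0 = 0) :
    Tendsto (fun μ : ℂ => N μ / Complex.sin (Real.pi * μ)) (𝓝[≠] 0) (𝓝 (deriv N 0 / Real.pi)) := by
  have hs : HasDerivAt (fun μ : ℂ => Complex.sin (Real.pi * μ)) Real.pi 0 := by
    have : HasDerivAt (fun μ : ℂ => (Real.pi * μ : ℂ)) Real.pi 0 := by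
      simpa using (hasDerivAt_id (0 : ℂ)).const_mul (Real.pi : ℂ)
    simpa using this.csin
  have h1 := hasDerivAt_iff_tendsto_slope_zero.1 hN.hasDerivAt
  have h2 := hasDerivAt_iff_tendsto_slope_zero.1 hs
  have h3 := h1.div h2 (by exact_mod_cast Real.pi_ne_zero)
  refine h3.congr' ?_
  filter_upwards [self_mem_nhdsWithin] with μ hμ
  have hμ0 : μ ≠ 0 := hμ
  simp only [Pi.div_apply, zero_add, h0, sub_zero, mul_zero, Complex.sin_zero, smul_eq_mul]
  rw [mul_div_mul_left _ _ (inv_ne_zero hμ0)]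

theorem eq_zero_of_eq_intCast {a : ℂ} (h₁ : -(1 / 2 : ℝ) < a.re) (h₂ : a.re < 1 / 2)
    (h : ∃ k : ℤ, a = k) : a = 0 := by
  obtain ⟨k, rfl⟩ := h
  simp only [intCast_re] at h₁ h₂
  have h3 : (-1 : ℝ) < k := by linarith
  have h4 : (k : ℝ) < 1 := by linarith
  have h5 : (-1 : ℤ) < k := by exact_mod_cast h3
  have h6 : k < (1 : ℤ) := by exact_mod_cast h4
  have : k = 0 := by omega
  simp [this]

theorem not_eq_intCast {a : ℂ} (h₁ : -(1 / 2 : ℝ) < a.re) (h₂ : a.re < 1 / 2) (h : a ≠ 0) :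
    ¬ ∃ k : ℤ, a = k := fun hk => h (eq_zero_of_eq_intCast h₁ h₂ hk)

/-- The limits in the definitions of `Y_0` and `K_0` exist because the numerators are differentiable
in the order and vanish at `0`; otherwise `limUnder` would be a default value. -/
theorem tendsto_koshliakovKernel {x : ℝ} (hx : 0 < x) :
    Tendsto (fun μ => koshliakovKernel μ x) (𝓝[≠] 0) (𝓝 (koshliakovKernel 0 x)) := by
  obtain ⟨hI, hJ⟩ := differentiableAt_bessel hx
  have hI' : DifferentiableAt ℂ (fun ν => besselI (-ν) x) 0 :=
    DifferentiableAt.comp (0 : ℂ) (g := fun ν => besselI ν x) (by simpa using hI)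
      differentiableAt_id.neg
  have hJ' : DifferentiableAt ℂ (fun ν => besselJ (-ν) x) 0 :=
    DifferentiableAt.comp (0 : ℂ) (g := fun ν => besselJ ν x) (by simpa using hJ)
      differentiableAt_id.neg
  have hcos : DifferentiableAt ℂ (fun ν : ℂ => Complex.cos (Real.pi * ν)) 0 := by fun_prop
  have tY := tendsto_div_sin_pi_mul (N := fun μ => besselJ μ x * Complex.cos (Real.pi * μ) -
    besselJ (-μ) x) ((hJ.mul hcos).sub hJ') (by simp)
  have tK := (tendsto_div_sin_pi_mul (N := fun μ => besselI (-μ) x - besselI μ x) (hI'.sub hI)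
    (by simp)).const_mul (Real.pi / 2 : ℂ)
  have hex : ∃ k : ℤ, (0 : ℂ) = k := ⟨0, by simp⟩
  have c1 : Tendsto (fun μ : ℂ => Complex.cos (Real.pi * μ / 2)) (𝓝[≠] 0)
      (𝓝 (Complex.cos (Real.pi * 0 / 2))) :=
    (Continuous.tendsto (by fun_prop) 0).mono_left nhdsWithin_le_nhds
  have c2 : Tendsto (fun μ : ℂ => Complex.sin (Real.pi * μ / 2)) (𝓝[≠] 0)
      (𝓝 (Complex.sin (Real.pi * 0 / 2))) :=
    (Continuous.tendsto (by fun_prop) 0).mono_left nhdsWithin_le_nhds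
  have c3 : Tendsto (fun μ : ℂ => besselJ μ x) (𝓝[≠] 0) (𝓝 (besselJ 0 x)) :=
    hJ.continuousAt.tendsto.mono_left nhdsWithin_le_nhds
  rw [koshliakovKernel, besselY, besselK, if_pos hex, if_pos hex, tY.limUnder_eq, tK.limUnder_eq]
  refine ((((tK.const_mul (2 / Real.pi : ℂ)).sub tY).mul c1).sub (c3.mul c2)).congr' ?_
  have hball : Metric.ball (0 : ℂ) (1 / 2) ∈ 𝓝[≠] (0 : ℂ) :=
    mem_nhdsWithin_of_mem_nhds (Metric.ball_mem_nhds _ (by norm_num))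
  filter_upwards [self_mem_nhdsWithin, hball] with μ hμ hb
  have hb' : ‖μ‖ < 1 / 2 := by simpa using hb
  have hre := abs_le.1 (abs_re_le_norm μ)
  have hni := not_eq_intCast (a := μ) (by linarith [hre.1]) (by linarith [hre.2]) hμ
  rw [koshliakovKernel, besselY, besselK, if_neg hni, if_neg hni]

/-- Since `cos πa = 1 - 2 sin²(πa/2)`, the term `J_a sin(πa/2)` cancels what `cos πa` adds in `Y_a`.
The rest is odd in `a` up to the common denominator, with `I` and `J` entering only through `I + J`.
-/
theorem koshliakovKernel_of_ne_zero {a : ℂ} (h₁ : -(1 / 2 : ℝ) < a.re) (h₂ : a.re < 1 / 2)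
    (h : a ≠ 0) (x : ℝ) : koshliakovKernel a x =
      ((besselI (-a) x + besselJ (-a) x) / 2 - (besselI a x + besselJ a x) / 2) /
        Complex.sin (Real.pi * a / 2) := by
  have hni := not_eq_intCast h₁ h₂ h
  have hs : Complex.sin (Real.pi * a / 2) ≠ 0 :=
    sin_ne_zero_of_re h (abs_lt.2 ⟨by linarith, by linarith⟩)
  have hpi : (Real.pi : ℂ) ≠ 0 := by exact_mod_cast Real.pi_ne_zero
  have e1 : Complex.sin (Real.pi * a) =
      2 * Complex.sin (Real.pi * a / 2) * Complex.cos (Real.pi * a / 2) := by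
    rw [← Complex.sin_two_mul]; ring_nf
  have e2 : Complex.cos (Real.pi * a) = 1 - 2 * Complex.sin (Real.pi * a / 2) ^ 2 := by
    rw [show (Real.pi * a : ℂ) = 2 * (Real.pi * a / 2) by ring, Complex.cos_two_mul,
      Complex.cos_sq']
    ring_nf
  have hc : Complex.cos (Real.pi * a / 2) ≠ 0 := by
    intro h0
    rw [h0, mul_zero] at e1
    obtain ⟨k, hk⟩ := Complex.sin_eq_zero_iff.1 e1
    exact hni ⟨k, mul_left_cancel₀ hpi (by rw [hk, mul_comm])⟩
  rw [koshliakovKernel, besselY, besselK, if_neg hni, if_neg hni, e1, e2]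
  field_simp
  ring

/-! ### Mellin-Barnes integral of the kernel -/

/-- The kernel of the dual side, `2π y^{a/2}` times the Koshliakov kernel at `4π√y`. -/
def voronoiKernel (a : ℂ) (y : ℝ) : ℂ :=
  2 * Real.pi * (y : ℂ) ^ (a / 2) * koshliakovKernel a (4 * Real.pi * √y)

/-- The integrand of the Mellin-Barnes integral for `voronoiKernel`. -/
def mellinBarnes (a : ℂ) (y : ℝ) (w : ℂ) : ℂ := chi w * chi (w + a) * (y : ℂ) ^ (-w)

/-- The function `mellinBarnes` with its poles at `-2j` and `-2j - a` removed. -/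
def mellinBarnesReg (a : ℂ) (y : ℝ) (j : ℕ) (w : ℂ) : ℂ :=
  chiReg j w * chiReg j (w + a) * (y : ℂ) ^ (-w)

theorem ofReal_sqrt_cpow {y : ℝ} (hy : 0 < y) (s : ℂ) : ((√y : ℝ) : ℂ) ^ s = (y : ℂ) ^ (s / 2) := by
  have h1 : ((√y : ℝ) : ℂ) ≠ 0 := by exact_mod_cast (Real.sqrt_pos.2 hy).ne'
  have h2 : (y : ℂ) ≠ 0 := by exact_mod_cast hy.ne'
  rw [cpow_def_of_ne_zero h1, cpow_def_of_ne_zero h2, ← ofReal_log (Real.sqrt_nonneg y),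
    ← ofReal_log hy.le, Real.log_sqrt hy.le]
  push_cast
  ring_nf

theorem besselTerm_four_pi_sqrt {y : ℝ} (hy : 0 < y) (ν : ℂ) (j : ℕ) :
    besselTerm (2 * j) ν ((4 * Real.pi * √y : ℝ) : ℂ) =
      (2 * Real.pi) ^ (4 * j) * (2 * Real.pi) ^ ν * (y ^ (2 * j) * (y : ℂ) ^ (ν / 2)) /
        ((2 * j).factorial * Gamma (1 + 2 * j + ν)) := by
  have hy0 : (y : ℂ) ≠ 0 := by exact_mod_cast hy.ne'
  have h1 : (((4 * Real.pi * √y : ℝ) : ℂ) / 2) = ((2 * Real.pi : ℝ) : ℂ) * ((√y : ℝ) : ℂ) := by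
    push_cast; ring
  have h2 : (2 * ((2 * j : ℕ) : ℂ) + ν) = ((4 * j : ℕ) : ℂ) + ν := by push_cast; ring
  have h3 : (((4 * j : ℕ) : ℂ) + ν) / 2 = ((2 * j : ℕ) : ℂ) + ν / 2 := by push_cast; ring
  rw [besselTerm, h1, h2, mul_cpow_ofReal_nonneg (by positivity) (Real.sqrt_nonneg y),
    ofReal_sqrt_cpow hy, h3, cpow_add _ _ hy0, cpow_natCast]
  push_cast
  rw [show (4 * (j : ℂ)) = ((4 * j : ℕ) : ℂ) by push_cast; rfl, cpow_add _ _ two_pi_ne_zero',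
    cpow_natCast, show (2 * (j : ℂ) + 1 + ν) = 1 + 2 * j + ν by ring]

theorem chiReg_sub_two_mul {u : ℂ} (hu : u ≠ 0) (j : ℕ) :
    chiReg j (u - 2 * j) = (-1) ^ j * Real.pi * ((2 * Real.pi) ^ (2 * j) * (2 * Real.pi) ^ (-u)) *
      (u / Complex.sin (Real.pi * u / 2)) * (Gamma (1 + 2 * j - u))⁻¹ := by
  rw [chiReg, show u - 2 * (j : ℂ) + 2 * j = u by ring, divSin_of_ne hu,
    show 1 - (u - 2 * (j : ℂ)) = 1 + 2 * j - u by ring,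
    show -(u - 2 * (j : ℂ)) = ((2 * j : ℕ) : ℂ) + -u by push_cast; ring,
    cpow_add _ _ two_pi_ne_zero', cpow_natCast]

/-- The residue at `-2j` is the `2j`-th term of the series of order `-a`, and the residue at `-2j-a`
that of order `a`, after multiplication by the prefactor `2π y^{a/2} / sin(πa/2)`. The divided
difference is the sum of the two. -/
theorem hasSum_residues {a : ℂ} (h₁ : -(1 / 2 : ℝ) < a.re) (h₂ : a.re < 1 / 2) (h : a ≠ 0) {y : ℝ}
    (hy : 0 < y) :
    HasSum (fun j : ℕ => dslope (mellinBarnesReg a y j) (-(2 * j)) (-a - 2 * j))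
      (voronoiKernel a y) := by
  have hx : 0 < 4 * Real.pi * √y := by positivity
  have hy0 : (y : ℂ) ≠ 0 := by exact_mod_cast hy.ne'
  have s1 := hasSum_besselTerm_two_mul (ν := -a) (by simp; linarith) hx
  have s2 := hasSum_besselTerm_two_mul (ν := a) (by linarith) hx
  rw [voronoiKernel, koshliakovKernel_of_ne_zero h₁ h₂ h]
  have hs : Complex.sin (Real.pi * a / 2) ≠ 0 :=
    sin_ne_zero_of_re h (abs_lt.2 ⟨by linarith, by linarith⟩)
  refine (((s1.sub s2).div_const _).mul_left _).congr_fun ?_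
  intro j
  have hne : -a - 2 * (j : ℂ) ≠ -(2 * j) := by
    intro h0
    exact h (by linear_combination -h0)
  rw [besselTerm_four_pi_sqrt hy, besselTerm_four_pi_sqrt hy, dslope_of_ne _ hne, slope_def_field,
    mellinBarnesReg, mellinBarnesReg, chiReg_neg_two_mul, show -(2 * (j : ℂ)) + a = a - 2 * j by ring,
    chiReg_sub_two_mul h, chiReg_sub_two_mul (neg_ne_zero.2 h),
    show -a - 2 * (j : ℂ) + a = -(2 * j) by ring, chiReg_neg_two_mul,
    show -(-a - 2 * (j : ℂ)) = ((2 * j : ℕ) : ℂ) + a by push_cast; ring, cpow_add _ _ hy0,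
    cpow_natCast, show -(-(2 * (j : ℂ))) = ((2 * j : ℕ) : ℂ) by push_cast; ring, cpow_natCast,
    show -a - 2 * (j : ℂ) - -(2 * j) = -a by ring,
    show (Real.pi * -a / 2 : ℂ) = -(Real.pi * a / 2) by ring, Complex.sin_neg, neg_neg,
    show -a / 2 = -(a / 2) by ring, cpow_neg (y : ℂ) (a / 2),
    show (y : ℂ) ^ a = (y : ℂ) ^ (a / 2) * (y : ℂ) ^ (a / 2) by rw [← cpow_add _ _ hy0]; ring_nf,
    sub_neg_eq_add, ← sub_eq_add_neg]
  have hp : (y : ℂ) ^ (a / 2) ≠ 0 := by simp [cpow_eq_zero_iff, hy0]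
  have hj : ((-1 : ℂ) ^ j) * (-1) ^ j = 1 := by rw [← mul_pow]; simp
  generalize (y : ℂ) ^ (a / 2) = Y at *
  generalize (Gamma (1 + 2 * (j : ℂ) - a)) = G₁
  generalize (Gamma (1 + 2 * (j : ℂ) + a)) = G₂
  generalize (2 * Real.pi : ℂ) ^ (-a) = P₁
  generalize (2 * Real.pi : ℂ) ^ a = P₂
  have hf : ((2 * j).factorial : ℂ) ≠ 0 := by exact_mod_cast (2 * j).factorial_ne_zero
  generalize (((2 * j).factorial : ℕ) : ℂ) = f at *
  simp only [div_eq_mul_inv, mul_inv]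
  field_simp
  linear_combination (Real.pi ^ (4 * j) * 2 ^ (4 * j) * (P₁ * G₁⁻¹ - P₂ * Y ^ 2 * G₂⁻¹) : ℂ) * hj

theorem exists_norm_cpow_neg_le {y : ℝ} (hy : 0 < y) (α β : ℝ) :
    ∃ B : ℝ, 0 ≤ B ∧ ∀ w ∈ strip α β, ‖(y : ℂ) ^ (-w)‖ ≤ B := by
  have hcont : ContinuousOn (fun σ : ℝ => y ^ (-σ)) (Icc α β) :=
    ((Real.continuous_const_rpow hy.ne').comp continuous_neg).continuousOn
  obtain ⟨B, hB⟩ := isCompact_Icc.exists_bound_of_continuousOn hcont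
  refine ⟨|B|, abs_nonneg B, fun w hw => ?_⟩
  rw [norm_cpow_eq_rpow_re_of_pos hy, neg_re]
  exact (le_abs_self _).trans ((hB w.re hw).trans (le_abs_self B))

theorem exists_norm_chi_le_div {α β : ℝ} (hβ : β ≤ -1) :
    ∃ C : ℝ, 0 ≤ C ∧ ∀ w ∈ strip α β, 1 ≤ |w.im| → ‖chi w‖ ≤ C / |w.im| := by
  obtain ⟨C, hC0, hC⟩ := exists_norm_chi_le α β
  refine ⟨C, hC0, fun w hw ht => (hC w hw ht).trans ?_⟩
  rw [div_eq_mul_inv, ← Real.rpow_neg_one]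
  gcongr
  exact hw.2.trans hβ

/-- Here `re w ≤ -3/2` and `re (w + a) < -1`, so each factor `χ` is `O(1/|im w|)`. -/
theorem quadraticDecay_mellinBarnes {a : ℂ} (h₂ : a.re < 1 / 2) {y : ℝ} (hy : 0 < y) {α β : ℝ}
    (hβ : β ≤ -(3 / 2)) : QuadraticDecay (mellinBarnes a y) α β := by
  obtain ⟨B, hB0, hB⟩ := exists_norm_cpow_neg_le hy α β
  obtain ⟨C₁, hC₁0, hC₁⟩ := exists_norm_chi_le_div (α := α) (β := β) (by linarith)
  obtain ⟨C₂, hC₂0, hC₂⟩ := exists_norm_chi_le_div (α := α + a.re) (β := β + a.re) (by linarith)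
  refine ⟨C₁ * (2 * C₂) * B, 2 * |a.im| + 2, by positivity, fun w hw ht => ?_⟩
  have ha0 := abs_nonneg a.im
  have h1 : 1 ≤ |w.im| := by linarith
  have h3 : |w.im| / 2 ≤ |(w + a).im| := by
    have := abs_sub_abs_le_abs_sub w.im (-a.im)
    rw [abs_neg, sub_neg_eq_add] at this
    rw [add_im]
    linarith
  have h4 : ‖chi (w + a)‖ ≤ 2 * C₂ / |w.im| := by
    refine (hC₂ (w + a) ⟨by simpa using hw.1, by simpa using hw.2⟩ (by linarith)).trans ?_
    rw [div_le_div_iff₀ (by linarith) (by linarith)]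
    nlinarith
  rw [mellinBarnes, norm_mul, norm_mul, ← sq_abs]
  calc _ ≤ C₁ / |w.im| * (2 * C₂ / |w.im|) * B := by
        gcongr
        · exact hC₁ w hw h1
        · exact hB w hw
    _ = _ := by field_simp

theorem mellinBarnes_eq_div {a : ℂ} {y : ℝ} (j : ℕ) {w : ℂ} (hp : w ≠ -(2 * j))
    (hq : w ≠ -a - 2 * j) :
    mellinBarnes a y w = mellinBarnesReg a y j w / ((w - -(2 * j)) * (w - (-a - 2 * j))) := by
  have h1 : w + 2 * j ≠ 0 := fun h => hp (by linear_combination h)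
  have h2 : w + a + 2 * j ≠ 0 := fun h => hq (by linear_combination h)
  rw [mellinBarnes, mellinBarnesReg, chi_eq_chiReg_div h1, chi_eq_chiReg_div h2,
    show w - -(2 * (j : ℂ)) = w + 2 * j by ring, show w - (-a - 2 * (j : ℂ)) = w + a + 2 * j by ring]
  field_simp

theorem differentiableAt_mellinBarnesReg {a : ℂ} {y : ℝ} (hy : 0 < y) {j : ℕ} {w : ℂ}
    (h₁ : |w.re + 2 * j| < 2) (h₂ : |w.re + a.re + 2 * j| < 2) :
    DifferentiableAt ℂ (mellinBarnesReg a y j) w := by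
  have hy0 : (y : ℂ) ≠ 0 := by exact_mod_cast hy.ne'
  have h3 : DifferentiableAt ℂ (fun w : ℂ => chiReg j (w + a)) w :=
    (differentiableAt_chiReg (by simpa using h₂)).comp w (by fun_prop)
  exact ((differentiableAt_chiReg h₁).mul h3).mul
    (differentiableAt_id.neg.const_cpow (Or.inl hy0))

/-- The bounds on `re a` put both `-2(j+1)` and `-2(j+1) - a`, and no other pole, between the two
lines. -/
theorem verticalIntegral_mellinBarnes_sub {a : ℂ} (h₁ : -(1 / 2 : ℝ) < a.re) (h₂ : a.re < 1 / 2)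
    {y : ℝ} (hy : 0 < y) (j : ℕ) :
    verticalIntegral (mellinBarnes a y) (-(3 / 2) - 2 * j) -
      verticalIntegral (mellinBarnes a y) (-(3 / 2) - 2 * (j + 1 : ℕ)) =
    2 * Real.pi * dslope (mellinBarnesReg a y (j + 1)) (-(2 * (j + 1 : ℕ)))
      (-a - 2 * (j + 1 : ℕ)) := by
  have hj : (0 : ℝ) ≤ j := j.cast_nonneg
  have e1 : (-(2 * ((j + 1 : ℕ) : ℂ))).re = -(2 * ((j : ℝ) + 1)) := by simp
  have e2 : (-a - 2 * ((j + 1 : ℕ) : ℂ)).re = -a.re - 2 * ((j : ℝ) + 1) := by simp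
  refine verticalIntegral_sub_of_twoPoles ?_ ?_ ?_ ?_ ?_
    (quadraticDecay_mellinBarnes h₂ hy (by linarith)) fun w _ hp hq => mellinBarnes_eq_div _ hp hq
  · rw [e1]; push_cast; linarith
  · rw [e1]; linarith
  · rw [e2]; push_cast; linarith
  · rw [e2]; linarith
  · intro w hw
    have hw1 := hw.1
    have hw2 := hw.2
    push_cast at hw1 hw2
    refine (differentiableAt_mellinBarnesReg hy ?_ ?_).differentiableWithinAt
    · exact abs_lt.2 ⟨by push_cast; linarith, by push_cast; linarith⟩
    · exact abs_lt.2 ⟨by push_cast; linarith, by push_cast; linarith⟩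

/-- Two uses of `chi_sub_two` give four denominators of norm at least `n + 1`. Keeping only one
power of `n + 1` already yields `1/n!` after `n` shifts. -/
theorem norm_mellinBarnes_sub_two_le {a : ℂ} (h₂ : a.re < 1 / 2) {y : ℝ} (hy : 0 < y) {w : ℂ}
    {n : ℕ} (hw : w.re ≤ -(3 / 2) - 2 * n) :
    ‖mellinBarnes a y (w - 2)‖ ≤ (2 * Real.pi) ^ 4 * y ^ 2 / (n + 1) * ‖mellinBarnes a y w‖ := by
  have hn : (0 : ℝ) ≤ n := n.cast_nonneg
  have hy0 : (y : ℂ) ≠ 0 := by exact_mod_cast hy.ne'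
  have key : ∀ z : ℂ, z.re ≤ -1 - 2 * n → ∀ c : ℝ, 1 ≤ c → (n : ℝ) + 1 ≤ ‖z - c‖ := by
    intro z hz c hc
    have := (abs_le.1 (abs_re_le_norm (z - c))).1
    rw [sub_re, ofReal_re] at this
    linarith
  have hwa : (w + a).re ≤ -1 - 2 * n := by rw [add_re]; linarith
  have k1 := key w (by linarith) 1 le_rfl
  have k2 := key w (by linarith) 2 (by norm_num)
  have k3 := key (w + a) hwa 1 le_rfl
  have k4 := key (w + a) hwa 2 (by norm_num)
  simp only [ofReal_one, ofReal_ofNat] at k1 k2 k3 k4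
  have ne : ∀ {z c : ℂ}, (n : ℝ) + 1 ≤ ‖z - c‖ → z ≠ c := by
    rintro z c h rfl
    simp at h
    linarith
  have e : (y : ℂ) ^ (-(w - 2)) = (y : ℂ) ^ (-w) * y ^ 2 := by
    rw [show -(w - 2) = -w + (2 : ℕ) by push_cast; ring, cpow_add _ _ hy0, cpow_natCast]
  have e' : mellinBarnes a y (w - 2) = (2 * Real.pi) ^ 4 * y ^ 2 /
      (((w - 1) * (w - 2)) * ((w + a - 1) * (w + a - 2))) * mellinBarnes a y w := by
    rw [mellinBarnes, mellinBarnes, show w - 2 + a = w + a - 2 by ring, chi_sub_two (ne k1) (ne k2),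
      chi_sub_two (ne k3) (ne k4), e]
    have m1 := sub_ne_zero.2 (ne k1)
    have m2 := sub_ne_zero.2 (ne k2)
    have m3 := sub_ne_zero.2 (ne k3)
    have m4 := sub_ne_zero.2 (ne k4)
    field_simp
  rw [e', norm_mul, norm_div]
  have hnum : ‖((2 * Real.pi : ℂ) ^ 4 * (y : ℂ) ^ 2)‖ = (2 * Real.pi) ^ 4 * y ^ 2 := by
    rw [show ((2 * Real.pi : ℂ) ^ 4 * (y : ℂ) ^ 2) = (((2 * Real.pi) ^ 4 * y ^ 2 : ℝ) : ℂ) by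
      push_cast; rfl, norm_real, Real.norm_of_nonneg (by positivity)]
  have hden : (n : ℝ) + 1 ≤ ‖((w - 1) * (w - 2)) * ((w + a - 1) * (w + a - 2))‖ := by
    rw [norm_mul, norm_mul, norm_mul]
    calc (n : ℝ) + 1 ≤ (((n : ℝ) + 1) * (n + 1)) * ((n + 1) * (n + 1)) := by
          nlinarith [mul_nonneg hn hn, mul_nonneg hn (mul_nonneg hn hn),
            mul_nonneg (mul_nonneg hn hn) (mul_nonneg hn hn)]
      _ ≤ _ := by gcongr
  rw [hnum]
  gcongr

theorem ne_zero_of_re_lt {w : ℂ} (h : w.re < 0) : w ≠ 0 := by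
  rintro rfl
  simp at h

theorem differentiableAt_chi_of_re {w : ℂ} (h₁ : -2 < w.re) (h₂ : w.re < 0) :
    DifferentiableAt ℂ chi w :=
  differentiableAt_chi (sin_ne_zero_of_re (ne_zero_of_re_lt h₂) (abs_lt.2 ⟨h₁, by linarith⟩))

theorem continuousAt_mellinBarnes {a : ℂ} {y : ℝ} (hy : 0 < y) {w : ℂ} (h₁ : -2 < w.re)
    (h₂ : w.re < 0) (h₃ : -2 < (w + a).re) (h₄ : (w + a).re < 0) :
    ContinuousAt (mellinBarnes a y) w := by
  have hy0 : (y : ℂ) ≠ 0 := by exact_mod_cast hy.ne'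
  have h5 : ContinuousAt (fun w : ℂ => chi (w + a)) w :=
    ((differentiableAt_chi_of_re h₃ h₄).comp w (f := fun w : ℂ => w + a) (by fun_prop)).continuousAt
  exact ((differentiableAt_chi_of_re h₁ h₂).continuousAt.mul h5).mul
    (differentiableAt_id.neg.const_cpow (Or.inl hy0)).continuousAt

theorem continuous_mellinBarnes {a : ℂ} (h₁ : -(1 / 2 : ℝ) < a.re) (h₂ : a.re < 1 / 2) {y : ℝ}
    (hy : 0 < y) : Continuous fun t : ℝ => mellinBarnes a y ((-(3 / 2) : ℝ) + t * I) := by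
  rw [continuous_iff_continuousAt]
  intro t
  have hline : ContinuousAt (fun t : ℝ => (((-(3 / 2) : ℝ) : ℂ) + t * I)) t :=
    Continuous.continuousAt (by fun_prop)
  refine ContinuousAt.comp (g := mellinBarnes a y) ?_ hline
  refine continuousAt_mellinBarnes hy ?_ ?_ ?_ ?_ <;> simp <;> linarith

theorem integrable_mellinBarnes {a : ℂ} (h₁ : -(1 / 2 : ℝ) < a.re) (h₂ : a.re < 1 / 2) {y : ℝ}
    (hy : 0 < y) : Integrable fun t : ℝ => mellinBarnes a y ((-(3 / 2) : ℝ) + t * I) :=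
  integrable_vertical (right_mem_Icc.2 le_rfl) (continuous_mellinBarnes h₁ h₂ hy)
    (quadraticDecay_mellinBarnes h₂ hy le_rfl)

theorem tendsto_verticalIntegral_mellinBarnes {a : ℂ} (h₁ : -(1 / 2 : ℝ) < a.re)
    (h₂ : a.re < 1 / 2) {y : ℝ} (hy : 0 < y) :
    Tendsto (fun n : ℕ => verticalIntegral (mellinBarnes a y) (-(3 / 2) - 2 * n)) atTop (𝓝 0) := by
  set M : ℝ := (2 * Real.pi) ^ 4 * y ^ 2
  have hpt : ∀ (n : ℕ) (t : ℝ), ‖mellinBarnes a y ((-(3 / 2) - 2 * n : ℝ) + t * I)‖ ≤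
      M ^ n / n.factorial * ‖mellinBarnes a y ((-(3 / 2) : ℝ) + t * I)‖ := by
    intro n t
    induction n with
    | zero => simp
    | succ n ih =>
      have e : (((-(3 / 2) - 2 * (n + 1 : ℕ) : ℝ) : ℂ) + t * I) =
          ((-(3 / 2) - 2 * n : ℝ) : ℂ) + t * I - 2 := by push_cast; ring
      rw [e]
      refine (norm_mellinBarnes_sub_two_le h₂ hy (n := n) (by simp)).trans ?_
      calc _ ≤ M / (n + 1) * (M ^ n / n.factorial *
            ‖mellinBarnes a y ((-(3 / 2) : ℝ) + t * I)‖) := by gcongr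
        _ = _ := by
          rw [Nat.factorial_succ]
          push_cast
          field_simp
          ring
  have hlim := (FloorSemiring.tendsto_pow_div_factorial_atTop M).mul_const
    (∫ t : ℝ, ‖mellinBarnes a y ((-(3 / 2) : ℝ) + t * I)‖)
  rw [zero_mul] at hlim
  refine squeeze_zero_norm (fun n => ?_) hlim
  rw [← integral_const_mul]
  exact norm_integral_le_of_norm_le ((integrable_mellinBarnes h₁ h₂ hy).norm.const_mul _)
    (Eventually.of_forall (hpt n))

/-- The residues with `j ≥ 1` telescope to the integral over `re w = -3/2`, since the integral over
the far left line tends to zero. The residue with `j = 0` stays apart. -/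
theorem voronoiKernel_eq_of_ne_zero {a : ℂ} (h₁ : -(1 / 2 : ℝ) < a.re) (h₂ : a.re < 1 / 2)
    (h : a ≠ 0) {y : ℝ} (hy : 0 < y) :
    voronoiKernel a y = dslope (mellinBarnesReg a y 0) 0 (-a) +
      1 / (2 * Real.pi) * verticalIntegral (mellinBarnes a y) (-(3 / 2)) := by
  have hs := hasSum_residues h₁ h₂ h hy
  set r : ℕ → ℂ := fun j => dslope (mellinBarnesReg a y j) (-(2 * j)) (-a - 2 * j) with hr
  have hV : ∀ n : ℕ, ∑ j ∈ Finset.range n, r (j + 1) =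
      1 / (2 * Real.pi) * (verticalIntegral (mellinBarnes a y) (-(3 / 2)) -
        verticalIntegral (mellinBarnes a y) (-(3 / 2) - 2 * n)) := by
    intro n
    induction n with
    | zero => simp
    | succ n ih =>
      have := verticalIntegral_mellinBarnes_sub h₁ h₂ hy n
      rw [Finset.sum_range_succ, ih]
      have e : r (n + 1) = 1 / (2 * Real.pi) *
          (verticalIntegral (mellinBarnes a y) (-(3 / 2) - 2 * n) -
          verticalIntegral (mellinBarnes a y) (-(3 / 2) - 2 * (n + 1 : ℕ))) := by
        rw [this, one_div, inv_mul_cancel_left₀ two_pi_ne_zero']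
      rw [e]
      ring
  have h3 := ((hasSum_nat_add_iff' 1).2 hs).tendsto_sum_nat
  have h4 := ((tendsto_const_nhds (x := verticalIntegral (mellinBarnes a y) (-(3 / 2)))).sub
    (tendsto_verticalIntegral_mellinBarnes h₁ h₂ hy)).const_mul (1 / (2 * Real.pi) : ℂ)
  simp only [hV] at h3
  have h5 := tendsto_nhds_unique h3 h4
  simp only [Finset.sum_range_one, sub_zero, hr, Nat.cast_zero, mul_zero, neg_zero] at h5
  rw [← h5]
  ring

/-- A bound valid also near the real axis, on a strip around `re w = -3/2` wide enough for `w + a`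
with `|re a| < 1/4`: it gives the dominating function for `a → 0`. -/
theorem exists_norm_chi_le_div_one_add :
    ∃ C : ℝ, 0 ≤ C ∧ ∀ w ∈ strip (-(7 / 4)) (-(5 / 4)), ‖chi w‖ ≤ C / (1 + |w.im|) := by
  obtain ⟨C, hC0, hC⟩ := exists_norm_chi_le_div (α := -(7 / 4)) (β := -(5 / 4)) (by norm_num)
  have hK : IsCompact (Icc (-(7 / 4) : ℝ) (-(5 / 4)) ×ℂ Icc (-1) 1) :=
    isCompact_Icc.reProdIm isCompact_Icc
  obtain ⟨B, hB⟩ := hK.exists_bound_of_continuousOn (f := chi) fun w hw => by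
    have h1 := hw.1.1
    have h2 := hw.1.2
    exact (differentiableAt_chi_of_re (by linarith) (by linarith)).continuousAt.continuousWithinAt
  refine ⟨2 * C + 2 * |B|, by positivity, fun w hw => ?_⟩
  rw [le_div_iff₀ (by positivity)]
  rcases le_total 1 |w.im| with h | h
  · have h1 := hC w hw h
    rw [le_div_iff₀ (by linarith)] at h1
    nlinarith [norm_nonneg (chi w), abs_nonneg B]
  · have h1 := (hB w ⟨hw, abs_le.1 h⟩).trans (le_abs_self B)
    nlinarith [norm_nonneg (chi w), abs_nonneg B]

theorem tendsto_verticalIntegral_mellinBarnes_zero {y : ℝ} (hy : 0 < y) :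
    Tendsto (fun a => verticalIntegral (mellinBarnes a y) (-(3 / 2))) (𝓝[≠] 0)
      (𝓝 (verticalIntegral (mellinBarnes 0 y) (-(3 / 2)))) := by
  obtain ⟨C, hC0, hC⟩ := exists_norm_chi_le_div_one_add
  have hball : Metric.ball (0 : ℂ) (1 / 4) ∈ 𝓝[≠] (0 : ℂ) :=
    mem_nhdsWithin_of_mem_nhds (Metric.ball_mem_nhds _ (by norm_num))
  have hre : ∀ a ∈ Metric.ball (0 : ℂ) (1 / 4), |a.re| < 1 / 4 ∧ |a.im| < 1 / 4 := by
    intro a ha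
    have : ‖a‖ < 1 / 4 := by simpa using ha
    exact ⟨(abs_re_le_norm a).trans_lt this, (abs_im_le_norm a).trans_lt this⟩
  refine tendsto_integral_filter_of_dominated_convergence
    (fun t : ℝ => 2 * C ^ 2 * y ^ (3 / 2 : ℝ) * (1 + t ^ 2)⁻¹) ?_ ?_
    (integrable_inv_one_add_sq.const_mul _) ?_
  · filter_upwards [hball] with a ha
    have h := abs_lt.1 (hre a ha).1
    exact (continuous_mellinBarnes (by linarith) (by linarith) hy).aestronglyMeasurable
  · filter_upwards [hball] with a ha
    refine Eventually.of_forall fun t => ?_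
    have h := abs_lt.1 (hre a ha).1
    have him := (hre a ha).2
    have k1 := hC ((-(3 / 2) : ℝ) + t * I) (add_mul_I_mem_strip ⟨by norm_num, by norm_num⟩ t)
    have k2 := hC ((-(3 / 2) : ℝ) + t * I + a) ⟨by simp; linarith, by simp; linarith⟩
    simp only [add_im, ofReal_im, mul_im, ofReal_re, I_im, I_re, mul_one, mul_zero, add_zero,
      zero_add] at k1 k2
    have k3 : 1 + |t| ≤ 2 * (1 + |t + a.im|) := by
      have h1 := abs_sub_abs_le_abs_sub t (-a.im)
      rw [abs_neg, sub_neg_eq_add] at h1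
      linarith [abs_nonneg (t + a.im)]
    have k4 : C / (1 + |t + a.im|) ≤ 2 * C / (1 + |t|) := by
      rw [div_le_div_iff₀ (by positivity) (by positivity)]
      nlinarith
    have k5 : ‖(y : ℂ) ^ (-(((-(3 / 2) : ℝ) : ℂ) + t * I))‖ = y ^ (3 / 2 : ℝ) := by
      rw [norm_cpow_eq_rpow_re_of_pos hy]
      simp
    rw [mellinBarnes, norm_mul, norm_mul, k5]
    calc _ ≤ C / (1 + |t|) * (2 * C / (1 + |t|)) * y ^ (3 / 2 : ℝ) := by
          gcongr
          exact k2.trans k4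
      _ = 2 * C ^ 2 * y ^ (3 / 2 : ℝ) * ((1 + |t|) ^ 2)⁻¹ := by field_simp
      _ ≤ 2 * C ^ 2 * y ^ (3 / 2 : ℝ) * (1 + t ^ 2)⁻¹ := by
          gcongr
          rw [← sq_abs]
          nlinarith [abs_nonneg t]
  · refine Eventually.of_forall fun t => ?_
    have hc : ContinuousAt (fun a : ℂ => chi (((-(3 / 2) : ℝ) : ℂ) + t * I + a)) 0 := by
      have h1 : DifferentiableAt ℂ chi (((-(3 / 2) : ℝ) : ℂ) + t * I + 0) :=
        differentiableAt_chi_of_re (by simp; norm_num) (by simp)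
      exact h1.continuousAt.comp (f := fun a : ℂ => ((-(3 / 2) : ℝ) : ℂ) + t * I + a)
        (by fun_prop)
    exact ((continuousAt_const.mul hc).mul continuousAt_const).tendsto.mono_left nhdsWithin_le_nhds

theorem dslope_mellinBarnesReg_of_ne_zero {a : ℂ} (h : a ≠ 0) (y : ℝ) :
    dslope (mellinBarnesReg a y 0) 0 (-a) =
      2 / a * (chiReg 0 a - chiReg 0 (-a) * (y : ℂ) ^ a) := by
  have h0 : chiReg 0 0 = 2 := by simpa using chiReg_neg_two_mul 0
  rw [dslope_of_ne _ (neg_ne_zero.2 h), slope_def_field, mellinBarnesReg, mellinBarnesReg, h0]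
  simp only [neg_add_cancel, zero_add, neg_neg, neg_zero, cpow_zero, mul_one, sub_zero, h0]
  field_simp
  ring

theorem hasDerivAt_chiReg_zero : HasDerivAt (chiReg 0) (deriv (chiReg 0) 0) 0 :=
  (differentiableAt_chiReg (by simp)).hasDerivAt

theorem hasDerivAt_cpow_neg {y : ℝ} (hy : 0 < y) :
    HasDerivAt (fun w : ℂ => (y : ℂ) ^ (-w)) (-Complex.log y) 0 := by
  have hy0 : (y : ℂ) ≠ 0 := by exact_mod_cast hy.ne'
  simpa using (hasDerivAt_neg (0 : ℂ)).const_cpow (c := (y : ℂ)) (Or.inl hy0)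

theorem dslope_mellinBarnesReg_zero {y : ℝ} (hy : 0 < y) :
    dslope (mellinBarnesReg 0 y 0) 0 0 = 4 * deriv (chiReg 0) 0 - 4 * Complex.log y := by
  have h0 : chiReg 0 0 = 2 := by simpa using chiReg_neg_two_mul 0
  have e : mellinBarnesReg 0 y 0 = chiReg 0 * chiReg 0 * fun w : ℂ => (y : ℂ) ^ (-w) := by
    ext w
    rw [mellinBarnesReg, add_zero]
    rfl
  rw [dslope_same, e, ((hasDerivAt_chiReg_zero.mul hasDerivAt_chiReg_zero).mul
    (hasDerivAt_cpow_neg hy)).deriv]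
  simp only [Pi.mul_apply, h0, neg_zero, cpow_zero]
  ring

/-- Mellin-Barnes representation of the kernel. -/
theorem voronoiKernel_eq {a : ℂ} (h₁ : -(1 / 2 : ℝ) < a.re) (h₂ : a.re < 1 / 2) {y : ℝ}
    (hy : 0 < y) :
    voronoiKernel a y = dslope (mellinBarnesReg a y 0) 0 (-a) +
      1 / (2 * Real.pi) * verticalIntegral (mellinBarnes a y) (-(3 / 2)) := by
  -- At `a = 0` both sides are limits of their values at `a ≠ 0`.
  rcases ne_or_eq a 0 with h | rfl
  · exact voronoiKernel_eq_of_ne_zero h₁ h₂ h hy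
  have hy0 : (y : ℂ) ≠ 0 := by exact_mod_cast hy.ne'
  have h0 : chiReg 0 0 = 2 := by simpa using chiReg_neg_two_mul 0
  have hx : 0 < 4 * Real.pi * √y := by positivity
  have t1 : Tendsto (fun a => voronoiKernel a y) (𝓝[≠] 0) (𝓝 (voronoiKernel 0 y)) := by
    refine Tendsto.mul (Tendsto.const_mul _ ?_) (tendsto_koshliakovKernel hx)
    have : ContinuousAt (fun a : ℂ => (y : ℂ) ^ (a / 2)) 0 :=
      (DifferentiableAt.const_cpow (by fun_prop) (Or.inl hy0)).continuousAt
    exact this.tendsto.mono_left nhdsWithin_le_nhds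
  have t2 : Tendsto (fun a => dslope (mellinBarnesReg a y 0) 0 (-a)) (𝓝[≠] 0)
      (𝓝 (dslope (mellinBarnesReg 0 y 0) 0 (-0))) := by
    have hneg : HasDerivAt (fun a : ℂ => chiReg 0 (-a)) (-deriv (chiReg 0) 0) 0 := by
      have h1 : HasDerivAt (chiReg 0) (deriv (chiReg 0) 0) (-0) := by
        simpa using hasDerivAt_chiReg_zero
      exact (h1.comp (0 : ℂ) (hasDerivAt_neg (0 : ℂ))).congr_deriv (by ring)
    have hpow : HasDerivAt (fun a : ℂ => (y : ℂ) ^ a) (Complex.log y) 0 := by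
      simpa using (hasDerivAt_id (0 : ℂ)).const_cpow (c := (y : ℂ)) (Or.inl hy0)
    -- The expression divided by `a` is a function of `a` vanishing at `0`, so the limit is its
    -- derivative.
    have hd := hasDerivAt_iff_tendsto_slope_zero.1 (hasDerivAt_chiReg_zero.sub (hneg.mul hpow))
    rw [neg_zero, dslope_mellinBarnesReg_zero hy]
    have hd2 := hd.const_mul 2
    refine (hd2.congr' ?_).trans (le_of_eq ?_)
    · filter_upwards [self_mem_nhdsWithin] with a ha
      rw [dslope_mellinBarnesReg_of_ne_zero ha y]
      simp only [Pi.sub_apply, Pi.mul_apply, zero_add, neg_zero, h0, cpow_zero, smul_eq_mul]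
      ring
    · congr 1
      simp only [neg_zero, h0, cpow_zero]
      ring
  have t3 := t2.add ((tendsto_verticalIntegral_mellinBarnes_zero hy).const_mul
    (1 / (2 * Real.pi) : ℂ))
  refine tendsto_nhds_unique (t1.congr' ?_) t3
  have hball : Metric.ball (0 : ℂ) (1 / 2) ∈ 𝓝[≠] (0 : ℂ) :=
    mem_nhdsWithin_of_mem_nhds (Metric.ball_mem_nhds _ (by norm_num))
  filter_upwards [self_mem_nhdsWithin, hball] with a ha hb
  have hb' : ‖a‖ < 1 / 2 := by simpa using hb
  have hre := abs_le.1 (abs_re_le_norm a)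
  exact voronoiKernel_eq_of_ne_zero (by linarith [hre.1]) (by linarith [hre.2]) ha hy

/-! ### Polynomial growth of `ζ` -/

/-- The fractional part on `(1, ∞)`, extended by zero. -/
def fractTail : ℝ → ℂ := (Ioi (1 : ℝ)).indicator fun t => ((Int.fract t : ℝ) : ℂ)

theorem norm_fractTail_le_one (t : ℝ) : ‖fractTail t‖ ≤ 1 := by
  refine (norm_indicator_le_norm_self _ _).trans ?_
  rw [norm_real, Real.norm_of_nonneg (Int.fract_nonneg t)]
  exact (Int.fract_lt_one t).le

theorem locallyIntegrable_fractTail : LocallyIntegrable fractTail := by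
  refine (locallyIntegrable_const (1 : ℂ)).mono ?_ (Eventually.of_forall fun t => by
    simpa using norm_fractTail_le_one t)
  exact ((Complex.measurable_ofReal.comp measurable_fract).indicator
    measurableSet_Ioi).aestronglyMeasurable

/-- In the form of a Mellin transform at `-s` the integral inherits analyticity for `re s > 0`. -/
theorem mellin_fractTail (s : ℂ) :
    mellin fractTail (-s) = ∫ t in Ioi (1 : ℝ), ((Int.fract t : ℝ) : ℂ) * (t : ℂ) ^ (-(s + 1)) := by
  have e : ∀ t : ℝ, (t : ℂ) ^ (-s - 1) • fractTail t =
      (Ioi (1 : ℝ)).indicator (fun t : ℝ => ((Int.fract t : ℝ) : ℂ) * (t : ℂ) ^ (-(s + 1))) t := by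
    intro t
    by_cases ht : t ∈ Ioi (1 : ℝ)
    · rw [fractTail, indicator_of_mem ht, indicator_of_mem ht, neg_add', smul_eq_mul, mul_comm]
    · rw [fractTail, indicator_of_notMem ht, indicator_of_notMem ht, smul_zero]
  rw [mellin]
  simp_rw [e]
  rw [setIntegral_indicator measurableSet_Ioi, Ioi_inter_Ioi]
  simp

theorem differentiableAt_mellin_fractTail {s : ℂ} (hs : 0 < s.re) :
    DifferentiableAt ℂ (fun s => mellin fractTail (-s)) s := by
  have h : DifferentiableAt ℂ (mellin fractTail) (-s) := by
    refine mellin_differentiableAt_of_isBigO_rpow (a := 0) (b := -s.re - 1)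
      (locallyIntegrable_fractTail.locallyIntegrableOn _) ?_ (by simpa using hs) ?_ (by simp)
    · refine Asymptotics.IsBigO.of_bound 1 (Eventually.of_forall fun t => ?_)
      simpa using norm_fractTail_le_one t
    · have : fractTail =ᶠ[𝓝[>] 0] fun _ => 0 := by
        have h1 : Iio (1 : ℝ) ∈ 𝓝[>] (0 : ℝ) :=
          mem_nhdsWithin_of_mem_nhds (Iio_mem_nhds zero_lt_one)
        filter_upwards [h1] with t ht
        exact indicator_of_notMem (by simpa using ht.le) _
      exact this.trans_isBigO (Asymptotics.isBigO_zero _ _)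
  exact h.comp s differentiableAt_id.neg

theorem integrableOn_fract_mul_cpow {s : ℂ} (hs : 0 < s.re) :
    IntegrableOn (fun t : ℝ => ((Int.fract t : ℝ) : ℂ) * (t : ℂ) ^ (-(s + 1))) (Ioi 1) := by
  have h : IntegrableOn (fun t : ℝ => (t : ℂ) ^ (-(s + 1))) (Ioi 1) :=
    integrableOn_Ioi_cpow_of_lt (by simpa using hs) zero_lt_one
  refine Integrable.bdd_mul (c := 1) h
    (Complex.measurable_ofReal.comp measurable_fract).aestronglyMeasurable
    (Eventually.of_forall fun t => ?_)
  rw [norm_real, Real.norm_of_nonneg (Int.fract_nonneg t)]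
  exact (Int.fract_lt_one t).le

/-- Abel summation, with `⌊t⌋ = t - {t}`. -/
theorem riemannZeta_eq_of_one_lt_re {s : ℂ} (hs : 1 < s.re) :
    riemannZeta s = s / (s - 1) - s * mellin fractTail (-s) := by
  have h1 : (fun n : ℕ => ∑ k ∈ Finset.Icc 1 n, ‖(1 : ℕ → ℂ) k‖) =O[atTop]
      fun n : ℕ => (n : ℝ) ^ (1 : ℝ) := by
    refine Asymptotics.IsBigO.of_bound 1 (Eventually.of_forall fun n => ?_)
    simp
  rw [← LSeries_one_eq_riemannZeta hs, LSeries_eq_mul_integral' 1 zero_le_one hs h1,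
    mellin_fractTail]
  have e : ∀ t ∈ Ioi (1 : ℝ), (∑ k ∈ Finset.Icc 1 ⌊t⌋₊, (1 : ℕ → ℂ) k) * (t : ℂ) ^ (-(s + 1)) =
      (t : ℂ) ^ (-s) - ((Int.fract t : ℝ) : ℂ) * (t : ℂ) ^ (-(s + 1)) := by
    intro t ht
    have ht0 : (0 : ℝ) < t := zero_lt_one.trans ht
    have ht' : (t : ℂ) ≠ 0 := by exact_mod_cast ht0.ne'
    have h2 : (⌊t⌋₊ : ℂ) = t - ((Int.fract t : ℝ) : ℂ) := by
      have h3 : (⌊t⌋₊ : ℝ) = t - Int.fract t := by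
        rw [natCast_floor_eq_intCast_floor ht0.le, Int.self_sub_fract]
      have := congrArg (fun r : ℝ => (r : ℂ)) h3
      push_cast at this
      exact this
    have h4 : (t : ℂ) ^ (-s) = t * (t : ℂ) ^ (-(s + 1)) := by
      rw [show -s = 1 + -(s + 1) by ring, cpow_add _ _ ht', cpow_one]
    simp only [Pi.one_apply, Finset.sum_const, Nat.card_Icc, add_tsub_cancel_right, nsmul_eq_mul,
      mul_one]
    rw [h2, h4]
    ring
  rw [setIntegral_congr_fun measurableSet_Ioi e, integral_sub
    (integrableOn_Ioi_cpow_of_lt (by simpa using hs) zero_lt_one)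
    (integrableOn_fract_mul_cpow (by linarith)), integral_Ioi_cpow_of_lt (by simpa using hs)
    zero_lt_one, ofReal_one, one_cpow]
  have h5 : s - 1 ≠ 0 := by
    intro h
    have := congrArg re h
    simp at this
    linarith
  have h6 : -s + 1 ≠ 0 := by
    intro h
    exact h5 (by linear_combination -h)
  field_simp
  ring

/-- Multiplication by `s - 1` removes the pole, so the identity theorem extends the formula from `re
s > 1` to the half-plane `re s > 0`. -/
theorem riemannZeta₁_eq {s : ℂ} (hs : 0 < s.re) :
    riemannZeta₁ s = s - s * (s - 1) * mellin fractTail (-s) := by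
  have hU : IsOpen {z : ℂ | 0 < z.re} := isOpen_lt continuous_const continuous_re
  have h1 : AnalyticOnNhd ℂ riemannZeta₁ {z : ℂ | 0 < z.re} :=
    differentiable_riemannZeta₁.differentiableOn.analyticOnNhd hU
  have h2 : AnalyticOnNhd ℂ (fun s => s - s * (s - 1) * mellin fractTail (-s))
      {z : ℂ | 0 < z.re} := by
    refine DifferentiableOn.analyticOnNhd (fun z hz => ?_) hU
    exact (differentiableAt_id.sub ((differentiableAt_id.mul (differentiableAt_id.sub_const 1)).mul
      (differentiableAt_mellin_fractTail hz))).differentiableWithinAt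
  refine h1.eqOn_of_preconnected_of_eventuallyEq h2
    (convex_halfSpace_re_gt 0).isPreconnected (z₀ := 2) (by simp) ?_ hs
  have h3 : {z : ℂ | 1 < z.re} ∈ 𝓝 (2 : ℂ) :=
    (isOpen_lt continuous_const continuous_re).mem_nhds (by simp)
  filter_upwards [h3] with z hz
  have hz1 : z ≠ 1 := by
    rintro rfl
    simp at hz
  have hz2 : z - 1 ≠ 0 := sub_ne_zero.2 hz1
  have h4 := riemannZeta_eq_of_one_lt_re hz
  rw [riemannZeta_eq_inv_sub_mul hz1] at h4
  field_simp at h4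
  linear_combination h4

theorem norm_mellin_fractTail_le {s : ℂ} (hs : 0 < s.re) :
    ‖mellin fractTail (-s)‖ ≤ 1 / s.re := by
  rw [mellin_fractTail]
  have h : -(s.re + 1) < -1 := by linarith
  have h1 : ∫ t : ℝ in Ioi 1, t ^ (-(s.re + 1)) = 1 / s.re := by
    rw [integral_Ioi_rpow_of_lt h zero_lt_one, Real.one_rpow]
    have : s.re ≠ 0 := hs.ne'
    rw [show -(s.re + 1) + 1 = -s.re by ring, neg_div_neg_eq]
  rw [← h1]
  refine norm_integral_le_of_norm_le (integrableOn_Ioi_rpow_of_lt h zero_lt_one) ?_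
  filter_upwards [ae_restrict_mem measurableSet_Ioi] with t ht
  have ht0 : (0 : ℝ) < t := zero_lt_one.trans ht
  rw [norm_mul, norm_real, Real.norm_of_nonneg (Int.fract_nonneg t),
    norm_cpow_eq_rpow_re_of_pos ht0]
  simp only [neg_re, add_re, one_re]
  exact mul_le_of_le_one_left (by positivity) (Int.fract_lt_one t).le

/-- Polynomial growth of `g` as `|im w| → ∞` in a vertical strip. -/
def PolynomialGrowth (g : ℂ → ℂ) (σ₁ σ₂ : ℝ) : Prop :=
  ∃ (C T : ℝ) (N : ℕ), 0 ≤ C ∧ 1 ≤ T ∧ ∀ w ∈ strip σ₁ σ₂, T ≤ |w.im| → ‖g w‖ ≤ C * |w.im| ^ N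

namespace PolynomialGrowth

theorem mul {g h : ℂ → ℂ} {σ₁ σ₂ : ℝ} (hg : PolynomialGrowth g σ₁ σ₂)
    (hh : PolynomialGrowth h σ₁ σ₂) : PolynomialGrowth (fun w => g w * h w) σ₁ σ₂ := by
  obtain ⟨C, T, N, hC, hT, H⟩ := hg
  obtain ⟨C', T', N', hC', hT', H'⟩ := hh
  refine ⟨C * C', max T T', N + N', by positivity, hT.trans (le_max_left _ _), fun w hw ht => ?_⟩
  have h1 := H w hw ((le_max_left _ _).trans ht)
  have h2 := H' w hw ((le_max_right _ _).trans ht)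
  rw [norm_mul, pow_add]
  calc _ ≤ (C * |w.im| ^ N) * (C' * |w.im| ^ N') := by gcongr
    _ = _ := by ring

theorem mono {g : ℂ → ℂ} {σ₁ σ₂ τ₁ τ₂ : ℝ} (hg : PolynomialGrowth g σ₁ σ₂) (h₁ : σ₁ ≤ τ₁)
    (h₂ : τ₂ ≤ σ₂) : PolynomialGrowth g τ₁ τ₂ := by
  obtain ⟨C, T, N, hC, hT, H⟩ := hg
  exact ⟨C, T, N, hC, hT, fun w hw => H w ⟨h₁.trans hw.1, hw.2.trans h₂⟩⟩

theorem comp_add {g : ℂ → ℂ} {σ₁ σ₂ : ℝ} {a : ℂ}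
    (hg : PolynomialGrowth g (σ₁ + a.re) (σ₂ + a.re)) :
    PolynomialGrowth (fun w => g (w + a)) σ₁ σ₂ := by
  obtain ⟨C, T, N, hC, hT, H⟩ := hg
  have ha := abs_nonneg a.im
  refine ⟨C * 2 ^ N, T + |a.im|, N, by positivity, by linarith, fun w hw ht => ?_⟩
  have h1 : |w.im| - |a.im| ≤ |(w + a).im| := by
    have := abs_sub_abs_le_abs_sub w.im (-a.im)
    rwa [abs_neg, sub_neg_eq_add] at this
  have h2 : |(w + a).im| ≤ 2 * |w.im| := by
    rw [add_im]
    have := abs_add_le w.im a.im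
    linarith
  refine (H (w + a) ⟨by simpa using hw.1, by simpa using hw.2⟩ (by linarith)).trans ?_
  rw [mul_assoc, ← mul_pow]
  gcongr

theorem comp_one_sub {g : ℂ → ℂ} {σ₁ σ₂ : ℝ} (hg : PolynomialGrowth g (1 - σ₂) (1 - σ₁)) :
    PolynomialGrowth (fun w => g (1 - w)) σ₁ σ₂ := by
  obtain ⟨C, T, N, hC, hT, H⟩ := hg
  refine ⟨C, T, N, hC, hT, fun w hw ht => ?_⟩
  have := H (1 - w) ⟨by
    rw [sub_re, one_re]; linarith [hw.2], by rw [sub_re, one_re]; linarith [hw.1]⟩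
    (by simpa using ht)
  simpa using this

theorem union {g : ℂ → ℂ} {σ₁ σ₂ σ₃ : ℝ} (h₁ : PolynomialGrowth g σ₁ σ₂)
    (h₂ : PolynomialGrowth g σ₂ σ₃) : PolynomialGrowth g σ₁ σ₃ := by
  obtain ⟨C, T, N, hC, hT, H⟩ := h₁
  obtain ⟨C', T', N', hC', hT', H'⟩ := h₂
  refine ⟨C + C', max T T', N + N', by positivity, hT.trans (le_max_left _ _), fun w hw ht => ?_⟩
  have ht1 : 1 ≤ |w.im| := (hT.trans (le_max_left _ _)).trans ht
  have p1 : |w.im| ^ N ≤ |w.im| ^ (N + N') := pow_le_pow_right₀ ht1 (Nat.le_add_right _ _)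
  have p2 : |w.im| ^ N' ≤ |w.im| ^ (N + N') := pow_le_pow_right₀ ht1 (Nat.le_add_left _ _)
  have p0 : 0 ≤ |w.im| ^ (N + N') := by positivity
  rcases le_total w.re σ₂ with h | h
  · refine (H w ⟨hw.1, h⟩ ((le_max_left _ _).trans ht)).trans ?_
    nlinarith
  · refine (H' w ⟨h, hw.2⟩ ((le_max_right _ _).trans ht)).trans ?_
    nlinarith

theorem congr {g h : ℂ → ℂ} {σ₁ σ₂ : ℝ} (hg : PolynomialGrowth g σ₁ σ₂)
    (e : ∀ w ∈ strip σ₁ σ₂, 1 ≤ |w.im| → h w = g w) : PolynomialGrowth h σ₁ σ₂ := by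
  obtain ⟨C, T, N, hC, hT, H⟩ := hg
  exact ⟨C, T, N, hC, hT, fun w hw ht => by rw [e w hw (hT.trans ht)]; exact H w hw ht⟩

end PolynomialGrowth

theorem polynomialGrowth_chi (σ₁ σ₂ : ℝ) : PolynomialGrowth chi σ₁ σ₂ := by
  obtain ⟨C, hC0, hC⟩ := exists_norm_chi_le σ₁ σ₂
  obtain ⟨N, hN⟩ := exists_nat_ge σ₂
  refine ⟨C, 1, N, hC0, le_rfl, fun w hw ht => (hC w hw ht).trans ?_⟩
  rw [← Real.rpow_natCast]
  gcongr
  exact hw.2.trans hN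

theorem polynomialGrowth_cpow_neg {y : ℝ} (hy : 0 < y) (σ₁ σ₂ : ℝ) :
    PolynomialGrowth (fun w => (y : ℂ) ^ (-w)) σ₁ σ₂ := by
  obtain ⟨B, hB0, hB⟩ := exists_norm_cpow_neg_le hy σ₁ σ₂
  exact ⟨B, 1, 0, hB0, le_rfl, fun w hw _ => by simpa using hB w hw⟩

theorem polynomialGrowth_riemannZeta_right : PolynomialGrowth riemannZeta (1 / 2) 2 := by
  -- `‖s‖ ≤ 3 |im s|`, and the two parts of the formula contribute `‖s‖` and `2 ‖s‖`.
  refine ⟨9, 1, 1, by norm_num, le_rfl, fun s hs ht => ?_⟩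
  have hs0 : 0 < s.re := by linarith [hs.1]
  have him : ‖s - 1‖ ≥ 1 := by
    refine ht.trans ?_
    simpa using abs_im_le_norm (s - 1)
  have hs1 : s ≠ 1 := by
    rintro rfl
    simp at him
    linarith
  have hs1' : s - 1 ≠ 0 := sub_ne_zero.2 hs1
  have hnorm : ‖s‖ ≤ 3 * |s.im| := by
    have := norm_le_abs_re_add_abs_im s
    rw [abs_of_pos hs0] at this
    linarith [hs.2]
  have e : riemannZeta s = s / (s - 1) - s * mellin fractTail (-s) := by
    rw [riemannZeta_eq_inv_sub_mul hs1, riemannZeta₁_eq hs0]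
    field_simp
  have h1 : ‖s / (s - 1)‖ ≤ ‖s‖ := by
    rw [norm_div]
    exact div_le_self (norm_nonneg _) him
  have h2 : ‖s * mellin fractTail (-s)‖ ≤ ‖s‖ * 2 := by
    rw [norm_mul]
    gcongr
    refine (norm_mellin_fractTail_le hs0).trans ?_
    rw [div_le_iff₀ hs0]
    linarith [hs.1]
  rw [e, pow_one]
  refine (norm_sub_le _ _).trans ?_
  linarith

/-- Polynomial growth of `ζ` in vertical strips. -/
theorem polynomialGrowth_riemannZeta : PolynomialGrowth riemannZeta (-1) 2 := by
  refine PolynomialGrowth.union ?_ polynomialGrowth_riemannZeta_right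
  -- The functional equation reflects `-1 ≤ re s ≤ 1/2` into the strip `1/2 ≤ re s ≤ 2` already
  -- treated.
  have h1 : PolynomialGrowth (fun s => chi (1 - s) * riemannZeta (1 - s)) (-1) (1 / 2) := by
    refine PolynomialGrowth.comp_one_sub (g := fun s => chi s * riemannZeta s) ?_
    exact ((polynomialGrowth_chi _ _).mul polynomialGrowth_riemannZeta_right).mono (by norm_num)
      (by norm_num)
  refine h1.congr fun s _ ht => ?_
  have him : (1 - s).im ≠ 0 := by
    intro h
    rw [sub_im, one_im, zero_sub, neg_eq_zero] at h
    rw [h] at ht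
    norm_num at ht
  rw [← riemannZeta_one_sub_eq_chi_mul (ne_intCast_of_im_ne_zero him), sub_sub_cancel]

theorem PolynomialGrowth.mul_rapidlyDecays {g F : ℂ → ℂ} {σ₁ σ₂ : ℝ}
    (hg : PolynomialGrowth g σ₁ σ₂) (hF : RapidlyDecaysInStrips F) :
    QuadraticDecay (fun w => g w * F w) σ₁ σ₂ := by
  obtain ⟨C, T, N, hC, hT, H⟩ := hg
  obtain ⟨C', H'⟩ := hF σ₁ σ₂ (N + 2)
  refine ⟨C * C', T, by linarith, fun w hw ht => ?_⟩
  have ht1 : 1 ≤ |w.im| := hT.trans ht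
  have h1 := H w hw ht
  have h2 := H' w hw.1 hw.2 ht1
  rw [norm_mul, ← sq_abs, le_div_iff₀ (by positivity)]
  calc ‖g w‖ * ‖F w‖ * |w.im| ^ 2 ≤ C * |w.im| ^ N * ‖F w‖ * |w.im| ^ 2 := by gcongr
    _ = C * (‖F w‖ * |w.im| ^ (N + 2)) := by ring
    _ ≤ C * C' := by gcongr

theorem RapidlyDecaysInStrips.comp_one_sub {F : ℂ → ℂ} (hF : RapidlyDecaysInStrips F) :
    RapidlyDecaysInStrips fun w => F (1 - w) := by
  intro σ₁ σ₂ N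
  obtain ⟨C, H⟩ := hF (1 - σ₂) (1 - σ₁) N
  refine ⟨C, fun w h₁ h₂ ht => ?_⟩
  simpa using H (1 - w) (by rw [sub_re, one_re]; linarith)
    (by rw [sub_re, one_re]; linarith) (by simpa using ht)

/-! ### Dirichlet series of `σ_b`, integrated termwise -/

theorem sigma_eq_sum_divisorsAntidiagonal (b : ℂ) (n : ℕ) :
    sigma b n = ∑ p ∈ n.divisorsAntidiagonal, (p.2 : ℂ) ^ b := by
  rw [sigma, Nat.sum_divisorsAntidiagonal' (f := fun _ d : ℕ => (d : ℂ) ^ b)]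

/-- The Dirichlet series of `σ_b`. -/
theorem hasSum_sigma_mul_cpow {b s : ℂ} (h₁ : 1 < s.re) (h₂ : 1 < (s - b).re) :
    HasSum (fun n : ℕ+ => sigma b n * (n : ℂ) ^ (-s)) (riemannZeta s * riemannZeta (s - b)) := by
  have hterm : ∀ n : ℕ, LSeries.term (fun n : ℕ => (n : ℂ) ^ b) s n = LSeries.term 1 (s - b) n := by
    intro n
    rcases eq_or_ne n 0 with rfl | hn
    · simp
    · have : (n : ℂ) ≠ 0 := by exact_mod_cast hn
      rw [LSeries.term_of_ne_zero hn, LSeries.term_of_ne_zero hn, cpow_sub _ _ this, Pi.one_apply,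
        one_div_div]
  have hb : LSeriesHasSum (fun n : ℕ => (n : ℂ) ^ b) s (riemannZeta (s - b)) := by
    have := LSeriesHasSum_one h₂
    rw [LSeriesHasSum] at this ⊢
    exact this.congr_fun hterm
  have h := (LSeriesHasSum_one h₁).convolution hb
  rw [LSeriesHasSum, ← PNat.coe_injective.hasSum_iff] at h
  · convert h using 2 with n
    rw [Function.comp_apply, LSeries.term_of_ne_zero n.ne_zero, LSeries.convolution_def,
      sigma_eq_sum_divisorsAntidiagonal, cpow_neg, div_eq_mul_inv]
    simp
  · intro n hn
    have : n = 0 := by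
      by_contra h0
      exact hn ⟨⟨n, Nat.pos_of_ne_zero h0⟩, rfl⟩
    simp [this]

theorem norm_pnat_cpow (n : ℕ+) (s : ℂ) : ‖(n : ℂ) ^ s‖ = (n : ℝ) ^ s.re :=
  norm_natCast_cpow_of_pos n.pos s

/-- Termwise integration of a Dirichlet series along a vertical line. -/
theorem hasSum_sigma_mul_verticalIntegral {b : ℂ} {σ : ℝ} (h₁ : 1 < σ) (h₂ : 1 < σ - b.re)
    {G : ℂ → ℂ} (hG : Integrable fun t : ℝ => G (σ + t * I)) :
    HasSum (fun n : ℕ+ => sigma b n * verticalIntegral (fun w => (n : ℂ) ^ (-w) * G w) σ)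
      (verticalIntegral (fun w => riemannZeta w * riemannZeta (w - b) * G w) σ) := by
  have hcont : ∀ n : ℕ+, Continuous fun t : ℝ => sigma b n * (n : ℂ) ^ (-(σ + t * I : ℂ)) := by
    intro n
    refine continuous_const.mul (Continuous.const_cpow (by fun_prop) (Or.inl ?_))
    exact_mod_cast n.ne_zero
  have hnorm : ∀ (n : ℕ+) (t : ℝ), ‖sigma b n * (n : ℂ) ^ (-(σ + t * I : ℂ))‖ =
      ‖sigma b n * (n : ℂ) ^ (-(σ : ℂ))‖ := by
    intro n t
    rw [norm_mul, norm_mul, norm_pnat_cpow, norm_pnat_cpow]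
    simp
  have hint : ∀ n : ℕ+, Integrable fun t : ℝ =>
      sigma b n * (n : ℂ) ^ (-(σ + t * I : ℂ)) * G (σ + t * I) := fun n =>
    hG.bdd_mul (hcont n).aestronglyMeasurable (Eventually.of_forall fun t => (hnorm n t).le)
  have hsum := (hasSum_sigma_mul_cpow (b := b) (s := σ) (by simpa using h₁)
    (by simpa using h₂)).summable.norm
  have h := hasSum_integral_of_summable_integral_norm hint (by
    simp_rw [norm_mul _ (G _), hnorm, integral_const_mul]
    exact hsum.mul_right _)
  have e1 : ∀ n : ℕ+, ∫ t : ℝ, sigma b n * (n : ℂ) ^ (-(σ + t * I : ℂ)) * G (σ + t * I) =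
      sigma b n * verticalIntegral (fun w => (n : ℂ) ^ (-w) * G w) σ := by
    intro n
    simp_rw [mul_assoc]
    rw [integral_const_mul, verticalIntegral]
  have e2 : ∀ t : ℝ, ∑' n : ℕ+, sigma b n * (n : ℂ) ^ (-(σ + t * I : ℂ)) * G (σ + t * I) =
      riemannZeta (σ + t * I) * riemannZeta (σ + t * I - b) * G (σ + t * I) := by
    intro t
    rw [tsum_mul_right, (hasSum_sigma_mul_cpow (by simpa using h₁) (by simpa using h₂)).tsum_eq]
  simp_rw [e1, e2] at h
  exact h

/-! ### Mellin transform of a Schwartz function -/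

theorem schwartz_isBigO_atTop (f : 𝓢(ℝ, ℂ)) (b : ℝ) : f =O[atTop] fun x : ℝ => x ^ (-b) := by
  refine ((f.isBigO_cocompact_rpow (-b)).mono atTop_le_cocompact).congr' EventuallyEq.rfl ?_
  filter_upwards [eventually_ge_atTop 0] with x hx
  rw [Real.norm_of_nonneg hx]

theorem schwartz_isBigO_zero (f : 𝓢(ℝ, ℂ)) : f =O[𝓝[>] 0] fun x : ℝ => x ^ (-(0 : ℝ)) := by
  simp only [neg_zero, Real.rpow_zero]
  exact (f.continuous.continuousAt.isBigO_one ℝ).mono nhdsWithin_le_nhds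

theorem schwartz_locallyIntegrableOn (f : 𝓢(ℝ, ℂ)) : LocallyIntegrableOn f (Ioi 0) :=
  f.continuous.locallyIntegrable.locallyIntegrableOn _

theorem mellinConvergent_schwartz (f : 𝓢(ℝ, ℂ)) {s : ℂ} (hs : 0 < s.re) : MellinConvergent f s :=
  mellinConvergent_of_isBigO_rpow (schwartz_locallyIntegrableOn f)
    (schwartz_isBigO_atTop f (s.re + 1)) (by linarith) (schwartz_isBigO_zero f) hs

theorem hasDerivAt_mellin_schwartz (f : 𝓢(ℝ, ℂ)) {s : ℂ} (hs : 0 < s.re) :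
    MellinConvergent (fun t => Real.log t • f t) s ∧
      HasDerivAt (mellin f) (mellin (fun t => Real.log t • f t) s) s :=
  mellin_hasDerivAt_of_isBigO_rpow (schwartz_locallyIntegrableOn f)
    (schwartz_isBigO_atTop f (s.re + 1)) (by linarith) (schwartz_isBigO_zero f) hs

/-- Integration by parts. The boundary terms vanish, at `0` because `re s > 0` and at infinity by
the decay of `f`. -/
theorem mul_mellin_schwartz (f : 𝓢(ℝ, ℂ)) {s : ℂ} (hs : 0 < s.re) :
    s * mellin f s = -mellin (SchwartzMap.derivCLM ℝ ℂ f) (s + 1) := by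
  have hs0 : s ≠ 0 := by
    rintro rfl
    simp at hs
  have i1 := (mellinConvergent_schwartz f hs).const_smul s
  have i2 := mellinConvergent_schwartz (SchwartzMap.derivCLM ℝ ℂ f) (s := s + 1)
    (by rw [add_re, one_re]; linarith)
  have hderiv : ∀ x ∈ Ioi (0 : ℝ), HasDerivAt (fun x : ℝ => (x : ℂ) ^ s * f x)
      ((x : ℂ) ^ (s - 1) • s • f x +
        (x : ℂ) ^ (s + 1 - 1) • (SchwartzMap.derivCLM ℝ ℂ f) x) x := by
    intro x hx
    have h1 : HasDerivAt (fun x : ℝ => (x : ℂ) ^ s) (s * (x : ℂ) ^ (s - 1)) x :=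
      hasDerivAt_ofReal_cpow_const (ne_of_gt hx) hs0
    refine (h1.mul f.differentiableAt.hasDerivAt).congr_deriv ?_
    simp only [SchwartzMap.derivCLM_apply, add_sub_cancel_right, smul_eq_mul]
    ring
  have hcont : ContinuousWithinAt (fun x : ℝ => (x : ℂ) ^ s * f x) (Ici 0) 0 := by
    refine ContinuousAt.continuousWithinAt ?_
    exact (continuousAt_ofReal_cpow_const 0 s (Or.inl hs)).mul f.continuous.continuousAt
  have hlim : Tendsto (fun x : ℝ => (x : ℂ) ^ s * f x) atTop (𝓝 0) := by
    have h1 : (fun x : ℝ => (x : ℂ) ^ s) =O[atTop] fun x : ℝ => x ^ s.re := by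
      refine Asymptotics.IsBigO.of_bound 1 ?_
      filter_upwards [eventually_gt_atTop 0] with x hx
      rw [norm_cpow_eq_rpow_re_of_pos hx, one_mul]
      exact le_abs_self _
    have h2 := h1.mul (schwartz_isBigO_atTop f (s.re + 1))
    refine h2.trans_tendsto ?_
    have h3 : Tendsto (fun x : ℝ => x ^ (-(1 : ℝ))) atTop (𝓝 0) :=
      tendsto_rpow_neg_atTop zero_lt_one
    refine h3.congr' ?_
    filter_upwards [eventually_gt_atTop 0] with x hx
    rw [← Real.rpow_add hx]
    ring_nf
  have h := integral_Ioi_of_hasDerivAt_of_tendsto hcont hderiv (i1.add i2) hlim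
  rw [integral_add i1 i2, ofReal_zero, zero_cpow hs0, zero_mul, sub_zero] at h
  have e : ∫ t in Ioi (0 : ℝ), (t : ℂ) ^ (s - 1) • s • f t = s * mellin f s := by
    rw [← smul_eq_mul, ← mellin_const_smul, mellin]
  rw [e] at h
  change s * mellin f s + mellin (SchwartzMap.derivCLM ℝ ℂ f) (s + 1) = 0 at h
  linear_combination h

/-- The function `s F(s)`, where `F` is the Mellin transform of `f`, in the form which makes sense
for `re s > -1`. -/
def mellinReg (f : 𝓢(ℝ, ℂ)) (s : ℂ) : ℂ := -mellin (SchwartzMap.derivCLM ℝ ℂ f) (s + 1)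

theorem differentiableAt_mellinReg (f : 𝓢(ℝ, ℂ)) {s : ℂ} (hs : -1 < s.re) :
    DifferentiableAt ℂ (mellinReg f) s := by
  have h := (hasDerivAt_mellin_schwartz (SchwartzMap.derivCLM ℝ ℂ f) (s := s + 1)
    (by rw [add_re, one_re]; linarith)).2.differentiableAt
  exact (h.comp s (f := fun s : ℂ => s + 1) (by fun_prop)).neg

/-- The value is `-∫ f'` over `(0, ∞)`. It is the residue of `F` at `0`. -/
theorem mellinReg_zero (f : 𝓢(ℝ, ℂ)) : mellinReg f 0 = f 0 := by
  have i2 := mellinConvergent_schwartz (SchwartzMap.derivCLM ℝ ℂ f) (s := 0 + 1) (by simp)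
  have h := integral_Ioi_of_hasDerivAt_of_tendsto (f := f) (a := 0) (m := 0)
    (f' := fun x => (x : ℂ) ^ ((0 : ℂ) + 1 - 1) • (SchwartzMap.derivCLM ℝ ℂ f) x)
    f.continuous.continuousWithinAt
    (fun x _ => f.differentiableAt.hasDerivAt.congr_deriv (by simp)) i2
    (f.tendsto_cocompact.mono_left atTop_le_cocompact)
  rw [mellinReg, mellin, h]
  ring

/-- The identity theorem, applied on convex pieces of the half-plane punctured at `0`: the upper and
lower parts are reached from `re s > 0`, and the left part from the upper one. -/
theorem IsMellinContinuation.eq_mellinReg_div {f : 𝓢(ℝ, ℂ)} {F : ℂ → ℂ}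
    (hF : IsMellinContinuation f F) {s : ℂ} (hs : -1 < s.re) (hs0 : s ≠ 0) :
    F s = mellinReg f s / s := by
  have right : ∀ z : ℂ, 0 < z.re → F z = mellinReg f z / z := by
    intro z hz
    have hz0 : z ≠ 0 := by
      rintro rfl
      simp at hz
    rw [hF.2 z hz, eq_div_iff hz0, mellinReg, ← mul_mellin_schwartz f hz, mul_comm]
  have key : ∀ U : Set ℂ, IsOpen U → Convex ℝ U → (∀ z ∈ U, -1 < z.re ∧ z ≠ 0) → ∀ z₀ ∈ U,
      (F =ᶠ[𝓝 z₀] fun z => mellinReg f z / z) → ∀ z ∈ U, F z = mellinReg f z / z := by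
    intro U hU hconv hsub z₀ hz₀ heq z hz
    have h1 : AnalyticOnNhd ℂ F U := by
      refine (hF.1.mono fun z hz n h => ?_).analyticOnNhd hU
      obtain ⟨hz1, hz2⟩ := hsub z hz
      rcases Nat.eq_zero_or_pos n with rfl | hn
      · simp at h
        exact hz2 h
      · rw [h] at hz1
        have : (1 : ℝ) ≤ n := by exact_mod_cast hn
        simp at hz1
        linarith
    have h2 : AnalyticOnNhd ℂ (fun z => mellinReg f z / z) U := by
      refine DifferentiableOn.analyticOnNhd (fun z hz => ?_) hU
      exact ((differentiableAt_mellinReg f (hsub z hz).1).div differentiableAt_id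
        (hsub z hz).2).differentiableWithinAt
    exact h1.eqOn_of_preconnected_of_eventuallyEq h2 hconv.isPreconnected hz₀ heq hz
  have near : ∀ z : ℂ, 0 < z.re → F =ᶠ[𝓝 z] fun z => mellinReg f z / z := by
    intro z hz
    filter_upwards [(isOpen_lt continuous_const continuous_re).mem_nhds hz] with w hw
    exact right w hw
  have openRe : IsOpen {z : ℂ | -1 < z.re} := isOpen_lt continuous_const continuous_re
  have upper : ∀ z : ℂ, -1 < z.re → 0 < z.im → F z = mellinReg f z / z := by
    intro z h1 h2
    refine key ({z : ℂ | -1 < z.re} ∩ {z : ℂ | 0 < z.im})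
      (openRe.inter (isOpen_lt continuous_const continuous_im))
      ((convex_halfSpace_re_gt _).inter (convex_halfSpace_im_gt _)) ?_ (1 + I)
      ⟨by simp, by simp⟩ (near _ (by simp)) z ⟨h1, h2⟩
    rintro w ⟨hw1, hw2⟩
    refine ⟨hw1, ?_⟩
    rintro rfl
    simp at hw2
  have lower : ∀ z : ℂ, -1 < z.re → z.im < 0 → F z = mellinReg f z / z := by
    intro z h1 h2
    refine key ({z : ℂ | -1 < z.re} ∩ {z : ℂ | z.im < 0})
      (openRe.inter (isOpen_lt continuous_im continuous_const))
      ((convex_halfSpace_re_gt _).inter (convex_halfSpace_im_lt _)) ?_ (1 - I)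
      ⟨by simp, by simp⟩ (near _ (by simp)) z ⟨h1, h2⟩
    rintro w ⟨hw1, hw2⟩
    refine ⟨hw1, ?_⟩
    rintro rfl
    simp at hw2
  have left : ∀ z : ℂ, -1 < z.re → z.re < 0 → F z = mellinReg f z / z := by
    intro z h1 h2
    refine key ({z : ℂ | -1 < z.re} ∩ {z : ℂ | z.re < 0})
      (openRe.inter (isOpen_lt continuous_re continuous_const))
      ((convex_halfSpace_re_gt _).inter (convex_halfSpace_re_lt _)) ?_ (-(1 / 2) + I)
      ⟨by simp; norm_num, by simp⟩ ?_ z ⟨h1, h2⟩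
    · rintro w ⟨hw1, hw2⟩
      exact ⟨hw1, ne_zero_of_re_lt hw2⟩
    · have hm : {z : ℂ | -1 < z.re} ∩ {z : ℂ | 0 < z.im} ∈ 𝓝 (-(1 / 2) + I : ℂ) :=
        (openRe.inter (isOpen_lt continuous_const continuous_im)).mem_nhds
          ⟨by simp; norm_num, by simp⟩
      filter_upwards [hm] with w hw
      exact upper w hw.1 hw.2
  rcases lt_trichotomy s.im 0 with h | h | h
  · exact lower s hs h
  · rcases lt_trichotomy s.re 0 with h' | h' | h'
    · exact left s hs h'
    · exact absurd (Complex.ext h' h) hs0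
    · exact right s h'
  · exact upper s hs h

theorem IsMellinContinuation.differentiableAt {f : 𝓢(ℝ, ℂ)} {F : ℂ → ℂ}
    (hF : IsMellinContinuation f F) {s : ℂ} (hs : 0 < s.re) : DifferentiableAt ℂ F s := by
  have : mellin f =ᶠ[𝓝 s] F := by
    filter_upwards [(isOpen_lt continuous_const continuous_re).mem_nhds hs] with w hw
    exact (hF.2 w hw).symm
  exact (hasDerivAt_mellin_schwartz f hs).2.differentiableAt.congr_of_eventuallyEq this.symm

theorem IsMellinContinuation.hasDerivAt {f : 𝓢(ℝ, ℂ)} {F : ℂ → ℂ}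
    (hF : IsMellinContinuation f F) {s : ℂ} (hs : 0 < s.re) :
    HasDerivAt F (mellin (fun t => Real.log t • f t) s) s := by
  have : mellin f =ᶠ[𝓝 s] F := by
    filter_upwards [(isOpen_lt continuous_const continuous_re).mem_nhds hs] with w hw
    exact (hF.2 w hw).symm
  exact (hasDerivAt_mellin_schwartz f hs).2.congr_of_eventuallyEq this.symm

theorem polynomialGrowth_one (σ₁ σ₂ : ℝ) : PolynomialGrowth (fun _ => 1) σ₁ σ₂ :=
  ⟨1, 1, 0, zero_le_one, le_rfl, fun w _ _ => by simp⟩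

theorem integrable_vertical_mul {g F : ℂ → ℂ} {σ : ℝ} (hg : PolynomialGrowth g σ σ)
    (hF : RapidlyDecaysInStrips F) (hc : Continuous fun t : ℝ => g (σ + t * I) * F (σ + t * I)) :
    Integrable fun t : ℝ => g (σ + t * I) * F (σ + t * I) :=
  integrable_vertical (right_mem_Icc.2 le_rfl) hc (hg.mul_rapidlyDecays hF)

theorem IsMellinContinuation.continuous_vertical {f : 𝓢(ℝ, ℂ)} {F : ℂ → ℂ}
    (hF : IsMellinContinuation f F) {σ : ℝ} (hσ : 0 < σ) :
    Continuous fun t : ℝ => F (σ + t * I) := by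
  rw [continuous_iff_continuousAt]
  intro t
  have h : ContinuousAt F (σ + t * I) := (hF.differentiableAt (by simpa using hσ)).continuousAt
  exact h.comp (f := fun t : ℝ => (σ + t * I : ℂ)) (Continuous.continuousAt (by fun_prop))

theorem IsMellinContinuation.integrable_vertical {f : 𝓢(ℝ, ℂ)} {F : ℂ → ℂ}
    (hF : IsMellinContinuation f F) (hdecay : RapidlyDecaysInStrips F) {σ : ℝ} (hσ : 0 < σ) :
    Integrable fun t : ℝ => F (σ + t * I) := by
  have := integrable_vertical_mul (polynomialGrowth_one σ σ) hdecay
    (by simpa using hF.continuous_vertical hσ)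
  simpa using this

/-- Mellin inversion for a Schwartz function. -/
theorem IsMellinContinuation.inversion {f : 𝓢(ℝ, ℂ)} {F : ℂ → ℂ}
    (hF : IsMellinContinuation f F) (hdecay : RapidlyDecaysInStrips F) {σ x : ℝ} (hσ : 0 < σ)
    (hx : 0 < x) :
    verticalIntegral (fun s => (x : ℂ) ^ (-s) * F s) σ = 2 * Real.pi * f x := by
  have e : ∀ t : ℝ, F (σ + t * I) = mellin f (σ + t * I) := fun t => hF.2 _ (by simpa using hσ)
  have hint : VerticalIntegrable (mellin f) σ := by
    have := hF.integrable_vertical hdecay hσ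
    simp_rw [e] at this
    exact this
  have h := mellinInv_mellin_eq σ f hx (mellinConvergent_schwartz f (by simpa using hσ)) hint
    f.continuous.continuousAt
  rw [← h, mellinInv, verticalIntegral]
  simp_rw [e]
  rw [Complex.real_smul]
  push_cast
  rw [← mul_assoc, mul_one_div_cancel two_pi_ne_zero', one_mul]
  rfl

/-! ### The transform of `f` with the kernel -/

/-- The integrand of the Mellin-Barnes integral for the transform of `f` with `voronoiKernel`. -/
def dualIntegrand (a : ℂ) (F : ℂ → ℂ) (x : ℝ) (w : ℂ) : ℂ := mellinBarnes a x w * F (1 - w)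

theorem quadraticDecay_dualIntegrand (a : ℂ) {F : ℂ → ℂ} (hdecay : RapidlyDecaysInStrips F) {x : ℝ}
    (hx : 0 < x) (σ₁ σ₂ : ℝ) : QuadraticDecay (dualIntegrand a F x) σ₁ σ₂ :=
  (((polynomialGrowth_chi _ _).mul (polynomialGrowth_chi _ _).comp_add).mul
    (polynomialGrowth_cpow_neg hx _ _)).mul_rapidlyDecays
    (RapidlyDecaysInStrips.comp_one_sub hdecay)

theorem differentiableAt_chi_of_re_pos {w : ℂ} (h₁ : 0 < w.re) (h₂ : w.re < 2) :
    DifferentiableAt ℂ chi w := by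
  refine differentiableAt_chi (sin_ne_zero_of_re ?_ (abs_lt.2 ⟨by linarith, h₂⟩))
  rintro rfl
  simp at h₁

section

variable {a : ℂ} {f : 𝓢(ℝ, ℂ)} {F : ℂ → ℂ}

/-- The pole of `F(1 - w)` at `w = 1` is the only candidate, and its residue contains the factor
`chi 1 = 0`. -/
theorem verticalIntegral_dualIntegrand_shift_right (h₁ : -(1 / 2 : ℝ) < a.re) (h₂ : a.re < 1 / 2)
    (hF : IsMellinContinuation f F) (hdecay : RapidlyDecaysInStrips F) {x : ℝ} (hx : 0 < x) :
    verticalIntegral (dualIntegrand a F x) (3 / 2) =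
      verticalIntegral (dualIntegrand a F x) (1 / 2) := by
  have hx0 : (x : ℂ) ≠ 0 := by exact_mod_cast hx.ne'
  have h := verticalIntegral_sub_of_simplePole (g := dualIntegrand a F x)
    (h := fun w => -(mellinBarnes a x w * mellinReg f (1 - w))) (σ₁ := 1 / 2) (σ₂ := 3 / 2)
    (p := 1) (by norm_num) (by norm_num) ?_ (quadraticDecay_dualIntegrand a hdecay hx _ _) ?_
  · rw [mellinBarnes, chi_one] at h
    simpa [sub_eq_zero] using h
  · intro w hw
    have hw1 := hw.1
    have hw2 := hw.2
    have d1 : DifferentiableAt ℂ (fun w : ℂ => chi (w + a)) w :=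
      (differentiableAt_chi_of_re_pos (by rw [add_re]; linarith)
        (by rw [add_re]; linarith)).comp w (f := fun w : ℂ => w + a) (by fun_prop)
    have d2 : DifferentiableAt ℂ (fun w : ℂ => mellinReg f (1 - w)) w :=
      (differentiableAt_mellinReg f (by rw [sub_re, one_re]; linarith)).comp w
        (f := fun w : ℂ => 1 - w) (by fun_prop)
    exact ((((differentiableAt_chi_of_re_pos (by linarith) (by linarith)).mul d1).mul
      (differentiableAt_id.neg.const_cpow (Or.inl hx0))).mul d2).neg.differentiableWithinAt
  · intro w hw hw1
    have hw2 := hw.2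
    have h3 : w - 1 ≠ 0 := sub_ne_zero.2 hw1
    have h4 : 1 - w ≠ 0 := sub_ne_zero.2 hw1.symm
    rw [dualIntegrand, hF.eq_mellinReg_div (by rw [sub_re, one_re]; linarith) h4,
      show w - 1 = -(1 - w) by ring, neg_div_neg_eq, mul_div_assoc]

/-- Here `F(1 - w)` is holomorphic; the poles come from `χ(w)` at `0` and `χ(w + a)` at `-a`. -/
theorem verticalIntegral_dualIntegrand_shift_left (h₁ : -(1 / 2 : ℝ) < a.re) (h₂ : a.re < 1 / 2)
    (hF : IsMellinContinuation f F) (hdecay : RapidlyDecaysInStrips F) {x : ℝ} (hx : 0 < x) :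
    verticalIntegral (dualIntegrand a F x) (1 / 2) -
      verticalIntegral (dualIntegrand a F x) (-(3 / 2)) =
    2 * Real.pi * dslope (fun w => mellinBarnesReg a x 0 w * F (1 - w)) 0 (-a) := by
  refine verticalIntegral_sub_of_twoPoles (by norm_num) (by norm_num)
    (by rw [neg_re]; linarith) (by rw [neg_re]; linarith) ?_
    (quadraticDecay_dualIntegrand a hdecay hx _ _) ?_
  · intro w hw
    have hw1 := hw.1
    have hw2 := hw.2
    have d2 : DifferentiableAt ℂ (fun w : ℂ => F (1 - w)) w :=
      (hF.differentiableAt (by rw [sub_re, one_re]; linarith)).comp w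
        (f := fun w : ℂ => 1 - w) (by fun_prop)
    refine ((differentiableAt_mellinBarnesReg hx ?_ ?_).mul d2).differentiableWithinAt
    · simpa using abs_lt.2 ⟨by linarith, by linarith⟩
    · simpa using abs_lt.2 ⟨by linarith, by linarith⟩
  · intro w _ hp hq
    rw [dualIntegrand, mellinBarnes_eq_div 0 (by simpa using hp) (by simpa using hq)]
    simp only [Nat.cast_zero, mul_zero, neg_zero, sub_zero]
    rw [div_mul_eq_mul_div]

theorem mellinBarnes_mul {x y : ℝ} (hx : 0 < x) (hy : 0 < y) (w : ℂ) :
    mellinBarnes a (x * y) w = mellinBarnes a x w * (y : ℂ) ^ (-w) := by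
  rw [mellinBarnes, mellinBarnes, ofReal_mul, mul_cpow_ofReal_nonneg hx.le hy.le]
  ring

/-- Fubini: on `re w = -3/2` the value `F(1 - w)` is an absolutely convergent Mellin integral and
`mellinBarnes` is integrable. -/
theorem integral_mul_verticalIntegral_mellinBarnes (h₁ : -(1 / 2 : ℝ) < a.re) (h₂ : a.re < 1 / 2)
    (hF : IsMellinContinuation f F) {x : ℝ} (hx : 0 < x) :
    IntegrableOn (fun y : ℝ => f y * verticalIntegral (mellinBarnes a (x * y)) (-(3 / 2)))
      (Ioi 0) ∧
    ∫ y in Ioi (0 : ℝ), f y * verticalIntegral (mellinBarnes a (x * y)) (-(3 / 2)) =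
      verticalIntegral (dualIntegrand a F x) (-(3 / 2)) := by
  set u : ℝ → ℂ := fun t => mellinBarnes a x ((-(3 / 2) : ℝ) + t * I) with hu
  set Φ : ℝ × ℝ → ℂ := fun p => f p.1 * (p.1 : ℂ) ^ (-((-(3 / 2) : ℝ) + p.2 * I : ℂ)) * u p.2
    with hΦ
  have iu : Integrable u := integrable_mellinBarnes h₁ h₂ hx
  -- The exponent `5/2` is `re (1 - w)` on this line.
  have hf : Integrable (fun y : ℝ => (y : ℂ) ^ ((5 / 2 : ℂ) - 1) • f y)
      (volume.restrict (Ioi 0)) := mellinConvergent_schwartz f (by norm_num)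
  have hre : ((5 / 2 : ℂ) - 1).re = 3 / 2 := by norm_num
  have hmeas : Measurable Φ := by
    have hum : Measurable u := (continuous_mellinBarnes h₁ h₂ hx).measurable
    have h3 : Measurable fun p : ℝ × ℝ => (p.1 : ℂ) ^ (-((-(3 / 2) : ℝ) + p.2 * I : ℂ)) :=
      Measurable.pow (by fun_prop) (by fun_prop)
    exact ((f.continuous.measurable.comp measurable_fst).mul h3).mul (hum.comp measurable_snd)
  have hint : Integrable Φ ((volume.restrict (Ioi 0)).prod volume) := by
    refine (hf.mul_prod iu).mono hmeas.aestronglyMeasurable ?_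
    have hprod : (volume.restrict (Ioi (0 : ℝ))).prod (volume : Measure ℝ) =
        (volume.prod volume).restrict (Ioi 0 ×ˢ univ) := by
      rw [← Measure.prod_restrict, Measure.restrict_univ]
    rw [hprod]
    filter_upwards [ae_restrict_mem (measurableSet_Ioi.prod MeasurableSet.univ)] with p hp
    have hp0 : 0 < p.1 := hp.1
    simp only [hΦ, norm_mul, smul_eq_mul]
    rw [norm_cpow_eq_rpow_re_of_pos hp0, norm_cpow_eq_rpow_re_of_pos hp0, hre]
    have h : (-((-(3 / 2) : ℝ) + p.2 * I : ℂ)).re = 3 / 2 := by simp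
    rw [h, mul_comm (‖f p.1‖)]
  have e1 : ∀ y ∈ Ioi (0 : ℝ), ∫ t : ℝ, Φ (y, t) =
      f y * verticalIntegral (mellinBarnes a (x * y)) (-(3 / 2)) := by
    intro y hy
    rw [verticalIntegral, ← integral_const_mul]
    refine integral_congr_ae (Eventually.of_forall fun t => ?_)
    simp only [hΦ, hu]
    rw [mellinBarnes_mul hx hy]
    ring
  constructor
  · have := hint.integral_prod_left
    refine this.congr ?_
    filter_upwards [ae_restrict_mem measurableSet_Ioi] with y hy
    exact e1 y hy
  · rw [← setIntegral_congr_fun measurableSet_Ioi e1, integral_integral_swap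
      (f := fun y t => Φ (y, t)) hint, verticalIntegral]
    refine integral_congr_ae (Eventually.of_forall fun t => ?_)
    simp only [hΦ]
    rw [integral_mul_const, dualIntegrand, hF.2 _ (by simp; norm_num), mellin, mul_comm]
    congr 1
    refine setIntegral_congr_fun measurableSet_Ioi fun y _ => ?_
    simp only [smul_eq_mul]
    rw [mul_comm]
    congr 2
    ring

/-- The residue is a combination of `1` and `y^a`, integrating to `F(1)` and `F(1+a)`; at `a = 0` it
involves `1` and `log y`, and the logarithm gives `F'(1)`. -/
theorem integral_mul_dslope_mellinBarnesReg (h₁ : -(1 / 2 : ℝ) < a.re)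
    (hF : IsMellinContinuation f F) {x : ℝ} (hx : 0 < x) :
    IntegrableOn (fun y : ℝ => f y * dslope (mellinBarnesReg a (x * y) 0) 0 (-a)) (Ioi 0) ∧
    ∫ y in Ioi (0 : ℝ), f y * dslope (mellinBarnesReg a (x * y) 0) 0 (-a) =
      dslope (fun w => mellinBarnesReg a x 0 w * F (1 - w)) 0 (-a) := by
  have h0 : chiReg 0 0 = 2 := by simpa using chiReg_neg_two_mul 0
  have i1 := mellinConvergent_schwartz f (s := 1) (by simp)
  have v1 : ∫ y in Ioi (0 : ℝ), (y : ℂ) ^ ((1 : ℂ) - 1) • f y = F 1 := (hF.2 1 (by simp)).symm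
  rcases ne_or_eq a 0 with h | rfl
  · have hre : 0 < (1 + a).re := by rw [add_re, one_re]; linarith
    have i2 := mellinConvergent_schwartz f hre
    have v2 : ∫ y in Ioi (0 : ℝ), (y : ℂ) ^ ((1 + a) - 1) • f y = F (1 + a) :=
      (hF.2 (1 + a) hre).symm
    have e : ∀ y ∈ Ioi (0 : ℝ), 2 / a * chiReg 0 a * ((y : ℂ) ^ ((1 : ℂ) - 1) • f y) -
        2 / a * chiReg 0 (-a) * (x : ℂ) ^ a * ((y : ℂ) ^ ((1 + a) - 1) • f y) =
        f y * dslope (mellinBarnesReg a (x * y) 0) 0 (-a) := by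
      intro y hy
      have hy' : 0 < y := hy
      rw [dslope_mellinBarnesReg_of_ne_zero h, ofReal_mul,
        mul_cpow_ofReal_nonneg hx.le hy'.le, sub_self, cpow_zero, add_sub_cancel_left]
      simp only [smul_eq_mul]
      ring
    have hi := (i1.const_mul (2 / a * chiReg 0 a)).sub
      (i2.const_mul (2 / a * chiReg 0 (-a) * (x : ℂ) ^ a))
    constructor
    · refine hi.congr ?_
      filter_upwards [ae_restrict_mem measurableSet_Ioi] with y hy
      exact e y hy
    · rw [← setIntegral_congr_fun measurableSet_Ioi e, integral_sub
        (i1.const_mul (2 / a * chiReg 0 a)) (i2.const_mul (2 / a * chiReg 0 (-a) * (x : ℂ) ^ a)),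
        integral_const_mul, integral_const_mul, v1, v2, dslope_of_ne _ (neg_ne_zero.2 h),
        slope_def_field]
      simp only [mellinBarnesReg, neg_add_cancel, zero_add, neg_neg, neg_zero, cpow_zero, mul_one,
        sub_zero, h0, sub_neg_eq_add]
      field_simp
      ring
  · obtain ⟨i2, -⟩ := hasDerivAt_mellin_schwartz f (s := 1) (by simp)
    have hFd := hF.hasDerivAt (s := 1) (by simp)
    have e : ∀ y ∈ Ioi (0 : ℝ), (4 * deriv (chiReg 0) 0 - 4 * Complex.log x) *
        ((y : ℂ) ^ ((1 : ℂ) - 1) • f y) - 4 * ((y : ℂ) ^ ((1 : ℂ) - 1) • (Real.log y • f y)) =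
        f y * dslope (mellinBarnesReg 0 (x * y) 0) 0 (-0) := by
      intro y hy
      have hy' : 0 < y := hy
      rw [neg_zero, dslope_mellinBarnesReg_zero (mul_pos hx hy'), ← ofReal_log (mul_pos hx hy').le,
        Real.log_mul hx.ne' hy'.ne', ofReal_add, ofReal_log hx.le, sub_self, cpow_zero,
        Complex.real_smul]
      simp only [smul_eq_mul]
      ring
    have hi := (i1.const_mul (4 * deriv (chiReg 0) 0 - 4 * Complex.log x)).sub (i2.const_mul 4)
    constructor
    · refine hi.congr ?_
      filter_upwards [ae_restrict_mem measurableSet_Ioi] with y hy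
      exact e y hy
    · have hd : HasDerivAt (fun w : ℂ => F (1 - w))
          (-mellin (fun t => Real.log t • f t) 1) 0 := by
        have h3 : HasDerivAt F (mellin (fun t => Real.log t • f t) 1) (1 - 0) := by
          simpa using hFd
        exact (h3.comp (0 : ℂ) ((hasDerivAt_id (0 : ℂ)).const_sub 1)).congr_deriv (by ring)
      have hm : HasDerivAt (mellinBarnesReg 0 x 0)
          (4 * deriv (chiReg 0) 0 - 4 * Complex.log x) 0 := by
        rw [← dslope_mellinBarnesReg_zero hx, dslope_same]
        exact (differentiableAt_mellinBarnesReg hx (by simp) (by simp)).hasDerivAt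
      have hmd : HasDerivAt (fun w => mellinBarnesReg 0 x 0 w * F (1 - w)) _ 0 := hm.mul hd
      have h4 : mellinBarnesReg 0 x 0 0 = 4 := by
        rw [mellinBarnesReg, add_zero, h0, neg_zero, cpow_zero]
        norm_num
      rw [← setIntegral_congr_fun measurableSet_Ioi e, integral_sub
        (i1.const_mul (4 * deriv (chiReg 0) 0 - 4 * Complex.log x)) (i2.const_mul 4),
        integral_const_mul, integral_const_mul, v1, neg_zero, dslope_same, hmd.deriv, h4,
        sub_zero]
      rw [mellin]
      ring

/-- The transform of `f` with the kernel, as a Mellin-Barnes integral. -/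
theorem integral_mul_voronoiKernel (h₁ : -(1 / 2 : ℝ) < a.re) (h₂ : a.re < 1 / 2)
    (hF : IsMellinContinuation f F) (hdecay : RapidlyDecaysInStrips F) {x : ℝ} (hx : 0 < x) :
    IntegrableOn (fun y : ℝ => f y * voronoiKernel a (x * y)) (Ioi 0) ∧
    ∫ y in Ioi (0 : ℝ), f y * voronoiKernel a (x * y) =
      1 / (2 * Real.pi) * verticalIntegral (dualIntegrand a F x) (3 / 2) := by
  obtain ⟨i1, v1⟩ := integral_mul_dslope_mellinBarnesReg h₁ hF hx
  obtain ⟨i2, v2⟩ := integral_mul_verticalIntegral_mellinBarnes h₁ h₂ hF hx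
  have i2' := i2.const_mul (1 / (2 * Real.pi) : ℂ)
  have e : ∀ y ∈ Ioi (0 : ℝ), f y * dslope (mellinBarnesReg a (x * y) 0) 0 (-a) +
      1 / (2 * Real.pi) * (f y * verticalIntegral (mellinBarnes a (x * y)) (-(3 / 2))) =
      f y * voronoiKernel a (x * y) := by
    intro y hy
    rw [voronoiKernel_eq h₁ h₂ (mul_pos hx hy)]
    ring
  constructor
  · refine (i1.add i2').congr ?_
    filter_upwards [ae_restrict_mem measurableSet_Ioi] with y hy
    exact e y hy
  · have s1 := verticalIntegral_dualIntegrand_shift_right h₁ h₂ hF hdecay hx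
    have s2 := verticalIntegral_dualIntegrand_shift_left h₁ h₂ hF hdecay hx
    have s3 : dslope (fun w => mellinBarnesReg a x 0 w * F (1 - w)) 0 (-a) = 1 / (2 * Real.pi) *
        (verticalIntegral (dualIntegrand a F x) (1 / 2) -
          verticalIntegral (dualIntegrand a F x) (-(3 / 2))) := by
      rw [s2, one_div, inv_mul_cancel_left₀ two_pi_ne_zero']
    rw [← setIntegral_congr_fun measurableSet_Ioi e, integral_add i1 i2', integral_const_mul, v1,
      v2, s3, s1]
    ring

end

/-! ### Shifting the line for `∑ σ_a(n) f(n)`, and the dual series -/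

/-- The integrand of the Mellin-Barnes integral for `∑ σ_a(n) f(n)`. -/
def sigmaIntegrand (a : ℂ) (F : ℂ → ℂ) (s : ℂ) : ℂ := riemannZeta s * riemannZeta (s - a) * F s

/-- The numerator of `sigmaIntegrand` over its poles at `1` and `1 + a`. -/
def sigmaIntegrandReg (a : ℂ) (F : ℂ → ℂ) (s : ℂ) : ℂ :=
  riemannZeta₁ s * riemannZeta₁ (s - a) * F s

theorem riemannZeta₁_eq_mul {s : ℂ} (hs : s ≠ 1) : riemannZeta₁ s = (s - 1) * riemannZeta s := by
  rw [riemannZeta_eq_inv_sub_mul hs, mul_inv_cancel_left₀ (sub_ne_zero.2 hs)]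

section

variable {a : ℂ} {f : 𝓢(ℝ, ℂ)} {F : ℂ → ℂ}

theorem quadraticDecay_sigmaIntegrand (h₁ : -(1 / 2 : ℝ) < a.re) (h₂ : a.re < 1 / 2)
    (hdecay : RapidlyDecaysInStrips F) {σ₁ σ₂ : ℝ} (hσ₁ : -(1 / 2) ≤ σ₁) (hσ₂ : σ₂ ≤ 3 / 2) :
    QuadraticDecay (sigmaIntegrand a F) σ₁ σ₂ := by
  have h : PolynomialGrowth (fun s => riemannZeta (s - a)) σ₁ σ₂ := by
    simp_rw [sub_eq_add_neg]
    refine PolynomialGrowth.comp_add (polynomialGrowth_riemannZeta.mono ?_ ?_) <;>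
      rw [neg_re] <;> linarith
  exact ((polynomialGrowth_riemannZeta.mono (by linarith) (by linarith)).mul h).mul_rapidlyDecays
    hdecay

theorem verticalIntegral_sigmaIntegrand_shift_right (h₁ : -(1 / 2 : ℝ) < a.re) (h₂ : a.re < 1 / 2)
    (hF : IsMellinContinuation f F) (hdecay : RapidlyDecaysInStrips F) :
    verticalIntegral (sigmaIntegrand a F) (3 / 2) - verticalIntegral (sigmaIntegrand a F) (1 / 2) =
      2 * Real.pi * dslope (sigmaIntegrandReg a F) 1 (1 + a) := by
  refine verticalIntegral_sub_of_twoPoles (by norm_num) (by norm_num)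
    (by rw [add_re, one_re]; linarith) (by rw [add_re, one_re]; linarith) ?_
    (quadraticDecay_sigmaIntegrand h₁ h₂ hdecay (by norm_num) le_rfl) ?_
  · intro s hs
    have hs1 := hs.1
    have d2 : DifferentiableAt ℂ (fun s : ℂ => riemannZeta₁ (s - a)) s :=
      (differentiable_riemannZeta₁ (s - a)).comp s (f := fun s : ℂ => s - a) (by fun_prop)
    exact (((differentiable_riemannZeta₁ s).mul d2).mul
      (hF.differentiableAt (by linarith))).differentiableWithinAt
  · intro s _ hp hq
    have hq' : s - a ≠ 1 := fun h => hq (by rw [← h, sub_add_cancel])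
    have h3 : s - 1 ≠ 0 := sub_ne_zero.2 hp
    have h4 : s - (1 + a) ≠ 0 := sub_ne_zero.2 hq
    rw [sigmaIntegrand, sigmaIntegrandReg, riemannZeta₁_eq_mul hp, riemannZeta₁_eq_mul hq',
      eq_div_iff (mul_ne_zero h3 h4)]
    ring

/-- Both zeta factors are holomorphic in this strip. Only the pole of `F` at `0` is crossed, and
`ζ(0) = -1/2`. -/
theorem verticalIntegral_sigmaIntegrand_shift_left (h₁ : -(1 / 2 : ℝ) < a.re) (h₂ : a.re < 1 / 2)
    (hF : IsMellinContinuation f F) (hdecay : RapidlyDecaysInStrips F) :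
    verticalIntegral (sigmaIntegrand a F) (1 / 2) -
      verticalIntegral (sigmaIntegrand a F) (-(1 / 2)) =
      2 * Real.pi * (-(1 / 2) * riemannZeta (-a) * f 0) := by
  have h := verticalIntegral_sub_of_simplePole (g := sigmaIntegrand a F)
    (h := fun s => riemannZeta s * riemannZeta (s - a) * mellinReg f s) (σ₁ := -(1 / 2))
    (σ₂ := 1 / 2) (p := 0) (by norm_num) (by norm_num) ?_
    (quadraticDecay_sigmaIntegrand h₁ h₂ hdecay le_rfl (by norm_num)) ?_
  · rw [h, riemannZeta_zero, zero_sub, mellinReg_zero]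
    ring
  · intro s hs
    have hs1 := hs.1
    have hs2 := hs.2
    have d1 : DifferentiableAt ℂ riemannZeta s := by
      refine differentiableAt_riemannZeta ?_
      rintro rfl
      rw [one_re] at hs2
      linarith
    have d2 : DifferentiableAt ℂ (fun s : ℂ => riemannZeta (s - a)) s := by
      refine DifferentiableAt.comp s (f := fun s : ℂ => s - a) (differentiableAt_riemannZeta ?_)
        (by fun_prop)
      intro h
      have := congrArg re h
      rw [sub_re, one_re] at this
      linarith
    exact ((d1.mul d2).mul (differentiableAt_mellinReg f (by linarith))).differentiableWithinAt
  · intro s hs hs0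
    rw [sigmaIntegrand, hF.eq_mellinReg_div (by linarith [hs.1]) hs0, sub_zero, mul_div_assoc]

/-- For `a ≠ 0` the residues at `1` and `1 + a` are `ζ(1-a) F(1)` and `ζ(1+a) F(1+a)`. For `a = 0`
the product rule with `riemannZeta₁ 1 = 1` and derivative `γ` there gives `2γ F(1) + F'(1)`. -/
theorem integral_mainDensity_mul (h₁ : -(1 / 2 : ℝ) < a.re) (hF : IsMellinContinuation f F) :
    IntegrableOn (fun t : ℝ => mainDensity a t * f t) (Ioi 0) ∧
    ∫ t in Ioi (0 : ℝ), mainDensity a t * f t = dslope (sigmaIntegrandReg a F) 1 (1 + a) := by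
  have i1 := mellinConvergent_schwartz f (s := 1) (by simp)
  have v1 : ∫ y in Ioi (0 : ℝ), (y : ℂ) ^ ((1 : ℂ) - 1) • f y = F 1 := (hF.2 1 (by simp)).symm
  rcases ne_or_eq a 0 with h | rfl
  · have hre : 0 < (1 + a).re := by rw [add_re, one_re]; linarith
    have i2 := mellinConvergent_schwartz f hre
    have v2 : ∫ y in Ioi (0 : ℝ), (y : ℂ) ^ ((1 + a) - 1) • f y = F (1 + a) :=
      (hF.2 (1 + a) hre).symm
    have e : ∀ y ∈ Ioi (0 : ℝ), riemannZeta (1 - a) * ((y : ℂ) ^ ((1 : ℂ) - 1) • f y) +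
        riemannZeta (1 + a) * ((y : ℂ) ^ ((1 + a) - 1) • f y) = mainDensity a y * f y := by
      intro y _
      rw [mainDensity, if_neg h, sub_self, cpow_zero, add_sub_cancel_left]
      simp only [smul_eq_mul]
      ring
    have j1 := i1.const_mul (riemannZeta (1 - a))
    have j2 := i2.const_mul (riemannZeta (1 + a))
    constructor
    · refine (j1.add j2).congr ?_
      filter_upwards [ae_restrict_mem measurableSet_Ioi] with y hy
      exact e y hy
    · have n1 : 1 + a ≠ 1 := by simpa using h
      have n2 : 1 - a ≠ 1 := by simpa using h
      rw [← setIntegral_congr_fun measurableSet_Ioi e, integral_add j1 j2, integral_const_mul,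
        integral_const_mul, v1, v2, dslope_of_ne _ n1, slope_def_field, sigmaIntegrandReg,
        sigmaIntegrandReg, add_sub_cancel_right, riemannZeta₁_one, riemannZeta₁_eq_mul n1,
        riemannZeta₁_eq_mul n2]
      field_simp
      ring
  · obtain ⟨i2, -⟩ := hasDerivAt_mellin_schwartz f (s := 1) (by simp)
    have hFd := hF.hasDerivAt (s := 1) (by simp)
    have e : ∀ y ∈ Ioi (0 : ℝ), (2 * Real.eulerMascheroniConstant : ℂ) *
        ((y : ℂ) ^ ((1 : ℂ) - 1) • f y) + (y : ℂ) ^ ((1 : ℂ) - 1) • (Real.log y • f y) =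
        mainDensity 0 y * f y := by
      intro y _
      rw [mainDensity, if_pos rfl, sub_self, cpow_zero, Complex.real_smul]
      simp only [smul_eq_mul]
      ring
    have j1 := i1.const_mul (2 * Real.eulerMascheroniConstant : ℂ)
    constructor
    · refine (j1.add i2).congr ?_
      filter_upwards [ae_restrict_mem measurableSet_Ioi] with y hy
      exact e y hy
    · have hz : HasDerivAt riemannZeta₁ (Real.eulerMascheroniConstant : ℂ) 1 := by
        rw [← deriv_riemannZeta₁_one]
        exact (differentiable_riemannZeta₁ 1).hasDerivAt
      have hd : HasDerivAt (sigmaIntegrandReg 0 F)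
          (2 * Real.eulerMascheroniConstant * F 1 + mellin (fun t => Real.log t • f t) 1) 1 := by
        refine (((hz.mul hz).mul hFd).congr_deriv ?_).congr_of_eventuallyEq
          (Eventually.of_forall fun s => ?_)
        · rw [Pi.mul_apply, riemannZeta₁_one]
          ring
        · simp [sigmaIntegrandReg]
      rw [← setIntegral_congr_fun measurableSet_Ioi e, integral_add j1 i2, integral_const_mul, v1,
        add_zero, dslope_same, hd.deriv]
      rfl

/-- On this line `1 - w` has real part `-1/2`, between the possible poles `0` and `-1` of `F`. -/
theorem continuous_dualIntegrand (h₁ : -(1 / 2 : ℝ) < a.re) (h₂ : a.re < 1 / 2)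
    (hF : IsMellinContinuation f F) {x : ℝ} (hx : 0 < x) :
    Continuous fun t : ℝ => dualIntegrand a F x ((3 / 2 : ℝ) + t * I) := by
  have hx0 : (x : ℂ) ≠ 0 := by exact_mod_cast hx.ne'
  rw [continuous_iff_continuousAt]
  intro t
  set w : ℂ := (3 / 2 : ℝ) + t * I with hw
  have hre : w.re = 3 / 2 := by simp [hw]
  have d1 : DifferentiableAt ℂ (fun w : ℂ => chi (w + a)) w :=
    (differentiableAt_chi_of_re_pos (by rw [add_re]; linarith)
      (by rw [add_re]; linarith)).comp w (f := fun w : ℂ => w + a) (by fun_prop)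
  have d2 : DifferentiableAt ℂ (fun w : ℂ => F (1 - w)) w := by
    refine DifferentiableAt.comp w (f := fun w : ℂ => 1 - w) (hF.1.differentiableAt ?_)
      (by fun_prop)
    have hn : {z : ℂ | -1 < z.re} ∩ {z : ℂ | z.re < 0} ∈ 𝓝 (1 - w) :=
      ((isOpen_lt continuous_const continuous_re).inter
        (isOpen_lt continuous_re continuous_const)).mem_nhds
        ⟨by simp [hre]; norm_num, by simp [hre]; norm_num⟩
    filter_upwards [hn] with z hz n hzn
    have h3 : -1 < z.re := hz.1
    have h4 : z.re < 0 := hz.2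
    rw [hzn, neg_re, natCast_re] at h3 h4
    have h5 : (n : ℝ) < 1 := by linarith
    have h6 : n = 0 := by exact_mod_cast Nat.lt_one_iff.1 (by exact_mod_cast h5)
    simp [h6] at h4
  have d : DifferentiableAt ℂ (dualIntegrand a F x) w :=
    (((differentiableAt_chi_of_re_pos (by linarith) (by linarith)).mul d1).mul
      (differentiableAt_id.neg.const_cpow (Or.inl hx0))).mul d2
  exact d.continuousAt.comp (f := fun t : ℝ => ((3 / 2 : ℝ) + t * I : ℂ))
    (Continuous.continuousAt (by fun_prop))

/-- The functional equation of `ζ` on the left line of integration. -/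
theorem verticalIntegral_sigmaIntegrand_neg (h₁ : -(1 / 2 : ℝ) < a.re) (h₂ : a.re < 1 / 2) :
    verticalIntegral (sigmaIntegrand a F) (-(1 / 2)) =
      verticalIntegral (fun w => riemannZeta w * riemannZeta (w - -a) * dualIntegrand a F 1 w)
        (3 / 2) := by
  rw [verticalIntegral, verticalIntegral, ← integral_neg_eq_self]
  refine integral_congr_ae (Eventually.of_forall fun t => ?_)
  simp only
  set w : ℂ := (3 / 2 : ℝ) + t * I with hw
  have hre : w.re = 3 / 2 := by simp [hw]
  have e1 : ((-(1 / 2) : ℝ) + (-t : ℝ) * I : ℂ) = 1 - w := by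
    rw [hw]
    push_cast
    ring
  -- Both `w` and `w + a` have real part strictly between `1` and `2`, so the functional equation
  -- holds without exceptional points.
  have ne_int : ∀ z : ℂ, 1 < z.re → z.re < 2 → ∀ n : ℤ, z ≠ n := by
    rintro z h3 h4 n rfl
    rw [intCast_re] at h3 h4
    have h5 : 1 < n := by exact_mod_cast h3
    have h6 : n < 2 := by exact_mod_cast h4
    omega
  rw [e1, sigmaIntegrand, dualIntegrand, mellinBarnes, show 1 - w - a = 1 - (w + a) by ring,
    riemannZeta_one_sub_eq_chi_mul (ne_int w (by linarith) (by linarith)),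
    riemannZeta_one_sub_eq_chi_mul (ne_int (w + a) (by rw [add_re]; linarith)
      (by rw [add_re]; linarith)), sub_neg_eq_add, ofReal_one, one_cpow]
  ring

theorem hasSum_sigma_mul_schwartz (h₂ : a.re < 1 / 2) (hF : IsMellinContinuation f F)
    (hdecay : RapidlyDecaysInStrips F) :
    HasSum (fun n : ℕ+ => sigma a n * f (n : ℝ))
      (1 / (2 * Real.pi) * verticalIntegral (sigmaIntegrand a F) (3 / 2)) := by
  have h := (hasSum_sigma_mul_verticalIntegral (b := a) (σ := 3 / 2) (by norm_num) (by linarith)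
    (hF.integrable_vertical hdecay (by norm_num))).mul_left (1 / (2 * Real.pi) : ℂ)
  refine h.congr_fun fun n => ?_
  have hn : (0 : ℝ) < n := by exact_mod_cast n.pos
  have h3 := hF.inversion hdecay (σ := 3 / 2) (by norm_num) hn
  push_cast at h3
  rw [h3, one_div, mul_left_comm, inv_mul_cancel_left₀ two_pi_ne_zero']

theorem hasSum_sigma_neg_mul_integral (h₁ : -(1 / 2 : ℝ) < a.re) (h₂ : a.re < 1 / 2)
    (hF : IsMellinContinuation f F) (hdecay : RapidlyDecaysInStrips F) :
    HasSum (fun n : ℕ+ => sigma (-a) n * ∫ y in Ioi (0 : ℝ), f y * voronoiKernel a (n * y))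
      (1 / (2 * Real.pi) * verticalIntegral (sigmaIntegrand a F) (-(1 / 2))) := by
  have hint : Integrable fun t : ℝ => dualIntegrand a F 1 ((3 / 2 : ℝ) + t * I) :=
    integrable_vertical (right_mem_Icc.2 le_rfl) (continuous_dualIntegrand h₁ h₂ hF zero_lt_one)
      (quadraticDecay_dualIntegrand a hdecay zero_lt_one _ _)
  have h := (hasSum_sigma_mul_verticalIntegral (b := -a) (σ := 3 / 2) (by norm_num)
    (by rw [neg_re]; linarith) hint).mul_left (1 / (2 * Real.pi) : ℂ)
  rw [← verticalIntegral_sigmaIntegrand_neg h₁ h₂] at h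
  refine h.congr_fun fun n => ?_
  have hn : (0 : ℝ) < n := by exact_mod_cast n.pos
  have e : dualIntegrand a F n = fun w => (n : ℂ) ^ (-w) * dualIntegrand a F 1 w := by
    ext w
    rw [dualIntegrand, dualIntegrand, ← one_mul (n : ℝ), mellinBarnes_mul zero_lt_one hn]
    push_cast
    ring
  rw [(integral_mul_voronoiKernel h₁ h₂ hF hdecay hn).2, e]
  ring

end

/-- The involution `d ↦ n / d` of the divisors. -/
theorem sigma_mul_cpow_neg (a : ℂ) (n : ℕ+) : sigma a n * (n : ℂ) ^ (-a) = sigma (-a) n := by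
  rw [sigma, sigma, ← Nat.sum_div_divisors, Finset.sum_mul]
  refine Finset.sum_congr rfl fun d hd => ?_
  have hd' := Nat.dvd_of_mem_divisors hd
  have hd0 : d ≠ 0 := (Nat.pos_of_mem_divisors hd).ne'
  have hd1 : (d : ℂ) ≠ 0 := by exact_mod_cast hd0
  have e : (n : ℂ) = ((n / d : ℕ) : ℂ) * (d : ℂ) := by
    rw [← Nat.cast_mul, Nat.div_mul_cancel hd']
  have hq : ((n / d : ℕ) : ℂ) ≠ 0 := by
    intro h
    rw [h, zero_mul] at e
    exact n.ne_zero (by exact_mod_cast e)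
  rw [e, natCast_mul_natCast_cpow, ← mul_assoc, ← cpow_add _ _ hq, add_neg_cancel, cpow_zero,
    one_mul]

theorem cpow_mul_mul_koshliakovKernel (a : ℂ) (z : ℂ) (n : ℕ+) {y : ℝ} (hy : 0 < y) :
    (y : ℂ) ^ (a / 2) * z * koshliakovKernel a (4 * Real.pi * √((n : ℝ) * y)) =
      1 / (2 * Real.pi) * (n : ℂ) ^ (-a / 2) * (z * voronoiKernel a (n * y)) := by
  have hn : (0 : ℝ) < n := by exact_mod_cast n.pos
  have hn0 : (n : ℂ) ≠ 0 := by exact_mod_cast n.ne_zero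
  have h3 : (n : ℂ) ^ (-(a / 2)) * (n : ℂ) ^ (a / 2) = 1 := by
    rw [← cpow_add _ _ hn0, neg_add_cancel, cpow_zero]
  have h4 := two_pi_ne_zero'
  rw [voronoiKernel, neg_div, ofReal_mul, mul_cpow_ofReal_nonneg hn.le hy.le]
  push_cast
  field_simp
  linear_combination (-(y : ℂ) ^ (a / 2) * z *
    koshliakovKernel a (4 * Real.pi * √((n : ℝ) * y))) * h3

end Voronoi

end

theorem corollary1p3 (a : ℂ) (ha₁ : -(1 / 2 : ℝ) < a.re) (ha₂ : a.re < 1 / 2)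
    (f : 𝓢(ℝ, ℂ)) (F : ℂ → ℂ) (hF : Voronoi.IsMellinContinuation f F)
    (hdecay : Voronoi.RapidlyDecaysInStrips F) :
    Summable (fun n : ℕ+ => Voronoi.sigma a n * f (n : ℝ)) ∧
    MeasureTheory.IntegrableOn (fun t : ℝ => Voronoi.mainDensity a t * f t) (Set.Ioi 0) ∧
    (∀ n : ℕ+, MeasureTheory.IntegrableOn
      (fun y : ℝ => (y : ℂ) ^ (a / 2) * f y *
        Voronoi.koshliakovKernel a (4 * Real.pi * √((n : ℝ) * y))) (Set.Ioi 0)) ∧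
    Summable (fun n : ℕ+ => Voronoi.sigma a n * (n : ℂ) ^ (-a / 2) *
      ∫ y in Set.Ioi (0 : ℝ), (y : ℂ) ^ (a / 2) * f y *
        Voronoi.koshliakovKernel a (4 * Real.pi * √((n : ℝ) * y))) ∧
    ∑' n : ℕ+, Voronoi.sigma a n * f (n : ℝ) =
      (∫ t in Set.Ioi (0 : ℝ), Voronoi.mainDensity a t * f t)
        - 1 / 2 * riemannZeta (-a) * f 0
        + 2 * Real.pi * ∑' n : ℕ+, Voronoi.sigma a n * (n : ℂ) ^ (-a / 2) *
            ∫ y in Set.Ioi (0 : ℝ), (y : ℂ) ^ (a / 2) * f y *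
              Voronoi.koshliakovKernel a (4 * Real.pi * √((n : ℝ) * y)) := by
  obtain ⟨i1, v1⟩ := Voronoi.integral_mainDensity_mul ha₁ hF
  have S1 := Voronoi.hasSum_sigma_mul_schwartz ha₂ hF hdecay
  have S2 := (Voronoi.hasSum_sigma_neg_mul_integral ha₁ ha₂ hF hdecay).mul_left
    (1 / (2 * Real.pi) : ℂ)
  -- One factor `n^{-a/2}` is explicit, a second comes from `(ny)^{a/2}` in `voronoiKernel`;
  -- together they turn `sigma a` into `sigma (-a)`.
  have hterm : ∀ n : ℕ+, Voronoi.sigma a n * (n : ℂ) ^ (-a / 2) *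
      ∫ y in Set.Ioi (0 : ℝ), (y : ℂ) ^ (a / 2) * f y *
        Voronoi.koshliakovKernel a (4 * Real.pi * √((n : ℝ) * y)) =
      1 / (2 * Real.pi) * (Voronoi.sigma (-a) n *
        ∫ y in Set.Ioi (0 : ℝ), f y * Voronoi.voronoiKernel a (n * y)) := by
    intro n
    have hn0 : (n : ℂ) ≠ 0 := by exact_mod_cast n.ne_zero
    have h3 : (n : ℂ) ^ (-a / 2) * (n : ℂ) ^ (-a / 2) = (n : ℂ) ^ (-a) := by
      rw [← Complex.cpow_add _ _ hn0, add_halves]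
    rw [MeasureTheory.setIntegral_congr_fun measurableSet_Ioi fun y hy =>
      Voronoi.cpow_mul_mul_koshliakovKernel a (f y) n hy, MeasureTheory.integral_const_mul,
      ← Voronoi.sigma_mul_cpow_neg, ← h3]
    ring
  have S3 := S2.congr_fun hterm
  refine ⟨S1.summable, i1, fun n => ?_, S3.summable, ?_⟩
  · have hn : (0 : ℝ) < n := by exact_mod_cast n.pos
    have h3 := ((Voronoi.integral_mul_voronoiKernel ha₁ ha₂ hF hdecay hn).1.const_mul
      (1 / (2 * Real.pi) * (n : ℂ) ^ (-a / 2)))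
    refine h3.congr ?_
    filter_upwards [MeasureTheory.ae_restrict_mem measurableSet_Ioi] with y hy
    exact (Voronoi.cpow_mul_mul_koshliakovKernel a (f y) n hy).symm
  · have h3 := Voronoi.verticalIntegral_sigmaIntegrand_shift_right ha₁ ha₂ hF hdecay
    have h4 := Voronoi.verticalIntegral_sigmaIntegrand_shift_left ha₁ ha₂ hF hdecay
    have h5 := Voronoi.two_pi_ne_zero'
    rw [S1.tsum_eq, S3.tsum_eq, v1]
    rw [show Voronoi.verticalIntegral (Voronoi.sigmaIntegrand a F) (3 / 2) = _ from
      eq_add_of_sub_eq h3, eq_add_of_sub_eq h4]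
    field_simp
    ring
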